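/- Let $n\ge 0$ and let $[\overline n]=\{1<2<\dots<n<\overline n<\dots<\overline 2<\overline 1\}$, with $\overline{\overline{\imath}}=i$ and $|i|=|\overline{\imath}|=i$. Let $W=B_n$ be the group of signed permutations, i.e. bijections $w$ of $[\overline n]$ with $w(\overline{x})=\overline{w(x)}$, with length $\ell(w)=\#\{(k,l)\in[n]\times[\overline n]: k\le |l|,\ w(k)>w(l)\}$. For $i<j$ in $[n]$ write $(i,j)$, $(i,\overline{\jmath})$ and, for $i\in[n]$, $(i,\overline{\imath})$ both for the positive roots $\varepsilon_i-\varepsilon_j$, $\varepsilon_i+\varepsilon_j$, $2\varepsilon_i$ of type $C_n$ and for the corresponding reflections $t_{ij}t_{\overline{\jmath}\,\overline{\imath}}$, $t_{i\overline{\jmath}}t_{j\overline{\imath}}$, $t_{i\overline{\imath}}$; let $\rho=(n,n-1,\dots,1)$ and $\alpha^\vee=2\alpha/\langle\alpha,\alpha\rangle$. The Bruhat order on $W$ is generated by $u<us_\alpha$ for positive roots $\alpha$ with $\ell(u)<\ell(us_\alpha)$. The quantum Bruhat graph has an edge $w\xrightarrow{\alpha}ws_\alpha$, for a positive root $\alpha$,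 whenever $\ell(ws_\alpha)=\ell(w)+1$ or $\ell(ws_\alpha)=\ell(w)-2\langle\rho,\alpha^\vee\rangle+1$. For $1\le k\le n$ let $\Gamma(k)=\Gamma_r(k)\Gamma_l(k)$ be the sequence of roots with $\Gamma_r(k)=\Gamma_2\cdots\Gamma_k$, $\Gamma_l(k)=\Gamma_{k1}\cdots\Gamma_{kk}$, where $\Gamma_i=((1,\overline{\imath}),\dots,(i-1,\overline{\imath}))$ and $$\Gamma_{ki}=\big((1,\overline{\imath}),\dots,(i-1,\overline{\imath}),\ (i,\overline{k+1}),\dots,(i,\overline{n}),\ (i,\overline{\imath}),\ (i,n),(i,n-1),\dots,(i,k+1)\big).$$ Let $\mu=(\mu_1\ge\dots\ge\mu_n\ge0)$ be a partition with conjugate $\mu'$, and let $\Gamma=\Gamma^{\mu_1}\cdots\Gamma^1=(\beta_1,\dots,\beta_m)$ with $\Gamma^j=\Gamma(\mu'_j)$. A folding pair is a pair $(w,J)$ with $w\in W$ and $J=\{j_1<\dots<j_s\}\subseteq\{1,\dots,m\}$; put $w_i=w\,s_{\beta_{j_1}}\cdots s_{\beta_{j_i}}$, ${\rm end}(w,J)=w_s$,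 and $J^-=\{j_i: w_{i-1}<w_i\}$ (in Bruhat order). Let $\overline{\mathcal F}(\mu)$ be the set of folding pairs with $$\tfrac12\big(\ell(w)+\ell({\rm end}(w,J))-\#J\big)+\sum_{j\in J^-}\langle\rho,\beta_j^\vee\rangle=0 .$$ For a folding pair $(w,J)$ and $1\le j\le\mu_1$, let $\pi^j_r$ (resp. $\pi^j_l$) be the product of $w$ with the reflections $s_{\beta_p}$, for $p\in J$ in increasing order, over those $p$ lying in the part $\Gamma^{\mu_1}\cdots\Gamma^{j+1}$ (resp. $\Gamma^{\mu_1}\cdots\Gamma^{j+1}\Gamma_r(\mu_j')$) of $\Gamma$. The filling map $f$ sends $(w,J)$ to the filling $C_r^{\mu_1}C_l^{\mu_1}\cdots C_r^1C_l^1$ of the shape $2\mu$ by columns, where $C^j_r=\pi^j_r(1)\cdots\pi^j_r(\mu'_j)$ and $C^j_l=\pi^j_l(1)\cdots\pi^j_l(\mu'_j)$. The map ${\rm ord}$ sorts each column of a filling increasingly. A strictly increasing column $C$ of height $k$ with entries in $[\overline n]$, in which $z_1>\dots>z_r$ are the letters $z\in[n]$ with both $z$ and $\overline z$ in $C$, is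 a Kashiwara–Nakashima (KN) column if there are $t_1>\dots>t_r$ in $[n]$ such that, for each $i$, $t_i$ is the greatest $t\in[n]$ with $t<z_i$, $t<t_{i-1}$ (if $i\ge2$), $t\notin C$ and $\overline t\notin C$. Then $rC$ (resp. $lC$) is obtained from $C$ by changing every $\overline{z_i}$ into $\overline{t_i}$ (resp. every $z_i$ into $t_i$) and sorting. Let $B_\mu$, the tensor product of KN columns of heights $\mu'_{\mu_1},\dots,\mu'_1$ realized by split columns, be the set of fillings $D_r^{\mu_1}D_l^{\mu_1}\cdots D_r^1D_l^1$ of the shape $2\mu$ such that, for each $j$, $(D_r^j,D_l^j)=(rD^j,lD^j)$ for some KN column $D^j$ of height $\mu'_j$. **Theorem.** A folding pair $(w,J)$ belongs to $\overline{\mathcal F}(\mu)$ if and only if ${\rm end}(w,J)=1$ and $w=w_0\xleftarrow{\beta_{j_1}}w_1\xleftarrow{\beta_{j_2}}\cdots\xleftarrow{\beta_{j_s}}w_s=1$ is a path in the quantum Bruhat graph. The composite ${\rm ord}\circ f$ restricts to a bijection from $\overline{\mathcal F}(\mu)$ onto $B_\mu$. -/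

import Mathlib

namespace TypeC

/-- The alphabet `1 < 2 < ⋯ < n < n̄ < ⋯ < 2̄ < 1̄`, as a chain of `2 n` elements. The (0-based)
index `i < n` stands for the unbarred letter `i + 1`, and the index `2 n - 1 - i` stands for the
barred letter `(i + 1)‾`. -/
abbrev Letter (n : ℕ) : Type := Fin (2 * n)

/-- The unbarred letter attached to `i`. -/
def unb {n : ℕ} (i : Fin n) : Letter n := Fin.castLE (by omega) i

/-- The involution `x ↦ x̄` on letters. -/
def bar {n : ℕ} (x : Letter n) : Letter n := Fin.rev x

/-- The absolute value of a letter, as an unbarred letter. -/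
def absLetter {n : ℕ} (x : Letter n) : Letter n := min x (bar x)

theorem bar_bar {n : ℕ} (x : Letter n) : bar (bar x) = x := Fin.rev_rev x

/-- The group of signed permutations: the permutations `w` of the letters with
`w x̄ = (w x)‾`. The product is composition. -/
def SignedPerm (n : ℕ) : Subgroup (Equiv.Perm (Letter n)) where
  carrier := {w | ∀ x, w (bar x) = bar (w x)}
  one_mem' := fun _ => rfl
  mul_mem' := by
    intro a b ha hb x
    change ∀ x, a (bar x) = bar (a x) at ha
    change ∀ x, b (bar x) = bar (b x) at hb
    rw [Equiv.Perm.mul_apply, Equiv.Perm.mul_apply, hb, ha]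
  inv_mem' := by
    intro a ha x
    change ∀ x, a (bar x) = bar (a x) at ha
    rw [Equiv.Perm.inv_eq_iff_eq, ha]
    simp

/-- The underlying permutation of `reflection a b` below: `t_{a ā}` if `b = ā`, and
`t_{a b} t_{b̄ ā}` otherwise. -/
def reflectionPerm {n : ℕ} (a b : Letter n) : Equiv.Perm (Letter n) :=
  if b = bar a then Equiv.swap a b else Equiv.swap a b * Equiv.swap (bar b) (bar a)

theorem reflectionPerm_mem {n : ℕ} (a b : Letter n) : reflectionPerm a b ∈ SignedPerm n := by
  intro x
  have key : ∀ c d y : Letter n, bar (Equiv.swap c d y) = Equiv.swap (bar c) (bar d) (bar y) := by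
    intro c d y
    have hinj : Function.Injective (bar : Letter n → Letter n) := Fin.rev_injective
    exact (hinj.map_swap _ _ _)
  unfold reflectionPerm
  split_ifs with h
  · subst h
    rw [key, bar_bar, Equiv.swap_comm]
  · rw [Equiv.Perm.mul_apply, Equiv.Perm.mul_apply, key, key, bar_bar, bar_bar]
    by_cases hab : a = b
    · subst hab; simp
    have hcomm : Commute (Equiv.swap a b) (Equiv.swap (bar b) (bar a)) := by
      by_cases ha : a = bar a
      · exact absurd ha (by
          intro h'
          have := congrArg Fin.val h'
          simp only [bar, Fin.val_rev] at this
          omega)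
      by_cases hb : b = bar b
      · exact absurd hb (by
          intro h'
          have := congrArg Fin.val h'
          simp only [bar, Fin.val_rev] at this
          omega)
      have hba : a ≠ bar b := fun h' => h (by rw [h', bar_bar])
      apply Equiv.Perm.Disjoint.commute
      rw [Equiv.Perm.disjoint_iff_disjoint_support, Equiv.Perm.support_swap hab,
        Equiv.Perm.support_swap (fun h' : bar b = bar a => hab (Fin.rev_injective h').symm)]
      simp [Ne.symm hba, Ne.symm hb, Ne.symm ha, Ne.symm h]
    have := congrArg (fun p : Equiv.Perm (Letter n) => p (bar x)) hcomm.eq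
    simp only [Equiv.Perm.mul_apply] at this
    rw [this, Equiv.swap_comm (bar b) (bar a), Equiv.swap_comm b a]

/-- The reflection denoted `(a, b)`, as a signed permutation. -/
def reflection {n : ℕ} (r : Letter n × Letter n) : SignedPerm n :=
  ⟨reflectionPerm r.1 r.2, reflectionPerm_mem r.1 r.2⟩

/-- The length `#{(k, l) ∈ [n] × [n̄] : k ≤ |l|, w(k) > w(l)}` of a signed permutation. -/
def length {n : ℕ} (w : SignedPerm n) : ℕ :=
  (Finset.univ.filter (fun q : Fin n × Letter n =>
    unb q.1 ≤ absLetter q.2 ∧ w.1 q.2 < w.1 (unb q.1))).card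

/-- The coordinate vector `ε_x` of a letter, where `ε_{ī} = - ε_i`. -/
def eps {n : ℕ} (x : Letter n) : Fin n → ℚ :=
  fun i => (if x = unb i then 1 else 0) - (if x = bar (unb i) then 1 else 0)

/-- The pairs of letters that denote positive roots: `(i, j)` and `(i, j̄)` with `i < j`, and
`(i, ī)`. -/
def IsPositiveRoot {n : ℕ} (r : Letter n × Letter n) : Prop :=
  ∃ i j : Fin n, (i < j ∧ (r = (unb i, unb j) ∨ r = (unb i, bar (unb j)))) ∨
    r = (unb i, bar (unb i))

/-- The root denoted by `(a, b)`: `(i, j)` is `ε_i - ε_j`, `(i, j̄)` is `ε_i + ε_j`, and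
`(i, ī)` is `2 ε_i`. -/
def root {n : ℕ} (r : Letter n × Letter n) : Fin n → ℚ := eps r.1 - eps r.2

/-- The coroot `α^∨ = 2 α / ⟨α, α⟩`. -/
def coroot {n : ℕ} (r : Letter n × Letter n) : Fin n → ℚ :=
  (2 / (root r ⬝ᵥ root r)) • root r

/-- The vector `ρ = (n, n - 1, …, 1)`, half the sum of the positive roots. -/
def rho (n : ℕ) : Fin n → ℚ := fun i => (n : ℚ) - (i.val : ℚ)

/-- The (strict) Bruhat order: the transitive closure of the relations `u < u s_α` for positive
roots `α` with `ℓ(u) < ℓ(u s_α)`. -/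
def BruhatLT {n : ℕ} : SignedPerm n → SignedPerm n → Prop :=
  Relation.TransGen (fun u v =>
    ∃ r : Letter n × Letter n, IsPositiveRoot r ∧ v = u * reflection r ∧ length u < length v)

/-- The edge `w ⟶ w s_α` of the quantum Bruhat graph labelled by `α`. -/
def QuantumBruhatEdge {n : ℕ} (w : SignedPerm n) (r : Letter n × Letter n) : Prop :=
  length (w * reflection r) = length w + 1 ∨
    (length (w * reflection r) : ℚ) = (length w : ℚ) - 2 * (rho n ⬝ᵥ coroot r) + 1

/-- The segment `Γ_i = ((1, ī), (2, ī), …, (i-1, ī))`. -/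
def gammaSeg {n : ℕ} (i : Fin n) : List (Letter n × Letter n) :=
  ((List.finRange n).filter (fun p => p < i)).map (fun p => (unb p, bar (unb i)))

/-- `Γ_r(k) = Γ_1 Γ_2 ⋯ Γ_k` (the segment `Γ_1` is empty). -/
def gammaR (n k : ℕ) : List (Letter n × Letter n) :=
  ((List.finRange n).filter (fun i => i.val < k)).flatMap gammaSeg

/-- The segment `Γ_{ki}`, that is `(1, ī), …, (i-1, ī)`, then `(i, (k+1)‾), …, (i, n̄)`, then
`(i, ī)`, then `(i, n), …, (i, k+1)`. -/
def gammaKSeg {n : ℕ} (k : ℕ) (i : Fin n) : List (Letter n × Letter n) :=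
  gammaSeg i ++
    ((List.finRange n).filter (fun j => k ≤ j.val)).map (fun j => (unb i, bar (unb j))) ++
    [(unb i, bar (unb i))] ++
    ((List.finRange n).filter (fun j => k ≤ j.val)).reverse.map (fun j => (unb i, unb j))

/-- `Γ_l(k) = Γ_{k1} ⋯ Γ_{kk}`. -/
def gammaL (n k : ℕ) : List (Letter n × Letter n) :=
  ((List.finRange n).filter (fun i => i.val < k)).flatMap (gammaKSeg k)

/-- The `ω_k`-chain `Γ(k) = Γ_r(k) Γ_l(k)`. -/
def gamma (n k : ℕ) : List (Letter n × Letter n) := gammaR n k ++ gammaL n k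

/-- The number `μ_1` of columns of `μ` (it is `0` for `n = 0`). -/
def numCols {n : ℕ} (μ : Fin n → ℕ) : ℕ := Finset.univ.sup μ

/-- The height `μ'_{j+1}` of column `j + 1` of `μ`; the columns are indexed from `0`. -/
def height {n : ℕ} (μ : Fin n → ℕ) (j : ℕ) : ℕ := (Finset.univ.filter (fun i => j < μ i)).card

theorem height_le {n : ℕ} (μ : Fin n → ℕ) (j : ℕ) : height μ j ≤ n := by
  simpa [height] using Finset.card_filter_le (Finset.univ : Finset (Fin n)) (fun i => j < μ i)

/-- The `μ`-chain `Γ = Γ^{μ_1} ⋯ Γ^1`, where `Γ^j = Γ(μ'_j)`. -/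
def chain {n : ℕ} (μ : Fin n → ℕ) : List (Letter n × Letter n) :=
  (List.finRange (numCols μ)).reverse.flatMap (fun j => gamma n (height μ j))

/-- The folding pairs `(w, J)`, where `J` is a set of (0-based) positions in the `μ`-chain. -/
abbrev FoldingPair {n : ℕ} (μ : Fin n → ℕ) : Type :=
  SignedPerm n × Finset (Fin (chain μ).length)

/-- The product of `w` with the reflections `r_p`, for the positions `p ∈ J` among the first `N`
positions of the chain, in increasing order of `p`. -/
def partialProd {n : ℕ} {μ : Fin n → ℕ} (wJ : FoldingPair μ) (N : ℕ) : SignedPerm n :=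
  wJ.1 * (((List.finRange (chain μ).length).filter (fun p => p ∈ wJ.2 ∧ p.val < N)).map
    (fun p => reflection ((chain μ).get p))).prod

/-- `end(w, J)`: the product of `w` with all reflections of `J`. -/
def endElt {n : ℕ} {μ : Fin n → ℕ} (wJ : FoldingPair μ) : SignedPerm n :=
  partialProd wJ (chain μ).length

open Classical in
/-- The set `J⁻` of negative foldings: if `p = j_i`, then `partialProd wJ p` is `w_{i-1}` and
`partialProd wJ (p + 1)` is `w_i`. -/
noncomputable def negFoldings {n : ℕ} {μ : Fin n → ℕ} (wJ : FoldingPair μ) :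
    Finset (Fin (chain μ).length) :=
  wJ.2.filter (fun p => BruhatLT (partialProd wJ p.val) (partialProd wJ (p.val + 1)))

/-- The set of folding pairs with
`(ℓ(w) + ℓ(end(w, J)) - #J) / 2 + ∑_{j ∈ J⁻} ⟨ρ, β_j^∨⟩ = 0`. -/
def FBar {n : ℕ} (μ : Fin n → ℕ) : Set (FoldingPair μ) :=
  {wJ | (1 / 2 : ℚ) * ((length wJ.1 : ℚ) + (length (endElt wJ) : ℚ) - (wJ.2.card : ℚ)) +
    ∑ p ∈ negFoldings wJ, rho n ⬝ᵥ coroot ((chain μ).get p) = 0}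

/-- The sequence `w_0, w_1, …, w_s`, read backwards, is a path in the quantum Bruhat graph, with
edges `w_i ⟶ w_{i-1}` labelled by `β_{j_i}`, that starts at `w_s = 1`. -/
def IsQuantumBruhatPath {n : ℕ} {μ : Fin n → ℕ} (wJ : FoldingPair μ) : Prop :=
  endElt wJ = 1 ∧
    ∀ p ∈ wJ.2, QuantumBruhatEdge (partialProd wJ (p.val + 1)) ((chain μ).get p)

/-- A column of height `k` filled with letters, read from top to bottom. -/
abbrev Column (n k : ℕ) : Type := Fin k → Letter n

/-- The fillings of the shape `2 μ`: for each column of `μ` (indexed from `0`), a pair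
`(C_r, C_l)` of columns of the same height. -/
abbrev Filling {n : ℕ} (μ : Fin n → ℕ) : Type :=
  (j : Fin (numCols μ)) → Column n (height μ j) × Column n (height μ j)

/-- The column `u[1, k] = u(1) ⋯ u(k)`. -/
def firstEntries {n k : ℕ} (hk : k ≤ n) (u : SignedPerm n) : Column n k :=
  fun i => u.1 (unb (Fin.castLE hk i))

/-- The number of positions of the `μ`-chain to the left of the factor `Γ^{j+1}`. -/
def segStart {n : ℕ} (μ : Fin n → ℕ) (j : Fin (numCols μ)) : ℕ :=
  ∑ i ∈ Finset.Ioi j, (gamma n (height μ i)).length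

/-- The filling map. -/
def fillingMap {n : ℕ} {μ : Fin n → ℕ} (wJ : FoldingPair μ) : Filling μ := fun j =>
  (firstEntries (height_le μ j) (partialProd wJ (segStart μ j)),
   firstEntries (height_le μ j)
    (partialProd wJ (segStart μ j + (gammaR n (height μ j)).length)))

/-- Sorting a column increasingly. -/
def sortColumn {n k : ℕ} (C : Column n k) : Column n k := C ∘ Tuple.sort C

/-- The map `ord`, sorting each column of a filling increasingly. -/
def ord {n : ℕ} {μ : Fin n → ℕ} (σ : Filling μ) : Filling μ := fun j =>
  (sortColumn (σ j).1, sortColumn (σ j).2)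

/-- `I = {z_1 > ⋯ > z_r}` is the set of unbarred letters `z` such that `z` and `z̄` occur in `C`,
and `t_i` is the greatest letter in `[n]` with `t_i < z_i`, `t_i < t_{i-1}` (for `i ≥ 2`),
`t_i ∉ C` and `t̄_i ∉ C`. -/
structure IsSplitting {n k r : ℕ} (C : Column n k) (z t : Fin r → Fin n) : Prop where
  z_anti : StrictAnti z
  z_range : Set.range z = {x | unb x ∈ Set.range C ∧ bar (unb x) ∈ Set.range C}
  t_greatest : ∀ i : Fin r, IsGreatest
    {x | x < z i ∧ (∀ j : Fin r, j.val + 1 = i.val → x < t j) ∧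
      unb x ∉ Set.range C ∧ bar (unb x) ∉ Set.range C} (t i)

/-- `C` is a KN column and `(R, L)` is the split column `(r C, l C)`: the column `C` is strictly
increasing and can be split, `R` is the increasing column obtained from `C` by changing `z̄_i`
into `t̄_i` for all `i` and reordering, and `L` is the increasing column obtained from `C` by
changing `z_i` into `t_i` for all `i` and reordering. -/
def IsSplitColumn {n k : ℕ} (C R L : Column n k) : Prop :=
  StrictMono C ∧ ∃ (r : ℕ) (z t : Fin r → Fin n), IsSplitting C z t ∧
    (StrictMono R ∧ Set.range R =
      (Set.range C \ Set.range (fun i => bar (unb (z i)))) ∪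
        Set.range (fun i => bar (unb (t i)))) ∧
    (StrictMono L ∧ Set.range L =
      (Set.range C \ Set.range (fun i => unb (z i))) ∪ Set.range (fun i => unb (t i)))

/-- The set `B_μ`: the fillings of the shape `2 μ` by split columns, whose pair of columns `j` is
the splitting of a KN column of height `μ'_j`. -/
def B {n : ℕ} (μ : Fin n → ℕ) : Set (Filling μ) :=
  {τ | ∀ j : Fin (numCols μ), ∃ D : Column n (height μ j), IsSplitColumn D (τ j).1 (τ j).2}

end TypeC

/-! The description of `FBar` is local. The level statistic telescopes into the length of the end
plus one term for each folding. A term is nonnegative because a reflection `s_α` changes the length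
and raises it by at most `2⟨ρ, α^∨⟩ - 1`. It vanishes exactly when the step, read backwards, is an
edge of the quantum Bruhat graph. Hence the statistic is zero iff the end is `1` and all steps are
edges (`mem_FBar_iff`).

For the bijection, paths are read backwards: they start at `1` and follow the reversed chain, column
after column, each column contributing the reversed `Γ_l(k)` and then the reversed `Γ_r(k)`. Two
counts suffice. From any `w`, exactly one walk along the reversed `Γ_l(k)` makes the set of the
first `k` letters equal to a prescribed `k`-set without a pair `x`, `x̄` (`cnt_rootsL_self`). From a
`w` whose first `k` letters form `L`, the number of walks along the reversed `Γ_r(k)` that end with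
first letters `R` is one if `(R, L)` is a split column, and zero otherwise (`cnt_rootsR_self`).
Existence and uniqueness then propagate from column to column.

Both counts treat one position `i < k` at a time, from the last to the first. Edges become
betweenness conditions on values. In `Γ_l` the letter `b` at position `i` first moves cyclically to
a letter `d`, passing no letter frozen at the positions strictly between `i` and `k`
(`cnt_outerRoots`). Then, in both chains, it moves upwards within one half of the alphabet to a
letter `c`, passing no free letter, and among the earlier positions `c̄` is replaced by `d̄`
(`cnt_innerRoots`). From then on `c` stays at position `i`, so it has to belong to the target.

The targets that remain possible are described by flows on the cycle of letters, with the current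
letters as sources and the target letters as sinks. For `Γ_l` the flow vanishes at the frozen
letters and at least once (`CritL`); for `Γ_r` it vanishes at the free letters and on both edges
between the halves (`CritR`). A nonnegative flow with a zero is unique, and its first zero after `b`
determines `c`. Removing the paths from `b` to `c` and from `c̄` to `d̄` leaves the flow of the next
smaller problem (`critR_iff`, `critL_iff`). So every count is the indicator of its criterion.

For the whole of `Γ_l(k)` nothing is frozen, and the flow exists as soon as the cardinalities agree.
For `Γ_r(k)` the criterion is the Kashiwara–Nakashima splitting: the flow consists of the paths from
`t_i` to `z_i` and their mirror images, and its vanishing at free letters is the greedy choice of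
the `t_i` (`IsSplitColumn.critR`, `CritR.isSplitColumn`). -/

namespace TypeC

/-! ### Inversions and the length of a signed permutation -/

/-- The number of inversions of a permutation of a finite chain. -/
def inversions {N : ℕ} (w : Equiv.Perm (Fin N)) : ℤ :=
  ∑ p, ∑ q, if p < q ∧ w q < w p then 1 else 0

/-- The number of positions between `x` and `y` whose values lie between those at `x` and `y`. -/
def between {N : ℕ} (w : Equiv.Perm (Fin N)) (x y : Fin N) : ℕ :=
  (Finset.univ.filter (fun z => x < z ∧ z < y ∧ w x < w z ∧ w z < w y)).card

/-- The pair at `x` and `y` becomes an inversion. A position between them gains two inversions if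
its value lies between the exchanged values, and otherwise takes part in as many as before.
Positions outside the interval keep their total. -/
theorem inversions_mul_swap {N : ℕ} (w : Equiv.Perm (Fin N)) {x y : Fin N} (hxy : x < y)
    (hw : w x < w y) :
    inversions (w * Equiv.swap x y) = inversions w + 1 + 2 * between w x y := by
  have h1 : inversions (w * Equiv.swap x y) =
      ∑ p, ∑ q, if Equiv.swap x y p < Equiv.swap x y q ∧ w q < w p then (1 : ℤ) else 0 := by
    unfold inversions
    rw [← Equiv.sum_comp (Equiv.swap x y)]
    refine Finset.sum_congr rfl fun p _ => ?_
    rw [← Equiv.sum_comp (Equiv.swap x y)]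
    simp
  -- Only pairs that involve `x` or `y` change; the added terms correct the rows and the columns of
  -- these two positions.
  have key : ∀ p q, (if Equiv.swap x y p < Equiv.swap x y q ∧ w q < w p then (1 : ℤ) else 0) =
      (if p < q ∧ w q < w p then 1 else 0) +
      (if p = y then (if q = x then 1 else 0) else 0) +
      (if p = x then - (if x < q ∧ q < y ∧ w q < w x then 1 else 0) else 0) +
      (if p = y then (if x < q ∧ q < y ∧ w q < w y then 1 else 0) else 0) +
      (if q = x then (if x < p ∧ p < y ∧ w x < w p then 1 else 0) else 0) +
      (if q = y then - (if x < p ∧ p < y ∧ w y < w p then 1 else 0) else 0) := by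
    intro p q
    have hinj : w p = w q → p = q := fun h => w.injective h
    rcases eq_or_ne p x with rfl | hpx
    · rcases eq_or_ne q p with rfl | hqx
      · simp [hxy.ne]
      · rcases eq_or_ne q y with rfl | hqy
        · simp [hxy.ne', hxy.ne, hw.not_gt, hxy.not_gt]
        · simp only [Equiv.swap_apply_left, Equiv.swap_apply_of_ne_of_ne hqx hqy, hqx, hqy, hxy.ne,
            if_true, if_false]
          split_ifs <;> omega
    · rcases eq_or_ne p y with rfl | hpy
      · rcases eq_or_ne q x with rfl | hqx
        · simp [hxy, hw, hxy.not_gt, hxy.ne]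
        · rcases eq_or_ne q p with rfl | hqy
          · simp [hxy.ne']
          · simp only [Equiv.swap_apply_right, Equiv.swap_apply_of_ne_of_ne hqx hqy, hqx, hqy,
              hxy.ne', if_true, if_false]
            split_ifs <;> omega
      · rw [Equiv.swap_apply_of_ne_of_ne hpx hpy]
        simp only [hpx, hpy, if_false]
        rcases eq_or_ne q x with rfl | hqx
        · simp only [Equiv.swap_apply_left, hxy.ne, if_true, if_false]
          split_ifs <;> omega
        · rcases eq_or_ne q y with rfl | hqy
          · simp only [Equiv.swap_apply_right, hqx, if_true, if_false]
            split_ifs <;> omega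
          · simp [Equiv.swap_apply_of_ne_of_ne hqx hqy, hqx, hqy]
  have hb : (between w x y : ℤ) =
      ∑ z, if x < z ∧ z < y ∧ w x < w z ∧ w z < w y then (1 : ℤ) else 0 := by
    rw [between, Finset.sum_boole]
  rw [h1, hb]
  simp_rw [key]
  simp only [Finset.sum_add_distrib]
  have e1 : ∀ f : Fin N → ℤ, ∑ p, ∑ q, (if p = x then f q else 0) = ∑ q, f q := by
    intro f; rw [Finset.sum_comm]; simp
  have e2 : ∀ f : Fin N → ℤ, ∑ p, ∑ q, (if p = y then f q else 0) = ∑ q, f q := by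
    intro f; rw [Finset.sum_comm]; simp
  rw [e1, e2, e2]
  simp only [Finset.sum_ite_eq', Finset.mem_univ, if_true]
  rw [← inversions]
  have : ∀ z, (if x < z ∧ z < y ∧ w x < w z ∧ w z < w y then (1 : ℤ) else 0) * 2 =
      -(if x < z ∧ z < y ∧ w z < w x then 1 else 0) + (if x < z ∧ z < y ∧ w z < w y then 1 else 0)
      + (if x < z ∧ z < y ∧ w x < w z then 1 else 0)
      + -(if x < z ∧ z < y ∧ w y < w z then 1 else 0) := by
    intro z
    have h1 : w z = w x → z = x := fun h => w.injective h
    have h2 : w z = w y → z = y := fun h => w.injective h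
    split_ifs <;> omega
  rw [mul_comm, Finset.sum_mul, Finset.sum_congr rfl (fun z _ => this z)]
  simp only [Finset.sum_add_distrib]
  ring

/-- The number of unbarred positions with barred values. -/
def negCount {n : ℕ} (w : Equiv.Perm (Letter n)) : ℤ :=
  ∑ p : Letter n, if p.val < n ∧ n ≤ (w p).val then 1 else 0

theorem negCount_mul_swap {n : ℕ} (w : Equiv.Perm (Letter n)) {x y : Letter n} (hxy : x ≠ y) :
    negCount (w * Equiv.swap x y) = negCount w +
      ((if y.val < n then 1 else 0) - (if x.val < n then 1 else 0)) *
      ((if n ≤ (w x).val then 1 else 0) - (if n ≤ (w y).val then 1 else 0)) := by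
  have h1 : negCount (w * Equiv.swap x y) =
      ∑ p : Letter n, if (Equiv.swap x y p).val < n ∧ n ≤ (w p).val then (1 : ℤ) else 0 := by
    unfold negCount
    rw [← Equiv.sum_comp (Equiv.swap x y)]
    simp
  have key : ∀ p : Letter n, (if (Equiv.swap x y p).val < n ∧ n ≤ (w p).val then (1 : ℤ) else 0) =
      (if p.val < n ∧ n ≤ (w p).val then 1 else 0) +
      (if p = x then ((if y.val < n then 1 else 0) - (if x.val < n then 1 else 0)) *
        (if n ≤ (w x).val then 1 else 0) else 0) +
      (if p = y then - ((if y.val < n then 1 else 0) - (if x.val < n then 1 else 0)) *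
        (if n ≤ (w y).val then 1 else 0) else 0) := by
    intro p
    rcases eq_or_ne p x with rfl | hpx
    · simp only [Equiv.swap_apply_left, if_true, hxy, if_false]
      split_ifs <;> omega
    · rcases eq_or_ne p y with rfl | hpy
      · simp only [Equiv.swap_apply_right, if_true, hxy.symm, if_false]
        split_ifs <;> omega
      · simp [Equiv.swap_apply_of_ne_of_ne hpx hpy, hpx, hpy]
  rw [h1, Finset.sum_congr rfl (fun p _ => key p)]
  simp only [Finset.sum_add_distrib, Finset.sum_ite_eq', Finset.mem_univ, if_true]
  rw [← negCount]
  ring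

theorem val_bar {n : ℕ} (x : Letter n) : (bar x).val = 2 * n - 1 - x.val := by
  simp only [bar, Fin.val_rev]; omega

theorem val_unb {n : ℕ} (i : Fin n) : (unb i).val = i.val := rfl

theorem apply_bar {n : ℕ} (w : SignedPerm n) (x : Letter n) : w.1 (bar x) = bar (w.1 x) := w.2 x

theorem bar_lt_bar {n : ℕ} {x y : Letter n} : bar x < bar y ↔ y < x := Fin.rev_lt_rev

/-- The letters are the unbarred ones and the barred ones. -/
def letterEquiv (n : ℕ) : Fin n ⊕ Fin n ≃ Letter n where
  toFun := Sum.elim unb (fun i => bar (unb i))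
  invFun x := if h : x.val < n then Sum.inl ⟨x.val, h⟩
    else Sum.inr ⟨2 * n - 1 - x.val, by omega⟩
  left_inv := by
    rintro (i | i)
    · simp [val_unb]
    · have := i.isLt
      have h : ¬ (bar (unb i)).val < n := by rw [val_bar, val_unb]; omega
      refine (dif_neg h).trans ?_
      congr 1; apply Fin.ext; simp only [Sum.elim_inr, val_bar, val_unb]; omega
  right_inv := by
    intro x
    have := x.isLt
    by_cases h : x.val < n
    · simp only [h, dif_pos]; apply Fin.ext; simp [val_unb]
    · simp only [h, dif_neg, not_false_iff]; apply Fin.ext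
      simp only [Sum.elim_inr, val_bar, val_unb]; omega

theorem sum_letter {n : ℕ} {M : Type*} [AddCommMonoid M] (f : Letter n → M) :
    ∑ x, f x = ∑ i, (f (unb i) + f (bar (unb i))) := by
  rw [← Equiv.sum_comp (letterEquiv n), Fintype.sum_sum_type, Finset.sum_add_distrib]; rfl

/-- The map `(p, q) ↦ (q̄, p̄)` is an involution on inversions, and the length counts one from each
orbit. Its fixed points are the inversions `(i, ī)`, and `negCount` adds the second copy that they
lack. -/
theorem two_mul_length {n : ℕ} (w : SignedPerm n) :
    2 * (length w : ℤ) = inversions w.1 + negCount w.1 := by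
  have h1 : (length w : ℤ) = ∑ i : Fin n, ∑ j : Fin n,
      ((if i ≤ j ∧ w.1 (unb j) < w.1 (unb i) then 1 else 0) +
      (if i ≤ j ∧ w.1 (bar (unb j)) < w.1 (unb i) then 1 else 0)) := by
    unfold length
    rw [Finset.card_filter, Nat.cast_sum, Fintype.sum_prod_type]
    refine Finset.sum_congr rfl fun i _ => ?_
    rw [sum_letter]
    refine Finset.sum_congr rfl fun j _ => ?_
    have e1 : absLetter (unb j) = unb j := by
      apply min_eq_left; rw [Fin.le_def, val_bar, val_unb]; omega
    have e2 : absLetter (bar (unb j)) = unb j := by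
      rw [absLetter, bar_bar]; apply min_eq_right; rw [Fin.le_def, val_bar, val_unb]; omega
    have e3 : unb i ≤ unb j ↔ i ≤ j := by rw [Fin.le_def, Fin.le_def, val_unb, val_unb]
    simp only [e1, e2, e3, Nat.cast_ite, Nat.cast_one, Nat.cast_zero]
  have h2 : negCount w.1 = ∑ i : Fin n, ∑ j : Fin n,
      if i = j then (if w.1 (bar (unb i)) < w.1 (unb i) then 1 else 0) else 0 := by
    unfold negCount
    rw [sum_letter]
    simp only [Finset.sum_ite_eq, Finset.mem_univ, if_true]
    refine Finset.sum_congr rfl fun i _ => ?_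
    have := i.isLt
    have := (w.1 (unb i)).isLt
    simp only [apply_bar, Fin.lt_def, val_bar, val_unb]
    split_ifs <;> omega
  have h3 : inversions w.1 = ∑ i : Fin n, ∑ j : Fin n,
      ((if i < j ∧ w.1 (unb j) < w.1 (unb i) then 1 else 0) +
      (if w.1 (bar (unb j)) < w.1 (unb i) then 1 else 0) +
      (if j < i ∧ w.1 (unb i) < w.1 (unb j) then 1 else 0)) := by
    unfold inversions
    rw [sum_letter]
    refine Finset.sum_congr rfl fun i _ => ?_
    rw [sum_letter, sum_letter, ← Finset.sum_add_distrib]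
    refine Finset.sum_congr rfl fun j _ => ?_
    have := i.isLt
    have := j.isLt
    simp only [apply_bar, bar_lt_bar]
    simp only [Fin.lt_def, val_bar, val_unb]
    split_ifs <;> omega
  have h4 : (length w : ℤ) = ∑ i : Fin n, ∑ j : Fin n,
      ((if j ≤ i ∧ w.1 (unb i) < w.1 (unb j) then 1 else 0) +
      (if j ≤ i ∧ w.1 (bar (unb j)) < w.1 (unb i) then 1 else 0)) := by
    rw [h1, Finset.sum_comm]
    refine Finset.sum_congr rfl fun i _ => Finset.sum_congr rfl fun j _ => ?_
    congr 2
    rw [apply_bar, apply_bar, ← bar_lt_bar, bar_bar]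
  rw [two_mul]
  nth_rewrite 1 [h1]
  rw [h4, h2, h3, ← Finset.sum_add_distrib, ← Finset.sum_add_distrib]
  refine Finset.sum_congr rfl fun i _ => ?_
  rw [← Finset.sum_add_distrib, ← Finset.sum_add_distrib]
  refine Finset.sum_congr rfl fun j _ => ?_
  rcases lt_trichotomy i j with h | rfl | h
  · simp only [h, h.le, h.not_ge, h.not_gt, h.ne]; simp
  · simp
  · simp only [h, h.le, h.not_ge, h.not_gt, h.ne']; simp; ring


/-! ### Heights of coroots and the effect of a reflection on the length -/

theorem eps_unb {n : ℕ} (i : Fin n) : eps (unb i) = Pi.single i 1 := by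
  funext j
  have h1 : unb i = unb j ↔ j = i := by
    simp only [Fin.ext_iff, val_unb]; omega
  have h2 : ¬ unb i = bar (unb j) := by
    simp only [Fin.ext_iff, val_unb, val_bar]; omega
  simp [eps, h1, h2, Pi.single_apply]

theorem eps_bar_unb {n : ℕ} (i : Fin n) : eps (bar (unb i)) = - Pi.single i 1 := by
  funext j
  have h1 : ¬ bar (unb i) = unb j := by
    simp only [Fin.ext_iff, val_unb, val_bar]; omega
  have h2 : bar (unb i) = bar (unb j) ↔ j = i := by
    simp only [Fin.ext_iff, val_unb, val_bar]; omega
  by_cases h : j = i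
  · subst h; simp [eps, h1]
  · simp [eps, h1, h2, h]

theorem rho_coroot_unb {n : ℕ} {i j : Fin n} (h : i < j) :
    rho n ⬝ᵥ coroot (unb i, unb j) = (j.val : ℚ) - i.val := by
  simp only [coroot, root, eps_unb, dotProduct_smul, dotProduct_sub,
    dotProduct_single, Pi.sub_apply, Pi.single_eq_same, Pi.single_eq_of_ne h.ne,
    Pi.single_eq_of_ne h.ne', rho, smul_eq_mul]
  norm_num

theorem rho_coroot_bar {n : ℕ} {i j : Fin n} (h : i < j) :
    rho n ⬝ᵥ coroot (unb i, bar (unb j)) = 2 * (n : ℚ) - i.val - j.val := by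
  simp only [coroot, root, eps_unb, eps_bar_unb, dotProduct_smul, dotProduct_sub,
    dotProduct_neg,
    dotProduct_single, Pi.sub_apply, Pi.neg_apply, Pi.single_eq_same, Pi.single_eq_of_ne h.ne,
    Pi.single_eq_of_ne h.ne', rho, smul_eq_mul]
  norm_num
  ring

theorem rho_coroot_self {n : ℕ} (i : Fin n) :
    rho n ⬝ᵥ coroot (unb i, bar (unb i)) = (n : ℚ) - i.val := by
  simp only [coroot, root, eps_unb, eps_bar_unb, dotProduct_smul, dotProduct_sub,
    dotProduct_neg,
    dotProduct_single, Pi.sub_apply, Pi.single_eq_same, rho, smul_eq_mul]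
  norm_num
  ring

theorem coe_reflection_of_ne {n : ℕ} {a b : Letter n} (h : b ≠ bar a) :
    (reflection (a, b)).1 = Equiv.swap a b * Equiv.swap (bar b) (bar a) := by
  simp [reflection, reflectionPerm, h]

theorem coe_reflection_self {n : ℕ} (a : Letter n) :
    (reflection (a, bar a)).1 = Equiv.swap a (bar a) := by
  simp [reflection, reflectionPerm]

theorem reflection_apply_of_ne {n : ℕ} {a b x : Letter n} (h1 : x ≠ a) (h2 : x ≠ b)
    (h3 : x ≠ bar a) (h4 : x ≠ bar b) : (reflection (a, b)).1 x = x := by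
  by_cases h : b = bar a
  · subst h
    rw [coe_reflection_self, Equiv.swap_apply_of_ne_of_ne h1 h2]
  · rw [coe_reflection_of_ne h, Equiv.Perm.mul_apply, Equiv.swap_apply_of_ne_of_ne h4 h3,
      Equiv.swap_apply_of_ne_of_ne h1 h2]

theorem bar_ne {n : ℕ} (x : Letter n) : bar x ≠ x := by
  have := x.isLt
  simp only [ne_eq, Fin.ext_iff, val_bar]; omega

theorem reflection_apply_left {n : ℕ} {a b : Letter n} (hab : a ≠ b) :
    (reflection (a, b)).1 a = b := by
  by_cases h : b = bar a
  · subst h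
    rw [coe_reflection_self, Equiv.swap_apply_left]
  · have h1 : a ≠ bar b := fun h' => h (by rw [h', bar_bar])
    rw [coe_reflection_of_ne h, Equiv.Perm.mul_apply,
      Equiv.swap_apply_of_ne_of_ne h1 (bar_ne a).symm, Equiv.swap_apply_left]

theorem reflection_apply_right {n : ℕ} {a b : Letter n} (hab : a ≠ b) :
    (reflection (a, b)).1 b = a := by
  by_cases h : b = bar a
  · subst h
    rw [coe_reflection_self, Equiv.swap_apply_right]
  · rw [coe_reflection_of_ne h, Equiv.Perm.mul_apply,
      Equiv.swap_apply_of_ne_of_ne (bar_ne b).symm h, Equiv.swap_apply_right]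

theorem reflection_mul_self {n : ℕ} (r : Letter n × Letter n) : reflection r * reflection r = 1 := by
  obtain ⟨a, b⟩ := r
  apply Subtype.ext
  apply Equiv.ext
  intro x
  change (reflection (a, b)).1 ((reflection (a, b)).1 x) = x
  rcases eq_or_ne a b with rfl | hab
  · have : (reflection (a, a)).1 = 1 := by
      rw [coe_reflection_of_ne (bar_ne a).symm]; simp [Equiv.Perm.one_def]
    rw [this]; rfl
  have hl := reflection_apply_left hab
  have hr := reflection_apply_right hab
  by_cases h1 : x = a
  · rw [h1, hl, hr]
  by_cases h2 : x = b
  · rw [h2, hr, hl]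
  by_cases h3 : x = bar a
  · rw [h3, apply_bar, hl, apply_bar, hr]
  by_cases h4 : x = bar b
  · rw [h4, apply_bar, hr, apply_bar, hl]
  rw [reflection_apply_of_ne h1 h2 h3 h4, reflection_apply_of_ne h1 h2 h3 h4]

theorem mul_reflection_cancel {n : ℕ} (w : SignedPerm n) (r : Letter n × Letter n) :
    w * reflection r * reflection r = w := by
  rw [mul_assoc, reflection_mul_self, mul_one]

theorem mul_reflection_apply_left {n : ℕ} (w : SignedPerm n) {a b : Letter n} (hab : a ≠ b) :
    (w * reflection (a, b)).1 a = w.1 b :=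
  congrArg w.1 (reflection_apply_left hab)

theorem mul_reflection_apply_right {n : ℕ} (w : SignedPerm n) {a b : Letter n} (hab : a ≠ b) :
    (w * reflection (a, b)).1 b = w.1 a :=
  congrArg w.1 (reflection_apply_right hab)

theorem mul_reflection_apply_of_ne {n : ℕ} (w : SignedPerm n) {a b x : Letter n} (h1 : x ≠ a)
    (h2 : x ≠ b) (h3 : x ≠ bar a) (h4 : x ≠ bar b) :
    (w * reflection (a, b)).1 x = w.1 x :=
  congrArg w.1 (reflection_apply_of_ne h1 h2 h3 h4)

theorem card_filter_bar {n : ℕ} (P : Letter n → Prop) [DecidablePred P] :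
    (Finset.univ.filter (fun z => P (bar z))).card = (Finset.univ.filter P).card :=
  Finset.card_nbij' bar bar (by intro z; simp) (by intro z; simp [bar_bar])
    (fun z _ => bar_bar z) (fun z _ => bar_bar z)

/-- The reflection is a product of two mirror transpositions with disjoint supports. Both see the
same number of letters in between, and neither changes `negCount`. -/
theorem length_mul_reflection_unb {n : ℕ} (w : SignedPerm n) {i j : Fin n} (hij : i < j)
    (hw : w.1 (unb i) < w.1 (unb j)) :
    length (w * reflection (unb i, unb j)) =
      length w + 1 + 2 * between w.1 (unb i) (unb j) := by
  have hi := i.isLt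
  have hj := j.isLt
  have hij' : i.val < j.val := hij
  set a := unb i with ha
  set b := unb j with hb
  have vab : a.val = i.val := rfl
  have vbb : b.val = j.val := rfl
  have hne : b ≠ bar a := by simp only [ne_eq, Fin.ext_iff, val_bar]; omega
  have h1 := two_mul_length w
  have h2 := two_mul_length (w * reflection (a, b))
  have e : (w * reflection (a, b)).1 = w.1 * Equiv.swap a b * Equiv.swap (bar b) (bar a) := by
    rw [mul_assoc, ← coe_reflection_of_ne hne]; rfl
  have hba : bar b < bar a := by rw [bar_lt_bar]; exact hij
  have fixb : (w.1 * Equiv.swap a b) (bar b) = bar (w.1 b) := by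
    rw [Equiv.Perm.mul_apply, Equiv.swap_apply_of_ne_of_ne _ (bar_ne b), apply_bar]
    exact fun h => hne (by rw [← h, bar_bar])
  have fixa : (w.1 * Equiv.swap a b) (bar a) = bar (w.1 a) := by
    rw [Equiv.Perm.mul_apply, Equiv.swap_apply_of_ne_of_ne (bar_ne a) hne.symm, apply_bar]
  have hbt : between (w.1 * Equiv.swap a b) (bar b) (bar a) = between w.1 a b := by
    unfold between
    rw [fixa, fixb, ← card_filter_bar]
    congr 1
    ext z
    simp only [Finset.mem_filter, Finset.mem_univ, true_and]
    by_cases hz : a < z ∧ z < b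
    · have : (w.1 * Equiv.swap a b) (bar z) = bar (w.1 z) := by
        have hz1 : a.val < z.val := hz.1
        have hz2 : z.val < b.val := hz.2
        have := val_bar z
        rw [Equiv.Perm.mul_apply, Equiv.swap_apply_of_ne_of_ne _ _, apply_bar] <;>
        · simp only [ne_eq, Fin.ext_iff]; omega
      rw [this]; simp only [bar_lt_bar]; tauto
    · simp only [bar_lt_bar]; tauto
  rw [e, inversions_mul_swap _ hba (by rw [fixa, fixb]; exact bar_lt_bar.2 hw),
    inversions_mul_swap _ (show a < b from hij) hw, hbt, negCount_mul_swap _ hba.ne,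
    negCount_mul_swap _ (Fin.ne_of_lt hij)] at h2
  have vb1 := val_bar a
  have vb2 := val_bar b
  rw [if_neg (show ¬ (bar a).val < n by omega), if_neg (show ¬ (bar b).val < n by omega),
    if_pos (show a.val < n by omega), if_pos (show b.val < n by omega)] at h2
  push_cast at h2 ⊢
  omega

/-- Here a single transposition acts. The letters in between come in pairs `z`, `z̄`, which gives an
even number, and `negCount` grows by one. -/
theorem length_mul_reflection_self {n : ℕ} (w : SignedPerm n) (i : Fin n)
    (hw : w.1 (unb i) < w.1 (bar (unb i))) :
    length (w * reflection (unb i, bar (unb i))) = length w + 1 +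
      2 * (Finset.univ.filter (fun j : Fin n => i < j ∧ w.1 (unb i) < w.1 (unb j) ∧
        w.1 (unb j) < w.1 (bar (unb i)))).card := by
  have hi := i.isLt
  set a := unb i with ha
  have va : a.val = i.val := rfl
  have vb := val_bar a
  have h1 := two_mul_length w
  have h2 := two_mul_length (w * reflection (a, bar a))
  have e : (w * reflection (a, bar a)).1 = w.1 * Equiv.swap a (bar a) := by
    rw [← coe_reflection_self]; rfl
  have hlt : a < bar a := by rw [Fin.lt_def]; omega
  have hbt : between w.1 a (bar a) = 2 * (Finset.univ.filter (fun j : Fin n => i < j ∧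
      w.1 a < w.1 (unb j) ∧ w.1 (unb j) < w.1 (bar a))).card := by
    unfold between
    rw [Finset.card_filter, Finset.card_filter, sum_letter, Finset.mul_sum]
    refine Finset.sum_congr rfl fun j _ => ?_
    have hj := j.isLt
    have e1 : (a < unb j ∧ unb j < bar a ∧ w.1 a < w.1 (unb j) ∧ w.1 (unb j) < w.1 (bar a)) ↔
        (i < j ∧ w.1 a < w.1 (unb j) ∧ w.1 (unb j) < w.1 (bar a)) := by
      have : unb j < bar a := by rw [Fin.lt_def, val_unb]; omega
      have h' : a < unb j ↔ i < j := Iff.rfl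
      rw [h']; tauto
    have e2 : (a < bar (unb j) ∧ bar (unb j) < bar a ∧ w.1 a < w.1 (bar (unb j)) ∧
        w.1 (bar (unb j)) < w.1 (bar a)) ↔
        (i < j ∧ w.1 a < w.1 (unb j) ∧ w.1 (unb j) < w.1 (bar a)) := by
      have hb : a < bar (unb j) := by
        have := val_unb j
        rw [Fin.lt_def, val_bar]; omega
      have e4 : w.1 a < bar (w.1 (unb j)) ↔ w.1 (unb j) < bar (w.1 a) := by
        rw [← bar_lt_bar, bar_bar]
      have h' : a < unb j ↔ i < j := Iff.rfl
      rw [bar_lt_bar, h', apply_bar, apply_bar, bar_lt_bar, e4]; tauto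
    simp only [e1, e2]
    split_ifs <;> rfl
  rw [e, inversions_mul_swap _ hlt hw, hbt, negCount_mul_swap _ hlt.ne] at h2
  have hwa := apply_bar w a
  have v1 := val_bar (w.1 a)
  rw [← hwa] at v1
  have hw' : (w.1 a).val < (w.1 (bar a)).val := hw
  rw [if_neg (show ¬ (bar a).val < n by omega), if_pos (show a.val < n by omega),
    if_neg (show ¬ n ≤ (w.1 a).val by omega), if_pos (show n ≤ (w.1 (bar a)).val by omega)] at h2
  push_cast at h2 ⊢
  omega

/-- Again two mirror transpositions act. If the exchanged values lie in different halves, `negCount`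
grows by two, and exactly one of the two transpositions sees one further letter in between, so twice
the length grows by four more. -/
theorem length_mul_reflection_bar {n : ℕ} (w : SignedPerm n) {i j : Fin n} (hij : i < j)
    (hw : w.1 (unb i) < w.1 (bar (unb j))) :
    length (w * reflection (unb i, bar (unb j))) = length w + 1 +
      2 * (Finset.univ.filter (fun z : Letter n => z ≠ unb j ∧ unb i < z ∧ z < bar (unb j) ∧
        w.1 (unb i) < w.1 z ∧ w.1 z < w.1 (bar (unb j)))).card +
      if (w.1 (unb i)).val < n ∧ n ≤ (w.1 (bar (unb j))).val then 2 else 0 := by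
  have hi := i.isLt
  have hj := j.isLt
  have hij' : i.val < j.val := hij
  set a := unb i with ha
  set c := unb j with hc
  have va : a.val = i.val := rfl
  have vc : c.val = j.val := rfl
  have va' := val_bar a
  have vc' := val_bar c
  set M := (Finset.univ.filter (fun z : Letter n => z ≠ c ∧ a < z ∧ z < bar c ∧
        w.1 a < w.1 z ∧ w.1 z < w.1 (bar c))).card with hM
  have hne : bar c ≠ bar a := by simp only [ne_eq, Fin.ext_iff]; omega
  have h1 := two_mul_length w
  have h2 := two_mul_length (w * reflection (a, bar c))
  have e : (w * reflection (a, bar c)).1 = w.1 * Equiv.swap a (bar c) * Equiv.swap c (bar a) := by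
    rw [mul_assoc]
    change w.1 * (reflection (a, bar c)).1 = _
    rw [coe_reflection_of_ne hne, bar_bar]
  have hac : a < bar c := by rw [Fin.lt_def]; omega
  have hca : c < bar a := by rw [Fin.lt_def]; omega
  have fixc : (w.1 * Equiv.swap a (bar c)) c = w.1 c := by
    rw [Equiv.Perm.mul_apply, Equiv.swap_apply_of_ne_of_ne _ (bar_ne c).symm]
    simp only [ne_eq, Fin.ext_iff]; omega
  have fixa : (w.1 * Equiv.swap a (bar c)) (bar a) = bar (w.1 a) := by
    rw [Equiv.Perm.mul_apply, Equiv.swap_apply_of_ne_of_ne (bar_ne a) hne.symm, apply_bar]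
  have hwc : w.1 c = bar (w.1 (bar c)) := by rw [apply_bar, bar_bar]
  -- Position `c` lies between `a` and `c̄`. It is split off here, and `c̄` below, since the two
  -- transpositions treat these positions differently.
  have hb1 : between w.1 a (bar c) = M + if w.1 a < w.1 c ∧ w.1 c < w.1 (bar c) then 1 else 0 := by
    rw [hM]; unfold between
    rw [Finset.card_filter, Finset.card_filter, ← Finset.sum_erase_add _ _ (Finset.mem_univ c),
      ← Finset.sum_erase_add (a := c) _ _ (Finset.mem_univ c)]
    rw [if_neg (show ¬ (c ≠ c ∧ _) by simp), add_zero]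
    congr 1
    · refine Finset.sum_congr rfl fun z hz => ?_
      have := Finset.ne_of_mem_erase hz
      simp [this]
    · have h3 : a < c := hij
      have h4 : c < bar c := by rw [Fin.lt_def]; omega
      simp [h3, h4]
  have hb2 : between (w.1 * Equiv.swap a (bar c)) c (bar a) =
      M + if w.1 c < w.1 a ∧ w.1 a < bar (w.1 a) then 1 else 0 := by
    rw [hM]; unfold between
    rw [← card_filter_bar (fun z => z ≠ c ∧ _), fixc, fixa]
    rw [Finset.card_filter, Finset.card_filter, ← Finset.sum_erase_add _ _ (Finset.mem_univ (bar c)),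
      ← Finset.sum_erase_add (a := bar c) _ _ (Finset.mem_univ (bar c))]
    rw [if_neg (show ¬ (bar (bar c) ≠ c ∧ _) by simp [bar_bar]), add_zero]
    congr 1
    · refine Finset.sum_congr rfl fun z hz => ?_
      have hz := Finset.ne_of_mem_erase hz
      have hz2 : bar z ≠ c := fun h => hz (by rw [← h, bar_bar])
      have e1 : a < bar z ↔ z < bar a := by rw [← bar_lt_bar, bar_bar]
      have e2 : bar z < bar c ↔ c < z := bar_lt_bar
      have e3 : w.1 a < w.1 (bar z) ↔ w.1 z < bar (w.1 a) := by
        rw [apply_bar, ← bar_lt_bar, bar_bar]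
      have e4 : w.1 (bar z) < w.1 (bar c) ↔ w.1 c < w.1 z := by
        rw [apply_bar, apply_bar, bar_lt_bar]
      by_cases hza : z = a
      · have : ¬ c < z := by rw [hza, Fin.lt_def]; omega
        simp [this, e2]
      · rw [Equiv.Perm.mul_apply, Equiv.swap_apply_of_ne_of_ne hza hz]
        simp only [e1, e2, e3, e4, ne_eq, hz2, not_false_iff, true_and]
        congr 1
        exact propext ⟨fun h => ⟨h.2.1, h.1, h.2.2.2, h.2.2.1⟩, fun h => ⟨h.2.1, h.1, h.2.2.2, h.2.2.1⟩⟩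
    · have h3 : c < bar c := by rw [Fin.lt_def]; omega
      have h4 : bar c < bar a := bar_lt_bar.2 hij
      simp [h3, h4]
  have hw' : (w.1 a).val < (w.1 (bar c)).val := hw
  have v1 : (w.1 c).val = 2 * n - 1 - (w.1 (bar c)).val := by rw [hwc, val_bar]
  have v2 := val_bar (w.1 a)
  have v3 := (w.1 a).isLt
  have v4 := (w.1 (bar c)).isLt
  have hlt2 : w.1 c < bar (w.1 a) := by rw [Fin.lt_def]; omega
  rw [e, inversions_mul_swap _ hca (by rw [fixa, fixc]; exact hlt2),
    inversions_mul_swap _ hac hw, hb1, hb2, negCount_mul_swap _ hca.ne,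
    negCount_mul_swap _ hac.ne, fixa, fixc] at h2
  simp only [Fin.lt_def] at h2
  rw [if_neg (show ¬ (bar a).val < n by omega), if_neg (show ¬ (bar c).val < n by omega),
    if_pos (show a.val < n by omega), if_pos (show c.val < n by omega)] at h2
  push_cast at h2 ⊢
  -- The values at `a` and `c` differ, so exactly one of the two extra indicators holds when the
  -- exchanged values lie in different halves.
  have v5 : (w.1 c).val ≠ (w.1 a).val := fun h => by
    have := w.1.injective (Fin.ext h)
    rw [Fin.ext_iff] at this; omega
  split_ifs at h2 ⊢ <;> omega


/-- If the length rises, the rise is controlled by the number of positions strictly between the two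
exchanged ones, and this number is governed by `⟨ρ, α^∨⟩`. If it falls, then `w` is obtained from `w
s_α` by a rise, and the inequality is clear. -/
theorem length_mul_reflection_bound {n : ℕ} (w : SignedPerm n) {r : Letter n × Letter n}
    (hr : IsPositiveRoot r) :
    length (w * reflection r) ≠ length w ∧
      (length (w * reflection r) : ℚ) + 1 ≤ length w + 2 * (rho n ⬝ᵥ coroot r) ∧
      1 ≤ rho n ⬝ᵥ coroot r := by
  have main : ∀ a b : Letter n, a ≠ b → 1 ≤ rho n ⬝ᵥ coroot (a, b) →
      (∀ w : SignedPerm n, w.1 a < w.1 b → length w < length (w * reflection (a, b)) ∧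
        (length (w * reflection (a, b)) : ℚ) + 1 ≤ length w + 2 * (rho n ⬝ᵥ coroot (a, b))) →
      length (w * reflection (a, b)) ≠ length w ∧
      (length (w * reflection (a, b)) : ℚ) + 1 ≤ length w + 2 * (rho n ⬝ᵥ coroot (a, b)) ∧
      1 ≤ rho n ⬝ᵥ coroot (a, b) := by
    intro a b hab h1 hup
    rcases lt_trichotomy (w.1 a) (w.1 b) with h | h | h
    · exact ⟨(hup w h).1.ne', (hup w h).2, h1⟩
    · exact absurd (w.1.injective h) hab
    · have := (hup (w * reflection (a, b)) (by
        rwa [mul_reflection_apply_left w hab, mul_reflection_apply_right w hab])).1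
      rw [mul_reflection_cancel] at this
      refine ⟨this.ne, ?_, h1⟩
      have h2 : (length (w * reflection (a, b)) : ℚ) + 1 ≤ length w := by exact_mod_cast this
      linarith
  obtain ⟨i, j, ⟨hij, rfl | rfl⟩ | rfl⟩ := hr
  · have h0 : i.val + 1 ≤ j.val := hij
    have h0' : (i.val : ℚ) + 1 ≤ j.val := by exact_mod_cast h0
    refine main _ _ ?_ ?_ ?_
    · simp only [ne_eq, Fin.ext_iff, val_unb]; omega
    · rw [rho_coroot_unb hij]; linarith
    · intro w hw
      rw [length_mul_reflection_unb w hij hw, rho_coroot_unb hij]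
      refine ⟨by omega, ?_⟩
      have : between w.1 (unb i) (unb j) ≤ j.val - i.val - 1 := by
        calc _ ≤ (Finset.Ioo (unb i) (unb j)).card := by
              apply Finset.card_le_card; intro z; simp only [Finset.mem_filter, Finset.mem_Ioo]; tauto
          _ = _ := by rw [Fin.card_Ioo, val_unb, val_unb]
      have h2 : between w.1 (unb i) (unb j) + i.val + 1 ≤ j.val := by omega
      have : (between w.1 (unb i) (unb j) : ℚ) + i.val + 1 ≤ j.val := by exact_mod_cast h2
      push_cast
      linarith
  · have h0 : i.val + 1 ≤ j.val := hij
    have hj := j.isLt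
    have h0' : (i.val : ℚ) + j.val + 1 ≤ 2 * n := by
      have : i.val + j.val + 1 ≤ 2 * n := by omega
      exact_mod_cast this
    refine main _ _ ?_ ?_ ?_
    · simp only [ne_eq, Fin.ext_iff, val_bar, val_unb]; omega
    · rw [rho_coroot_bar hij]; linarith
    · intro w hw
      rw [length_mul_reflection_bar w hij hw, rho_coroot_bar hij]
      refine ⟨by omega, ?_⟩
      set M := (Finset.univ.filter (fun z : Letter n => z ≠ unb j ∧ unb i < z ∧ z < bar (unb j) ∧
        w.1 (unb i) < w.1 z ∧ w.1 z < w.1 (bar (unb j)))).card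
      have : M + 1 ≤ 2 * n - 1 - j.val - i.val - 1 := by
        calc M + 1 ≤ ((Finset.Ioo (unb i) (bar (unb j))).erase (unb j)).card + 1 := by
              gcongr
              apply Finset.card_le_card; intro z
              simp only [Finset.mem_filter, Finset.mem_Ioo, Finset.mem_erase]; tauto
          _ = _ := by
            rw [Finset.card_erase_add_one, Fin.card_Ioo, val_bar, val_unb, val_unb]
            simp only [Finset.mem_Ioo, Fin.lt_def, val_bar, val_unb]; omega
      have h2 : M + i.val + j.val + 3 ≤ 2 * n := by omega
      have h3 : (M : ℚ) + i.val + j.val + 3 ≤ 2 * n := by exact_mod_cast h2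
      push_cast
      split_ifs <;> linarith
  · have h0 := i.isLt
    have h0' : (i.val : ℚ) + 1 ≤ n := by exact_mod_cast h0
    refine main _ _ (bar_ne _).symm ?_ ?_
    · rw [rho_coroot_self]; linarith
    · intro w hw
      rw [length_mul_reflection_self w i hw, rho_coroot_self]
      refine ⟨by omega, ?_⟩
      set M := (Finset.univ.filter (fun j : Fin n => i < j ∧ w.1 (unb i) < w.1 (unb j) ∧
        w.1 (unb j) < w.1 (bar (unb i)))).card
      have : M ≤ n - 1 - i.val := by
        calc M ≤ (Finset.Ioi i).card := by
              apply Finset.card_le_card; intro z; simp only [Finset.mem_filter, Finset.mem_Ioi]; tauto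
          _ = _ := by rw [Fin.card_Ioi]
      have h2 : M + i.val + 1 ≤ n := by omega
      have : (M : ℚ) + i.val + 1 ≤ n := by exact_mod_cast h2
      push_cast
      linarith

/-! ### The level statistic and paths in the quantum Bruhat graph -/

theorem bruhatLT_mul_reflection_iff {n : ℕ} (w : SignedPerm n) {r : Letter n × Letter n}
    (hr : IsPositiveRoot r) : BruhatLT w (w * reflection r) ↔
      length w < length (w * reflection r) := by
  refine ⟨fun h => ?_, fun h => Relation.TransGen.single ⟨r, hr, rfl, h⟩⟩
  have : ∀ u v : SignedPerm n, BruhatLT u v → length u < length v := by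
    intro u v h
    induction h with
    | single h => exact h.choose_spec.2.2
    | tail _ h ih => exact ih.trans h.choose_spec.2.2
  exact this _ _ h

theorem eq_one_of_length_eq_zero {n : ℕ} {w : SignedPerm n} (h : length w = 0) : w = 1 := by
  have h0 : ∀ (i : Fin n) (l : Letter n), unb i ≤ absLetter l → ¬ w.1 l < w.1 (unb i) := by
    intro i l h1 h2
    have := Finset.card_eq_zero.1 h
    have hm : (i, l) ∈ (∅ : Finset (Fin n × Letter n)) := by
      rw [← this]; simp [h1, h2]
    simp at hm
  have e1 : ∀ j : Fin n, absLetter (unb j) = unb j := by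
    intro j; apply min_eq_left; rw [Fin.le_def, val_bar, val_unb]; omega
  have e2 : ∀ j : Fin n, absLetter (bar (unb j)) = unb j := by
    intro j; rw [absLetter, bar_bar]; apply min_eq_right; rw [Fin.le_def, val_bar, val_unb]; omega
  have hmono : StrictMono w.1 := by
    intro x y hxy
    have hxy' : x.val < y.val := hxy
    have hx := x.isLt
    have hy := y.isLt
    refine lt_of_le_of_ne ?_ (fun h => hxy.ne (w.1.injective h))
    have key : ∀ (x y : Letter n), x.val < y.val → x.val ≤ 2 * n - 1 - y.val →
        w.1 x ≤ w.1 y := by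
      intro x y h1 h2
      have hx : x.val < n := by omega
      have ex : x = unb ⟨x.val, hx⟩ := rfl
      rw [ex]
      refine not_lt.1 (h0 _ _ ?_)
      rw [absLetter, le_min_iff, Fin.le_def, Fin.le_def, val_unb, val_bar]
      exact ⟨h1.le, h2⟩
    -- The length counts only pairs with `x ≤ |y|`; for any other pair the mirror pair `(ȳ, x̄)` is
    -- counted.
    rcases le_total x.val (2 * n - 1 - y.val) with h1 | h1
    · exact key x y hxy' h1
    · have := key (bar y) (bar x) (by rw [val_bar, val_bar]; omega) (by
        rw [val_bar, val_bar]; omega)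
      rw [apply_bar, apply_bar] at this
      exact Fin.rev_le_rev.1 this
  have : w.1 = 1 := by
    -- A finite chain has only one order automorphism.
    have h := Subsingleton.elim (OrderIso.ofRelIsoLT ⟨w.1, @fun a b => hmono.lt_iff_lt⟩)
      (OrderIso.refl (Letter n))
    ext x
    exact congrArg (fun f : Letter n ≃o Letter n => (f x).val) h
  exact Subtype.ext this

theorem length_one {n : ℕ} : length (1 : SignedPerm n) = 0 := by
  rw [length, Finset.card_eq_zero, Finset.filter_eq_empty_iff]
  rintro ⟨i, l⟩ - ⟨h1, h2⟩
  have h3 : l < unb i := h2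
  exact absurd (h1.trans (min_le_left _ _)) (not_le.2 h3)

theorem isPositiveRoot_of_mem_gamma {n k : ℕ} {r : Letter n × Letter n} (hr : r ∈ gamma n k) :
    IsPositiveRoot r := by
  have hseg : ∀ i, r ∈ gammaSeg i → IsPositiveRoot r := by
    intro i h
    simp only [gammaSeg, List.mem_map, List.mem_filter, List.mem_finRange, true_and,
      decide_eq_true_eq] at h
    obtain ⟨p, hp, rfl⟩ := h
    exact ⟨p, i, Or.inl ⟨hp, Or.inr rfl⟩⟩
  simp only [gamma, gammaR, gammaL, gammaKSeg, List.mem_append, List.mem_flatMap, List.mem_map,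
    List.mem_filter, List.mem_reverse, List.mem_finRange, true_and, decide_eq_true_eq,
    List.mem_singleton] at hr
  obtain ⟨i, -, h⟩ | ⟨i, hi, ((h | ⟨j, hj, rfl⟩) | rfl) | ⟨j, hj, rfl⟩⟩ := hr
  · exact hseg i h
  · exact hseg i h
  · exact ⟨i, j, Or.inl ⟨Nat.lt_of_lt_of_le hi hj, Or.inr rfl⟩⟩
  · exact ⟨i, i, Or.inr rfl⟩
  · exact ⟨i, j, Or.inl ⟨Nat.lt_of_lt_of_le hi hj, Or.inl rfl⟩⟩

theorem isPositiveRoot_of_mem_chain {n : ℕ} {μ : Fin n → ℕ} {r : Letter n × Letter n}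
    (hr : r ∈ chain μ) : IsPositiveRoot r := by
  simp only [chain, List.mem_flatMap] at hr
  obtain ⟨j, -, h⟩ := hr
  exact isPositiveRoot_of_mem_gamma h

theorem partialProd_zero {n : ℕ} {μ : Fin n → ℕ} (wJ : FoldingPair μ) : partialProd wJ 0 = wJ.1 := by
  simp [partialProd]

theorem filter_lt_succ_finRange {m : ℕ} (P : Fin m → Prop) [DecidablePred P] (p : Fin m) :
    (List.finRange m).filter (fun q => P q ∧ q.val < p.val + 1) =
      (List.finRange m).filter (fun q => P q ∧ q.val < p.val) ++ if P p then [p] else [] := by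
  induction m with
  | zero => exact p.elim0
  | succ m ih =>
    rw [List.finRange_succ, List.filter_cons, List.filter_cons]
    rcases Fin.eq_zero_or_eq_succ p with rfl | ⟨p, rfl⟩
    · simp only [List.filter_map]
      have : ∀ (Q : Fin m → Prop) [DecidablePred Q], List.filter (fun q => decide (Q q ∧ (Fin.succ q).val < (0 : ℕ) + 1))
          (List.finRange m) = [] := by
        intro Q _; rw [List.filter_eq_nil_iff]; intro a _; simp
      have e1 : ((fun q : Fin (m+1) => decide (P q ∧ q.val < (0 : Fin (m+1)).val + 1)) ∘ Fin.succ) =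
        (fun q : Fin m => decide (P (Fin.succ q) ∧ (Fin.succ q).val < (0 : ℕ) + 1)) := rfl
      rw [e1, this]
      have e2 : ((fun q : Fin (m+1) => decide (P q ∧ q.val < (0 : Fin (m+1)).val)) ∘ Fin.succ) =
        (fun q : Fin m => false) := by funext q; simp
      rw [e2]
      by_cases h : P 0 <;> simp [h]
    · have := ih (fun q => P (Fin.succ q)) p
      simp only [List.filter_map]
      have e1 : ∀ c, ((fun q : Fin (m+1) => decide (P q ∧ q.val < c + 1)) ∘ Fin.succ) =
        (fun q : Fin m => decide (P (Fin.succ q) ∧ q.val < c)) := by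
        intro c; funext q; simp
      rw [Fin.val_succ, e1, e1, this]
      by_cases h : P 0 <;> by_cases h2 : P p.succ <;> simp [h, h2]

theorem partialProd_succ {n : ℕ} {μ : Fin n → ℕ} (wJ : FoldingPair μ) (p : Fin (chain μ).length) :
    partialProd wJ (p.val + 1) = if p ∈ wJ.2 then
      partialProd wJ p.val * reflection ((chain μ).get p) else partialProd wJ p.val := by
  have := filter_lt_succ_finRange (fun q => q ∈ wJ.2) p
  unfold partialProd
  rw [this]
  split_ifs with h
  · simp [mul_assoc]
  · simp

/-- A sum of nonnegative terms vanishes iff every term does. Along a folding the Bruhat order is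
just the comparison of lengths, so each term depends only on the two lengths and the height of the
coroot, and `length_mul_reflection_bound` applies to it. -/
theorem mem_FBar_iff {n : ℕ} {μ : Fin n → ℕ} (wJ : FoldingPair μ) :
    wJ ∈ FBar μ ↔ IsQuantumBruhatPath wJ := by
  classical
  set P := partialProd wJ with hP
  set m := (chain μ).length with hm
  set ht : Fin m → ℚ := fun p => rho n ⬝ᵥ coroot ((chain μ).get p) with hht
  -- The contribution of one folding to the level. A rise contributes half of the defect in the
  -- bound `ℓ(w s_α) + 1 ≤ ℓ(w) + 2⟨ρ, α^∨⟩`, a fall half of the excess over one.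
  set f : Fin m → ℚ := fun p => (1 / 2 : ℚ) * ((length (P p.val) : ℚ) - length (P (p.val + 1)) - 1) +
    if length (P p.val) < length (P (p.val + 1)) then ht p else 0 with hf
  have hpos : ∀ p : Fin m, IsPositiveRoot ((chain μ).get p) := fun p =>
    isPositiveRoot_of_mem_chain (List.get_mem _ _)
  have hstep : ∀ p ∈ wJ.2, P (p.val + 1) = P p.val * reflection ((chain μ).get p) := by
    intro p hp; rw [hP, partialProd_succ, if_pos hp]
  have hstep' : ∀ p ∈ wJ.2, P p.val = P (p.val + 1) * reflection ((chain μ).get p) := by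
    intro p hp; rw [hstep p hp, mul_reflection_cancel]
  have htel : (length wJ.1 : ℚ) - length (endElt wJ) =
      ∑ p ∈ wJ.2, ((length (P p.val) : ℚ) - length (P (p.val + 1))) := by
    -- Positions outside `J` leave the partial product unchanged, so the sum may run over the whole
    -- chain, where it telescopes.
    have h1 : ∑ p ∈ wJ.2, ((length (P p.val) : ℚ) - length (P (p.val + 1))) =
        ∑ p : Fin m, ((length (P p.val) : ℚ) - length (P (p.val + 1))) := by
      apply Finset.sum_subset (Finset.subset_univ _)
      intro p _ hp
      rw [hP, partialProd_succ, if_neg hp, sub_self]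
    rw [h1, Fin.sum_univ_eq_sum_range (fun p => (length (P p) : ℚ) - length (P (p + 1))) m,
      Finset.sum_range_sub', hP, partialProd_zero]
    rfl
  have hneg : ∑ p ∈ negFoldings wJ, ht p =
      ∑ p ∈ wJ.2, if length (P p.val) < length (P (p.val + 1)) then ht p else 0 := by
    unfold negFoldings
    rw [Finset.sum_filter]
    refine Finset.sum_congr rfl fun p hp => ?_
    have := bruhatLT_mul_reflection_iff (P p.val) (hpos p)
    rw [← hstep p hp] at this
    simp only [← hP, this]
  have hsum : (1 / 2 : ℚ) * ((length wJ.1 : ℚ) + (length (endElt wJ) : ℚ) - (wJ.2.card : ℚ)) +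
      ∑ p ∈ negFoldings wJ, ht p = length (endElt wJ) + ∑ p ∈ wJ.2, f p := by
    rw [hneg, hf]
    simp only [Finset.sum_add_distrib, ← Finset.mul_sum, Finset.sum_sub_distrib] at htel ⊢
    rw [Finset.sum_const, nsmul_eq_mul]
    linarith
  have hfb : ∀ p ∈ wJ.2, 0 ≤ f p ∧ (f p = 0 ↔ QuantumBruhatEdge (P (p.val + 1)) ((chain μ).get p)) := by
    intro p hp
    obtain ⟨h1, h2, h3⟩ := length_mul_reflection_bound (P p.val) (hpos p)
    rw [← hstep p hp] at h1 h2
    unfold QuantumBruhatEdge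
    rw [← hstep' p hp]
    simp only [hf, hht]
    split_ifs with h
    · refine ⟨by linarith, ?_⟩
      constructor
      · intro h4; right; linarith
      · rintro (h4 | h4)
        · omega
        · linarith
    · have h5 : length (P (p.val + 1)) + 1 ≤ length (P p.val) := by omega
      have h6 : (length (P (p.val + 1)) : ℚ) + 1 ≤ length (P p.val) := by exact_mod_cast h5
      refine ⟨by linarith, ?_⟩
      constructor
      · intro h4; left
        have : (length (P p.val) : ℚ) = length (P (p.val + 1)) + 1 := by linarith
        exact_mod_cast this
      · rintro (h4 | h4)
        · rw [h4]; push_cast; ring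
        · linarith
  change _ = (0 : ℚ) ↔ _
  rw [hsum, add_eq_zero_iff_of_nonneg (Nat.cast_nonneg _) (Finset.sum_nonneg fun p hp => (hfb p hp).1),
    Finset.sum_eq_zero_iff_of_nonneg (fun p hp => (hfb p hp).1)]
  refine and_congr ⟨fun h => eq_one_of_length_eq_zero (by exact_mod_cast h), fun h => ?_⟩
    (forall₂_congr fun p hp => (hfb p hp).2)
  rw [h, length_one, Nat.cast_zero]


/-! ### Edges of the quantum Bruhat graph as conditions on values -/

/-- `x` lies strictly between `a` and `b` in the cyclic order. -/
def Cyc (a x b : ℕ) : Prop := a < x ∧ x < b ∨ x < b ∧ b < a ∨ b < a ∧ a < x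

/-- The signed permutation `w` as a function on natural numbers. -/
def value {n : ℕ} (w : SignedPerm n) (p : ℕ) : ℕ := if h : p < 2 * n then (w.1 ⟨p, h⟩).val else p

theorem value_coe {n : ℕ} (w : SignedPerm n) (x : Letter n) : value w x.val = (w.1 x).val := by
  rw [value, dif_pos x.isLt]

theorem value_lt {n : ℕ} (w : SignedPerm n) {p : ℕ} (hp : p < 2 * n) : value w p < 2 * n := by
  rw [value, dif_pos hp]; exact Fin.isLt _

theorem value_inj {n : ℕ} (w : SignedPerm n) {p q : ℕ} (hp : p < 2 * n) (hq : q < 2 * n)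
    (h : value w p = value w q) : p = q := by
  rw [value, value, dif_pos hp, dif_pos hq] at h
  exact congrArg Fin.val (w.1.injective (Fin.ext h))

theorem value_surj {n : ℕ} (w : SignedPerm n) {y : ℕ} (hy : y < 2 * n) :
    ∃ p, p < 2 * n ∧ value w p = y := by
  refine ⟨(w.1.symm ⟨y, hy⟩).val, Fin.isLt _, ?_⟩
  rw [value_coe, Equiv.apply_symm_apply]

theorem value_bar {n : ℕ} (w : SignedPerm n) {p : ℕ} (hp : p < 2 * n) :
    value w (2 * n - 1 - p) = 2 * n - 1 - value w p := by
  have h := val_bar (⟨p, hp⟩ : Letter n)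
  rw [← h, value_coe, apply_bar, val_bar, value, dif_pos hp]

theorem value_mul_left {n : ℕ} (w : SignedPerm n) {a b : Letter n} (hab : a ≠ b) :
    value (w * reflection (a, b)) a.val = value w b.val := by
  rw [value_coe, value_coe, mul_reflection_apply_left w hab]

theorem value_mul_right {n : ℕ} (w : SignedPerm n) {a b : Letter n} (hab : a ≠ b) :
    value (w * reflection (a, b)) b.val = value w a.val := by
  rw [value_coe, value_coe, mul_reflection_apply_right w hab]

theorem value_mul_of_ne {n : ℕ} (w : SignedPerm n) {a b : Letter n} {p : ℕ} (h1 : p ≠ a.val)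
    (h2 : p ≠ b.val) (h3 : p ≠ 2 * n - 1 - a.val) (h4 : p ≠ 2 * n - 1 - b.val) :
    value (w * reflection (a, b)) p = value w p := by
  unfold value
  split_ifs with hp
  · rw [mul_reflection_apply_of_ne w] <;> simpa only [ne_eq, Fin.ext_iff, val_bar]
  · rfl

/-- An upward edge requires that no intermediate position has a value between the two. A downward
edge is the extremal case of the length bound, in which every intermediate position has one. In the
cyclic order both conditions read the same. -/
theorem edge_unb_iff {n : ℕ} (w : SignedPerm n) {i j : Fin n} (hij : i < j) :
    QuantumBruhatEdge w (unb i, unb j) ↔ ∀ l, i.val < l → l < j.val →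
      ¬ Cyc (value w i.val) (value w l) (value w j.val) := by
  have hij' : i.val < j.val := hij
  have hj := j.isLt
  have hne : unb i ≠ unb j := by simp only [ne_eq, Fin.ext_iff, val_unb]; omega
  have vi : value w i.val = (w.1 (unb i)).val := value_coe w (unb i)
  have vj : value w j.val = (w.1 (unb j)).val := value_coe w (unb j)
  unfold QuantumBruhatEdge
  rw [rho_coroot_unb hij]
  have hq : (i.val : ℚ) + 1 ≤ j.val := by exact_mod_cast hij'
  rcases lt_trichotomy (w.1 (unb i)) (w.1 (unb j)) with h | h | h
  · have h' : (w.1 (unb i)).val < (w.1 (unb j)).val := h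
    have h1 := length_mul_reflection_unb w hij h
    have h2 : between w.1 (unb i) (unb j) = 0 ↔ ∀ l, i.val < l → l < j.val →
        ¬ Cyc (value w i.val) (value w l) (value w j.val) := by
      rw [between, Finset.card_eq_zero, Finset.filter_eq_empty_iff]
      constructor
      · intro h3 l h4 h5 h6
        have h7 := value_coe w (⟨l, by omega⟩ : Letter n)
        refine @h3 ⟨l, by omega⟩ (Finset.mem_univ _) ⟨h4, h5, ?_⟩
        simp only [Fin.lt_def, ← h7]
        unfold Cyc at h6
        omega
      · rintro h3 z - ⟨h4, h5, h6, h7⟩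
        refine h3 z.val h4 h5 (Or.inl ?_)
        rw [vi, vj, value_coe]; exact ⟨h6, h7⟩
    rw [← h2, h1]
    constructor
    · rintro (h3 | h3)
      · omega
      · push_cast at h3
        have := Nat.cast_nonneg (α := ℚ) (between w.1 (unb i) (unb j))
        linarith
    · intro h3; left; omega
  · exact absurd (w.1.injective h) hne
  · have h' : (w.1 (unb j)).val < (w.1 (unb i)).val := h
    have h1 := length_mul_reflection_unb (w * reflection (unb i, unb j)) hij (by
      rwa [mul_reflection_apply_left w hne, mul_reflection_apply_right w hne])
    rw [mul_reflection_cancel] at h1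
    set m := between (w * reflection (unb i, unb j)).1 (unb i) (unb j) with hm
    have hsub : (Finset.univ.filter (fun z => unb i < z ∧ z < unb j ∧
        w.1 (unb j) < w.1 z ∧ w.1 z < w.1 (unb i))) ⊆ Finset.Ioo (unb i) (unb j) := by
      intro z; simp only [Finset.mem_filter, Finset.mem_Ioo]; tauto
    have hm' : m = (Finset.univ.filter (fun z => unb i < z ∧ z < unb j ∧
        w.1 (unb j) < w.1 z ∧ w.1 z < w.1 (unb i))).card := by
      rw [hm, between, mul_reflection_apply_left w hne, mul_reflection_apply_right w hne]
      congr 1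
      ext z
      simp only [Finset.mem_filter, Finset.mem_univ, true_and]
      refine and_congr_right fun h3 => and_congr_right fun h4 => ?_
      have h3 : i.val < z.val := h3
      have h4 : z.val < j.val := h4
      rw [mul_reflection_apply_of_ne] <;> simp only [ne_eq, Fin.ext_iff, val_bar, val_unb] <;> omega
    have h2 : m = j.val - i.val - 1 ↔ ∀ l, i.val < l → l < j.val →
        ¬ Cyc (value w i.val) (value w l) (value w j.val) := by
      have : m = j.val - i.val - 1 ↔ (Finset.univ.filter (fun z => unb i < z ∧ z < unb j ∧
        w.1 (unb j) < w.1 z ∧ w.1 z < w.1 (unb i))) = Finset.Ioo (unb i) (unb j) := by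
        have e : (Finset.Ioo (unb i) (unb j)).card = j.val - i.val - 1 := by
          rw [Fin.card_Ioo, val_unb, val_unb]
        rw [hm', ← e]
        exact ⟨fun h => Finset.eq_of_subset_of_card_le hsub h.ge, fun h => by rw [h]⟩
      rw [this]
      constructor
      · intro h3 l h4 h5 h6
        have h8 : (⟨l, by omega⟩ : Letter n) ∈ Finset.Ioo (unb i) (unb j) := by
          rw [Finset.mem_Ioo]; exact ⟨h4, h5⟩
        rw [← h3, Finset.mem_filter] at h8
        have h9 : (w.1 (unb j)).val < (w.1 (⟨l, by omega⟩ : Letter n)).val := h8.2.2.2.1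
        have h10 : (w.1 (⟨l, by omega⟩ : Letter n)).val < (w.1 (unb i)).val := h8.2.2.2.2
        have h7 : value w l = (w.1 ⟨l, by omega⟩).val := value_coe w (⟨l, by omega⟩ : Letter n)
        unfold Cyc at h6
        omega
      · intro h3
        refine Finset.Subset.antisymm hsub fun z hz => ?_
        rw [Finset.mem_Ioo] at hz
        have h4 := h3 z.val hz.1 hz.2
        have h5 : z.val ≠ i.val := by have : i.val < z.val := hz.1; omega
        have h6 : z.val ≠ j.val := by have : z.val < j.val := hz.2; omega
        have h7 : value w z.val ≠ value w i.val := fun h =>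
          h5 (value_inj w z.isLt (by omega) h)
        have h8 : value w z.val ≠ value w j.val := fun h =>
          h6 (value_inj w z.isLt (by omega) h)
        simp only [Finset.mem_filter, Finset.mem_univ, true_and]
        refine ⟨hz.1, hz.2, ?_⟩
        rw [Fin.lt_def, Fin.lt_def, ← value_coe w z, ← vi, ← vj]
        unfold Cyc at h4
        omega
    rw [← h2]
    constructor
    · rintro (h3 | h3)
      · omega
      · rw [h1] at h3
        push_cast at h3
        have : (m : ℚ) + i.val + 1 = j.val := by linarith
        have : m + i.val + 1 = j.val := by exact_mod_cast this
        omega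
    · intro h3
      right
      have : m + i.val + 1 = j.val := by omega
      have : (m : ℚ) + i.val + 1 = j.val := by exact_mod_cast this
      rw [h1]; push_cast; linarith

/-- The same dichotomy as for `edge_unb_iff`; by mirror symmetry it is enough to test the unbarred
positions after `i`. -/
theorem edge_self_iff {n : ℕ} (w : SignedPerm n) (i : Fin n) :
    QuantumBruhatEdge w (unb i, bar (unb i)) ↔ ∀ l, i.val < l → l < n →
      ¬ Cyc (value w i.val) (value w l) (value w (2 * n - 1 - i.val)) := by
  have hi := i.isLt
  have hne : unb i ≠ bar (unb i) := (bar_ne _).symm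
  have vi : value w i.val = (w.1 (unb i)).val := value_coe w (unb i)
  have vj : value w (2 * n - 1 - i.val) = (w.1 (bar (unb i))).val := by
    rw [← value_coe, val_bar, val_unb]
  unfold QuantumBruhatEdge
  rw [rho_coroot_self]
  have hq : (i.val : ℚ) + 1 ≤ n := by exact_mod_cast hi
  rcases lt_trichotomy (w.1 (unb i)) (w.1 (bar (unb i))) with h | h | h
  · have h' : (w.1 (unb i)).val < (w.1 (bar (unb i))).val := h
    have h1 := length_mul_reflection_self w i h
    set m := (Finset.univ.filter (fun j : Fin n => i < j ∧ w.1 (unb i) < w.1 (unb j) ∧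
        w.1 (unb j) < w.1 (bar (unb i)))).card with hm
    have h2 : m = 0 ↔ ∀ l, i.val < l → l < n →
        ¬ Cyc (value w i.val) (value w l) (value w (2 * n - 1 - i.val)) := by
      rw [hm, Finset.card_eq_zero, Finset.filter_eq_empty_iff]
      constructor
      · intro h3 l h4 h5 h6
        have h7 : value w l = (w.1 (unb ⟨l, h5⟩)).val := value_coe w (unb ⟨l, h5⟩)
        refine @h3 ⟨l, h5⟩ (Finset.mem_univ _) ⟨h4, ?_⟩
        simp only [Fin.lt_def, ← h7]
        unfold Cyc at h6
        omega
      · rintro h3 z - ⟨h4, h6, h7⟩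
        refine h3 z.val h4 z.isLt (Or.inl ?_)
        have h8 : value w z.val = (w.1 (unb z)).val := value_coe w (unb z)
        rw [vi, vj, h8]; exact ⟨h6, h7⟩
    rw [← h2, h1]
    constructor
    · rintro (h3 | h3)
      · omega
      · push_cast at h3
        have := Nat.cast_nonneg (α := ℚ) m
        linarith
    · intro h3; left; omega
  · exact absurd (w.1.injective h) hne
  · have h' : (w.1 (bar (unb i))).val < (w.1 (unb i)).val := h
    have h1 := length_mul_reflection_self (w * reflection (unb i, bar (unb i))) i (by
      rwa [mul_reflection_apply_left w hne, mul_reflection_apply_right w hne])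
    rw [mul_reflection_cancel] at h1
    set m := (Finset.univ.filter (fun j : Fin n => i < j ∧
      (w * reflection (unb i, bar (unb i))).1 (unb i) < (w * reflection (unb i, bar (unb i))).1 (unb j) ∧
      (w * reflection (unb i, bar (unb i))).1 (unb j) <
        (w * reflection (unb i, bar (unb i))).1 (bar (unb i)))).card with hm
    have hsub : (Finset.univ.filter (fun z : Fin n => i < z ∧
        w.1 (bar (unb i)) < w.1 (unb z) ∧ w.1 (unb z) < w.1 (unb i))) ⊆ Finset.Ioi i := by
      intro z; simp only [Finset.mem_filter, Finset.mem_Ioi]; tauto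
    have hm' : m = (Finset.univ.filter (fun z : Fin n => i < z ∧
        w.1 (bar (unb i)) < w.1 (unb z) ∧ w.1 (unb z) < w.1 (unb i))).card := by
      rw [hm, mul_reflection_apply_left w hne, mul_reflection_apply_right w hne]
      congr 1
      ext z
      simp only [Finset.mem_filter, Finset.mem_univ, true_and]
      refine and_congr_right fun h3 => ?_
      have h3 : i.val < z.val := h3
      have := z.isLt
      rw [mul_reflection_apply_of_ne] <;> simp only [ne_eq, Fin.ext_iff, val_bar, val_unb] <;> omega
    have h2 : m = n - 1 - i.val ↔ ∀ l, i.val < l → l < n →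
        ¬ Cyc (value w i.val) (value w l) (value w (2 * n - 1 - i.val)) := by
      have : m = n - 1 - i.val ↔ (Finset.univ.filter (fun z : Fin n => i < z ∧
        w.1 (bar (unb i)) < w.1 (unb z) ∧ w.1 (unb z) < w.1 (unb i))) = Finset.Ioi i := by
        have e : (Finset.Ioi i).card = n - 1 - i.val := by rw [Fin.card_Ioi]
        rw [hm', ← e]
        exact ⟨fun h => Finset.eq_of_subset_of_card_le hsub h.ge, fun h => by rw [h]⟩
      rw [this]
      constructor
      · intro h3 l h4 h5 h6
        have h8 : (⟨l, h5⟩ : Fin n) ∈ Finset.Ioi i := by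
          rw [Finset.mem_Ioi]; exact h4
        rw [← h3, Finset.mem_filter] at h8
        have h7 : value w l = (w.1 (unb ⟨l, h5⟩)).val := value_coe w (unb ⟨l, h5⟩)
        have h9 : (w.1 (bar (unb i))).val < (w.1 (unb ⟨l, h5⟩)).val := h8.2.2.1
        have h10 : (w.1 (unb ⟨l, h5⟩)).val < (w.1 (unb i)).val := h8.2.2.2
        unfold Cyc at h6
        omega
      · intro h3
        refine Finset.Subset.antisymm hsub fun z hz => ?_
        rw [Finset.mem_Ioi] at hz
        have hz' : i.val < z.val := hz
        have hz2 := z.isLt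
        have h4 := h3 z.val hz z.isLt
        have h7 : value w z.val ≠ value w i.val := fun h =>
          (by omega : z.val ≠ i.val) (value_inj w (by omega) (by omega) h)
        have h8 : value w z.val ≠ value w (2 * n - 1 - i.val) := fun h =>
          (by omega : z.val ≠ 2 * n - 1 - i.val) (value_inj w (by omega) (by omega) h)
        simp only [Finset.mem_filter, Finset.mem_univ, true_and]
        refine ⟨hz, ?_⟩
        have h9 : value w z.val = (w.1 (unb z)).val := value_coe w (unb z)
        rw [Fin.lt_def, Fin.lt_def, ← h9, ← vi, ← vj]
        unfold Cyc at h4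
        omega
    rw [← h2]
    constructor
    · rintro (h3 | h3)
      · omega
      · rw [h1] at h3
        push_cast at h3
        have : (m : ℚ) + i.val + 1 = n := by linarith
        have : m + i.val + 1 = n := by exact_mod_cast this
        omega
    · intro h3
      right
      have : m + i.val + 1 = n := by omega
      have : (m : ℚ) + i.val + 1 = n := by exact_mod_cast this
      rw [h1]; push_cast; linarith

/-- For these roots there are no downward edges: the extremal drop is never attained. The two values
of an upward edge lie in one half, since otherwise the length would grow by at least three. -/
theorem edge_bar_iff {n : ℕ} (w : SignedPerm n) {i j : Fin n} (hij : i < j) :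
    QuantumBruhatEdge w (unb i, bar (unb j)) ↔ value w i.val < 2 * n - 1 - value w j.val ∧
      (n ≤ value w i.val ∨ 2 * n - 1 - value w j.val < n) ∧
      ∀ l, i.val < l → l < 2 * n - 1 - j.val →
      ¬ (value w i.val < value w l ∧ value w l < 2 * n - 1 - value w j.val) := by
  have hij' : i.val < j.val := hij
  have hj := j.isLt
  have hbar := length_mul_reflection_bound w (r := (unb i, bar (unb j))) ⟨i, j, Or.inl ⟨hij, Or.inr rfl⟩⟩
  have hne : unb i ≠ bar (unb j) := by simp only [ne_eq, Fin.ext_iff, val_bar, val_unb]; omega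
  have vi : value w i.val = (w.1 (unb i)).val := value_coe w (unb i)
  have vj' := value_bar w (p := j.val) (by omega)
  have vj : value w (2 * n - 1 - j.val) = (w.1 (bar (unb j))).val := by
    rw [← value_coe, val_bar, val_unb]
  have l1 := value_lt w (p := j.val) (by omega)
  rw [← vj']
  unfold QuantumBruhatEdge
  rw [rho_coroot_bar hij]
  have hq : (i.val : ℚ) + j.val + 1 ≤ 2 * n := by
    have : i.val + j.val + 1 ≤ 2 * n := by omega
    exact_mod_cast this
  rcases lt_trichotomy (w.1 (unb i)) (w.1 (bar (unb j))) with h | h | h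
  · have h' : (w.1 (unb i)).val < (w.1 (bar (unb j))).val := h
    have h1 := length_mul_reflection_bar w hij h
    rw [← vi, ← vj] at h1
    set m := (Finset.univ.filter (fun z : Letter n => z ≠ unb j ∧ unb i < z ∧ z < bar (unb j) ∧
        w.1 (unb i) < w.1 z ∧ w.1 z < w.1 (bar (unb j)))).card with hm
    constructor
    · rintro (h3 | h3)
      · have h4 : m = 0 := by omega
        have h5 : ¬ (value w i.val < n ∧ n ≤ value w (2 * n - 1 - j.val)) := by
          intro h5; rw [if_pos h5] at h1; omega
        refine ⟨by omega, by omega, fun l h6 h7 h8 => ?_⟩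
        rw [hm, Finset.card_eq_zero, Finset.filter_eq_empty_iff] at h4
        have h9 := value_coe w (⟨l, by omega⟩ : Letter n)
        refine @h4 ⟨l, by omega⟩ (Finset.mem_univ _) ⟨?_, h6, ?_, ?_⟩
        · simp only [ne_eq, Fin.ext_iff, val_unb]
          rintro rfl
          omega
        · rw [Fin.lt_def, val_bar, val_unb]; exact h7
        · rw [Fin.lt_def, Fin.lt_def, ← vi, ← vj, ← h9]; exact h8
      · rw [h1] at h3
        push_cast at h3
        have := Nat.cast_nonneg (α := ℚ) m
        split_ifs at h3 <;> linarith
    · rintro ⟨h3, h4, h5⟩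
      left
      rw [h1, if_neg (by omega)]
      have : m = 0 := by
        rw [hm, Finset.card_eq_zero, Finset.filter_eq_empty_iff]
        rintro z - ⟨-, h6, h7, h8, h9⟩
        refine h5 z.val h6 ?_ ?_
        · rw [Fin.lt_def, val_bar, val_unb] at h7; exact h7
        · rw [vi, vj, value_coe]; exact ⟨h8, h9⟩
      omega
  · exact absurd (w.1.injective h) hne
  · have h' : (w.1 (bar (unb j))).val < (w.1 (unb i)).val := h
    have h1 := length_mul_reflection_bar (w * reflection (unb i, bar (unb j))) hij (by
      rwa [mul_reflection_apply_left w hne, mul_reflection_apply_right w hne])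
    rw [mul_reflection_cancel] at h1
    refine ⟨fun h2 => ?_, fun h2 => by omega⟩
    -- The drop is at most `4 n - 2 i - 2 j - 3`, two less than the `2⟨ρ, α^∨⟩ - 1` of a quantum
    -- edge.
    exfalso
    set m := (Finset.univ.filter (fun z : Letter n => z ≠ unb j ∧ unb i < z ∧ z < bar (unb j) ∧
        (w * reflection (unb i, bar (unb j))).1 (unb i) < (w * reflection (unb i, bar (unb j))).1 z ∧
        (w * reflection (unb i, bar (unb j))).1 z <
          (w * reflection (unb i, bar (unb j))).1 (bar (unb j)))).card
    have hm : m + 1 ≤ 2 * n - 1 - j.val - i.val - 1 := by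
        calc m + 1 ≤ ((Finset.Ioo (unb i) (bar (unb j))).erase (unb j)).card + 1 := by
              gcongr
              apply Finset.card_le_card; intro z
              simp only [Finset.mem_filter, Finset.mem_Ioo, Finset.mem_erase]; tauto
          _ = _ := by
            rw [Finset.card_erase_add_one, Fin.card_Ioo, val_bar, val_unb, val_unb]
            simp only [Finset.mem_Ioo, Fin.lt_def, val_bar, val_unb]; omega
    have h4 : m + i.val + j.val + 3 ≤ 2 * n := by omega
    have h5 : (m : ℚ) + i.val + j.val + 3 ≤ 2 * n := by exact_mod_cast h4
    obtain ⟨e, he, h6⟩ : ∃ e ≤ 2, length w =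
        length (w * reflection (unb i, bar (unb j))) + 1 + 2 * m + e :=
      ⟨_, by split_ifs <;> omega, h1⟩
    rcases h2 with h2 | h2
    · omega
    · rw [h6] at h2
      push_cast at h2
      have : (e : ℚ) ≤ 2 := by exact_mod_cast he
      linarith

/-- The mirror image of `edge_bar_iff`: the edge seen from position `i`, whose letter moves up to
the bar of the letter at `p`. -/
theorem edge_bar_iff' {n : ℕ} (w : SignedPerm n) {p i : Fin n} (hpi : p < i) :
    QuantumBruhatEdge w (unb p, bar (unb i)) ↔ value w i.val < 2 * n - 1 - value w p.val ∧
      (n ≤ value w i.val ∨ 2 * n - 1 - value w p.val < n) ∧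
      ∀ l, i.val < l → l < 2 * n - 1 - p.val →
      ¬ (value w i.val < value w l ∧ value w l < 2 * n - 1 - value w p.val) := by
  have hij' : p.val < i.val := hpi
  have hj := i.isLt
  have l1 := value_lt w (p := p.val) (by omega)
  have l2 := value_lt w (p := i.val) (by omega)
  rw [edge_bar_iff w hpi]
  refine and_congr (by omega) (and_congr (by omega) ?_)
  constructor
  · intro h l h1 h2 h3
    have := h (2 * n - 1 - l) (by omega) (by omega)
    rw [value_bar w (by omega)] at this
    omega
  · intro h l h1 h2 h3
    have := h (2 * n - 1 - l) (by omega) (by omega)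
    rw [value_bar w (by omega)] at this
    have := value_lt w (p := l) (by omega)
    omega


/-! ### Counting walks along a list of labels -/

open Classical in
/-- The number of walks in the quantum Bruhat graph that start at `w`, use the labels of a sublist
of `Γ` in their order, and end in `T`. -/
noncomputable def cnt {n : ℕ} : List (Letter n × Letter n) → SignedPerm n →
    (SignedPerm n → Prop) → ℕ
  | [], w, T => if T w then 1 else 0
  | r :: Γ, w, T =>
    cnt Γ w T + if QuantumBruhatEdge w r then cnt Γ (w * reflection r) T else 0

/-- There is a walk from `w` to `x` along a sublist of `Γ`. -/
def Walk {n : ℕ} : List (Letter n × Letter n) → SignedPerm n → SignedPerm n → Prop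
  | [], w, x => x = w
  | r :: Γ, w, x => Walk Γ w x ∨ QuantumBruhatEdge w r ∧ Walk Γ (w * reflection r) x

theorem cnt_congr {n : ℕ} {Γ : List (Letter n × Letter n)} {w : SignedPerm n}
    {T T' : SignedPerm n → Prop} (h : ∀ x, Walk Γ w x → (T x ↔ T' x)) :
    cnt Γ w T = cnt Γ w T' := by
  induction Γ generalizing w with
  | nil =>
    by_cases hT : T w
    · rw [cnt, cnt, if_pos hT, if_pos ((h w rfl).1 hT)]
    · rw [cnt, cnt, if_neg hT, if_neg fun h' => hT ((h w rfl).2 h')]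
  | cons r Γ ih =>
    rw [cnt, cnt, ih fun x hx => h x (Or.inl hx)]
    split_ifs with he
    · rw [ih fun x hx => h x (Or.inr ⟨he, hx⟩)]
    · rfl

theorem cnt_eq_zero {n : ℕ} {Γ : List (Letter n × Letter n)} {w : SignedPerm n}
    {T : SignedPerm n → Prop} (h : ∀ x, Walk Γ w x → ¬ T x) : cnt Γ w T = 0 := by
  induction Γ generalizing w with
  | nil => simp only [cnt, h w rfl, if_false]
  | cons r Γ ih =>
    rw [cnt, ih fun x hx => h x (Or.inl hx)]
    split_ifs with he
    · rw [ih fun x hx => h x (Or.inr ⟨he, hx⟩)]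
    · rfl

theorem cnt_pos {n : ℕ} {Γ : List (Letter n × Letter n)} {w x : SignedPerm n}
    {T : SignedPerm n → Prop} (h : Walk Γ w x) (hT : T x) : 0 < cnt Γ w T := by
  induction Γ generalizing w with
  | nil => cases h; simp only [cnt, hT, if_true]; norm_num
  | cons r Γ ih =>
    rw [cnt]
    rcases h with h | ⟨he, h⟩
    · exact Nat.add_pos_left (ih h) _
    · rw [if_pos he]; exact Nat.add_pos_right _ (ih h)

open Classical in
-- A count for the second list that is 0 or 1 becomes a target condition for the first list. This is
-- how the factors of a chain are peeled off.
theorem cnt_append {n : ℕ} {Γ₁ Γ₂ : List (Letter n × Letter n)} {w : SignedPerm n}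
    {T C : SignedPerm n → Prop}
    (h : ∀ x, Walk Γ₁ w x → cnt Γ₂ x T = if C x then 1 else 0) :
    cnt (Γ₁ ++ Γ₂) w T = cnt Γ₁ w C := by
  induction Γ₁ generalizing w with
  | nil => exact h w rfl
  | cons r Γ ih =>
    rw [List.cons_append, cnt, cnt, ih fun x hx => h x (Or.inl hx)]
    split_ifs with he
    · rw [ih fun x hx => h x (Or.inr ⟨he, hx⟩)]
    · rfl

theorem Walk.invariant {n : ℕ} {Γ : List (Letter n × Letter n)} {w x : SignedPerm n}
    {P : SignedPerm n → Prop} (hP : ∀ u, ∀ r ∈ Γ, P u → P (u * reflection r)) (h : Walk Γ w x)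
    (hw : P w) : P x := by
  induction Γ generalizing w with
  | nil => cases h; exact hw
  | cons r Γ ih =>
    rcases h with h | ⟨he, h⟩
    · exact ih (fun u r hr => hP u r (List.mem_cons_of_mem _ hr)) h hw
    · exact ih (fun u r hr => hP u r (List.mem_cons_of_mem _ hr)) h
        (hP _ _ List.mem_cons_self hw)

open Classical in
-- Each value of `f` is attained by at most one walk, so the count is the number of values that
-- satisfy both conditions, and `hu` makes this number at most one.
theorem cnt_of_values {n : ℕ} {ι : Type*} {Γ : List (Letter n × Letter n)} {w : SignedPerm n}
    {T : SignedPerm n → Prop} (f : SignedPerm n → ι) (R T₀ : ι → Prop)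
    (h : ∀ c, cnt Γ w (fun x => f x = c) = if R c then 1 else 0)
    (hT : ∀ x, Walk Γ w x → R (f x) → (T x ↔ T₀ (f x)))
    (hu : ∀ c c', R c → T₀ c → R c' → T₀ c' → c = c') :
    cnt Γ w T = if ∃ c, R c ∧ T₀ c then 1 else 0 := by
  -- An endpoint makes the count of its own value positive, so the indicator of that value is 1.
  have hR : ∀ x, Walk Γ w x → R (f x) := by
    intro x hx
    by_contra hc
    have h1 := cnt_pos (T := fun y => f y = f x) hx rfl
    rw [h, if_neg hc] at h1
    exact lt_irrefl _ h1
  split_ifs with he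
  · obtain ⟨c, hc, hc'⟩ := he
    rw [cnt_congr (T' := fun x => f x = c), h, if_pos hc]
    intro x hx
    rw [hT x hx (hR x hx)]
    exact ⟨fun h => hu _ _ (hR x hx) h hc hc', fun h => h ▸ hc'⟩
  · refine cnt_eq_zero fun x hx hx' => he ⟨f x, hR x hx, (hT x hx (hR x hx)).1 hx'⟩

/-! ### Moves of one letter along the labels outside the column -/

/-- The letters that can be reached from `b`, where `O` are the free letters and `F` the blocking
ones. -/
def OuterReach (F O : ℕ → Prop) (n b c : ℕ) : Prop :=
  (c = b ∨ c = 2 * n - 1 - b ∨ O c) ∧ ∀ f, F f → ¬ Cyc b f c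

/-- The letters that can be reached from `b` without leaving from `b` to `x` first, but possibly
ending with a step to the bar of `x`. -/
def InnerReach (F O : ℕ → Prop) (n b x c : ℕ) : Prop :=
  (c ≠ 2 * n - 1 - x ∧ OuterReach (fun f => F f ∨ f = x) O n b c) ∨
  (c = 2 * n - 1 - x ∧ ∃ d, OuterReach (fun f => F f ∨ f = x) O n b d ∧ d < c ∧
    (n ≤ d ∨ c < n) ∧ (∀ f, F f → ¬ (d < f ∧ f < c)) ∧
    ∀ y, (y = b ∨ y = 2 * n - 1 - b ∨ O y) → ¬ (d < y ∧ y < c))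

theorem exists_greatest_lt {P : ℕ → Prop} {c : ℕ} (h : ∃ y < c, P y) :
    ∃ y < c, P y ∧ ∀ z, y < z → z < c → ¬ P z := by
  classical
  obtain ⟨y, hy, hP⟩ := h
  refine ⟨Nat.findGreatest P (c - 1), ?_, Nat.findGreatest_spec (by omega) hP, ?_⟩
  · have := Nat.findGreatest_le (P := P) (c - 1); omega
  · intro z h1 h2; exact Nat.findGreatest_is_greatest h1 (by omega)

section
variable {n b x c : ℕ} {F O : ℕ → Prop}

/-- For a common target, one of `b` and `x` would lie cyclically between the other and the target
and so block the way. A final step to a bar gives no escape, since it may not skip the letter from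
which the route started. -/
theorem InnerReach.disjoint (hb : b < 2 * n) (hx : x < 2 * n) (hbx : b ≠ x)
    (hbx' : b ≠ 2 * n - 1 - x) (hO : ∀ y, O y → y < 2 * n ∧ O (2 * n - 1 - y) ∧ y ≠ b ∧ y ≠ x ∧
      y ≠ 2 * n - 1 - b ∧ y ≠ 2 * n - 1 - x) :
    InnerReach F O n b x c → InnerReach F O n x b c → False := by
  rintro (⟨h1, h2, h3⟩ | ⟨h1, d, ⟨h2, h3⟩, h4, h5, h6, h7⟩)
      (⟨k1, k2, k3⟩ | ⟨k1, e, ⟨k2, k3⟩, k4, k5, k6, k7⟩)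
  · have h3 := h3 x (Or.inr rfl)
    have k3 := k3 b (Or.inr rfl)
    unfold Cyc at h3 k3
    rcases h2 with rfl | rfl | h2
    · rcases k2 with k2 | k2 | k2
      · omega
      · omega
      · exact (hO _ k2).2.2.1 rfl
    · rcases k2 with k2 | k2 | k2
      · omega
      · omega
      · exact (hO _ k2).2.2.2.2.1 rfl
    · have := hO _ h2
      omega
  · subst k1
    have h3 := h3 x (Or.inr rfl)
    have k3 := k3 b (Or.inr rfl)
    unfold Cyc at h3 k3
    rcases k2 with rfl | rfl | k2
    · omega
    · omega
    · have := hO _ k2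
      omega
  · subst h1
    have h3 := h3 x (Or.inr rfl)
    have k3 := k3 b (Or.inr rfl)
    unfold Cyc at h3 k3
    rcases h2 with rfl | rfl | h2
    · omega
    · have := h7 b (Or.inl rfl); omega
    · have := hO _ h2
      have := h7 b (Or.inl rfl)
      omega
  · omega

/-- The first label decides whether `b` is exchanged with `x`. The exchange takes place exactly when
the target is `x` or has `x` cyclically between `b` and itself; afterwards the letter left at
position `k` blocks, and its bar can be reached only by the last label. -/
theorem outerReach_iff (hb : b < 2 * n) (hx : x < 2 * n) (hbx : b ≠ x)
    (hbx' : b ≠ 2 * n - 1 - x) (hO : ∀ y, O y → y < 2 * n ∧ O (2 * n - 1 - y) ∧ y ≠ b ∧ y ≠ x ∧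
      y ≠ 2 * n - 1 - b ∧ y ≠ 2 * n - 1 - x)
    (hF : ∀ f, F f → f < 2 * n ∧ ¬ O f ∧ f ≠ b ∧ f ≠ x ∧ f ≠ 2 * n - 1 - b ∧ f ≠ 2 * n - 1 - x) :
    OuterReach F (fun y => O y ∨ y = x ∨ y = 2 * n - 1 - x) n b c ↔
      InnerReach F O n b x c ∨ (∀ f, F f → ¬ Cyc b f x) ∧ InnerReach F O n x b c := by
  constructor
  · rintro ⟨h1, h2⟩
    by_cases hcb : c = b
    · subst hcb
      refine Or.inl (Or.inl ⟨hbx', Or.inl rfl, ?_⟩)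
      intro f _; unfold Cyc; omega
    by_cases hcx : c = x
    · subst hcx
      refine Or.inr ⟨h2, Or.inl ⟨by omega, Or.inl rfl, ?_⟩⟩
      intro f _; unfold Cyc; omega
    by_cases hcb' : c = 2 * n - 1 - b
    · by_cases hx' : Cyc b x c
      · refine Or.inr ⟨fun f hf h => h2 f hf ?_, Or.inr ⟨hcb', ?_⟩⟩
        · unfold Cyc at hx' h ⊢; omega
        -- The last stop before `c` is the greatest candidate below `c` in the same half, so that
        -- the final step skips nothing. A candidate exists because `x` or its bar lies there.
        · obtain ⟨d, hd, ⟨hd1, hd2⟩, hd3⟩ := exists_greatest_lt (c := c)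
            (P := fun y => (y = x ∨ y = 2 * n - 1 - x ∨ O y) ∧ (n ≤ y ∨ c < n)) (by
              by_cases h : x < c ∧ (n ≤ x ∨ c < n)
              · exact ⟨x, h.1, Or.inl rfl, h.2⟩
              · refine ⟨2 * n - 1 - x, ?_, Or.inr (Or.inl rfl), ?_⟩ <;> unfold Cyc at hx' <;> omega)
          have hd2' : d < 2 * n := by omega
          have hxd : d = x ∨ Cyc x d c := by
            have := hd3 x
            unfold Cyc at hx' ⊢
            by_contra hcon
            have : ¬ (d < x ∧ x < c) := fun h => this h.1 h.2 ⟨Or.inl rfl, by omega⟩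
            omega
          refine ⟨d, ⟨hd1, ?_⟩, hd, hd2, ?_, ?_⟩
          · rintro f (hf | rfl) h
            · have := h2 f hf
              unfold Cyc at *; omega
            · unfold Cyc at *; omega
          · intro f hf h
            have := h2 f hf
            unfold Cyc at *; omega
          · intro y hy h
            exact hd3 y h.1 h.2 ⟨hy, by omega⟩
      · refine Or.inl (Or.inl ⟨by omega, Or.inr (Or.inl hcb'), ?_⟩)
        rintro f (hf | rfl)
        · exact h2 f hf
        · exact hx'
    by_cases hcx' : c = 2 * n - 1 - x
    · by_cases hx' : Cyc b x c
      · refine Or.inr ⟨fun f hf h => h2 f hf ?_, Or.inl ⟨hcb', Or.inr (Or.inl hcx'), ?_⟩⟩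
        · unfold Cyc at hx' h ⊢; omega
        · rintro f (hf | rfl) h
          · have := h2 f hf
            unfold Cyc at *; omega
          · unfold Cyc at *; omega
      · refine Or.inl (Or.inr ⟨hcx', ?_⟩)
        obtain ⟨d, hd, ⟨hd1, hd2⟩, hd3⟩ := exists_greatest_lt (c := c)
            (P := fun y => (y = b ∨ y = 2 * n - 1 - b ∨ O y) ∧ (n ≤ y ∨ c < n)) (by
              by_cases h : b < c ∧ (n ≤ b ∨ c < n)
              · exact ⟨b, h.1, Or.inl rfl, h.2⟩
              · refine ⟨2 * n - 1 - b, ?_, Or.inr (Or.inl rfl), ?_⟩ <;> unfold Cyc at hx' <;> omega)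
        have hbd : d = b ∨ Cyc b d c := by
          have := hd3 b
          by_contra hcon
          have : ¬ (d < b ∧ b < c) := fun h => this h.1 h.2 ⟨Or.inl rfl, by omega⟩
          unfold Cyc at *
          omega
        refine ⟨d, ⟨hd1, ?_⟩, hd, hd2, ?_, ?_⟩
        · rintro f (hf | rfl) h
          · have := h2 f hf
            unfold Cyc at *; omega
          · unfold Cyc at *; omega
        · intro f hf h
          have := h2 f hf
          unfold Cyc at *; omega
        · intro y hy h
          exact hd3 y h.1 h.2 ⟨hy, by omega⟩
    have hc : O c := by
      rcases h1 with h1 | h1 | h1 | h1 | h1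
      · exact absurd h1 hcb
      · exact absurd h1 hcb'
      · exact h1
      · exact absurd h1 hcx
      · exact absurd h1 hcx'
    by_cases hx' : Cyc b x c
    · refine Or.inr ⟨fun f hf h => h2 f hf ?_, Or.inl ⟨hcb', Or.inr (Or.inr hc), ?_⟩⟩
      · unfold Cyc at hx' h ⊢; omega
      · rintro f (hf | rfl) h
        · have := h2 f hf
          unfold Cyc at *; omega
        · unfold Cyc at *; omega
    · refine Or.inl (Or.inl ⟨hcx', Or.inr (Or.inr hc), ?_⟩)
      rintro f (hf | rfl)
      · exact h2 f hf
      · exact hx'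
  · rintro ((⟨h1, h2, h3⟩ | ⟨h1, d, ⟨h2, h3⟩, h4, h5, h6, h7⟩) | ⟨h0,
      ⟨h1, h2, h3⟩ | ⟨h1, d, ⟨h2, h3⟩, h4, h5, h6, h7⟩⟩)
    · exact ⟨by tauto, fun f hf => h3 f (Or.inl hf)⟩
    · refine ⟨by tauto, fun f hf h => ?_⟩
      have h3 := h3 f (Or.inl hf)
      have h6 := h6 f hf
      have h7 := h7 b (Or.inl rfl)
      have hfd : f ≠ d := by
        rintro rfl
        have := hF f hf
        tauto
      unfold Cyc at *; omega
    · refine ⟨by tauto, fun f hf h => ?_⟩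
      have h0 := h0 f hf
      have h8 := h3 f (Or.inl hf)
      have h3 := h3 b (Or.inr rfl)
      have := hF f hf
      have : c ≠ b := by
        rintro rfl
        rcases h2 with h2 | h2 | h2
        · omega
        · omega
        · exact (hO _ h2).2.2.1 rfl
      unfold Cyc at *; omega
    · refine ⟨by tauto, fun f hf h => ?_⟩
      have h0 := h0 f hf
      have h8 := h3 f (Or.inl hf)
      have h3 := h3 b (Or.inr rfl)
      have h6 := h6 f hf
      have := hF f hf
      have hdb : d ≠ b := by
        rintro rfl
        rcases h2 with h2 | h2 | h2
        · omega
        · omega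
        · exact (hO _ h2).2.2.1 rfl
      have hfd : f ≠ d := by
        rintro rfl
        tauto
      unfold Cyc at *; omega
end


/-- The indices that are at least `k`, in increasing order. -/
def outer (n k : ℕ) : List (Fin n) := (List.finRange n).filter (fun j => k ≤ j.val)

theorem outer_succ {n : ℕ} (k : Fin n) : outer n k.val = k :: outer n (k.val + 1) := by
  unfold outer
  induction n with
  | zero => exact k.elim0
  | succ n ih =>
    rw [List.finRange_succ, List.filter_cons, List.filter_cons]
    rcases Fin.eq_zero_or_eq_succ k with rfl | ⟨k, rfl⟩
    · simp [List.filter_map, Function.comp_def]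
    · have := ih k
      simp only [List.filter_map]
      have e : ∀ c, ((fun j : Fin (n + 1) => decide (c + 1 ≤ j.val)) ∘ Fin.succ) =
          (fun j : Fin n => decide (c ≤ j.val)) := by
        intro c; funext j; simp
      rw [Fin.val_succ, e, e, this]
      simp

theorem outer_eq_nil {n k : ℕ} (h : n ≤ k) : outer n k = [] := by
  rw [outer, List.filter_eq_nil_iff]
  intro j _
  have := j.isLt
  simp only [decide_eq_true_eq]; omega

/-- The labels `(i, k+1), …, (i, n), (i, ī), (i, n̄), …, (i, (k+1)‾)`. -/
def outerRoots {n : ℕ} (i : Fin n) (k : ℕ) : List (Letter n × Letter n) :=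
  (outer n k).map (fun j => (unb i, unb j)) ++ [(unb i, bar (unb i))] ++
    (outer n k).reverse.map (fun j => (unb i, bar (unb j)))

theorem outerRoots_succ {n : ℕ} (i k : Fin n) : outerRoots i k.val =
    (unb i, unb k) :: (outerRoots i (k.val + 1) ++ [(unb i, bar (unb k))]) := by
  simp [outerRoots, outer_succ k]

theorem outerRoots_of_ge {n k : ℕ} (i : Fin n) (h : n ≤ k) :
    outerRoots i k = [(unb i, bar (unb i))] := by
  simp [outerRoots, outer_eq_nil h]

theorem Walk.value_eq {n : ℕ} {Γ : List (Letter n × Letter n)} {w x : SignedPerm n} {l : ℕ}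
    (hl : ∀ r ∈ Γ, l ≠ r.1.val ∧ l ≠ r.2.val ∧ l ≠ 2 * n - 1 - r.1.val ∧ l ≠ 2 * n - 1 - r.2.val)
    (h : Walk Γ w x) : value x l = value w l := by
  refine h.invariant (P := fun u => value u l = value w l) (fun u r hr hu => ?_) rfl
  obtain ⟨h1, h2, h3, h4⟩ := hl r hr
  rw [← hu]
  exact value_mul_of_ne u h1 h2 h3 h4

theorem value_eq_of_walk_outerRoots {n k : ℕ} {i : Fin n} {w x : SignedPerm n}
    (h : Walk (outerRoots i k) w x) {l : ℕ} (hl : l < 2 * n) (h1 : l ≠ i.val)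
    (h2 : l ≠ 2 * n - 1 - i.val) (h3 : l < k ∨ 2 * n - 1 - k < l) : value x l = value w l := by
  refine h.value_eq fun r hr => ?_
  have hi := i.isLt
  simp only [outerRoots, outer, List.mem_append, List.mem_map, List.mem_singleton, List.mem_reverse,
    List.mem_filter, List.mem_finRange, true_and, decide_eq_true_eq] at hr
  obtain (⟨j, hj, rfl⟩ | rfl) | ⟨j, hj, rfl⟩ := hr
  · have := j.isLt
    simp only [val_unb]; omega
  · simp only [val_unb, val_bar]; omega
  · have := j.isLt
    simp only [val_unb, val_bar]; omega

/-- The values at the positions strictly between `i` and `k`. -/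
def innerValues {n : ℕ} (w : SignedPerm n) (i k : ℕ) (y : ℕ) : Prop :=
  ∃ f, i < f ∧ f < k ∧ y = value w f

/-- The values at the positions from `k` to its mirror image. -/
def outerValues {n : ℕ} (w : SignedPerm n) (k : ℕ) (y : ℕ) : Prop :=
  ∃ l, k ≤ l ∧ l < 2 * n - k ∧ y = value w l

theorem innerValues_succ {n : ℕ} (w : SignedPerm n) {i k : ℕ} (h : i < k) :
    innerValues w i (k + 1) = fun y => innerValues w i k y ∨ y = value w k := by
  funext y
  refine propext ⟨?_, ?_⟩
  · rintro ⟨f, h1, h2, rfl⟩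
    rcases Nat.lt_succ_iff_lt_or_eq.1 h2 with h3 | rfl
    · exact Or.inl ⟨f, h1, h3, rfl⟩
    · exact Or.inr rfl
  · rintro (⟨f, h1, h2, rfl⟩ | rfl)
    · exact ⟨f, h1, by omega, rfl⟩
    · exact ⟨k, h, by omega, rfl⟩

theorem outerValues_eq {n : ℕ} (w : SignedPerm n) {k : ℕ} (h : k < n) :
    outerValues w k = fun y => outerValues w (k + 1) y ∨ y = value w k ∨
      y = 2 * n - 1 - value w k := by
  funext y
  refine propext ⟨?_, ?_⟩
  · rintro ⟨l, h1, h2, rfl⟩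
    by_cases h3 : l = k
    · subst h3; exact Or.inr (Or.inl rfl)
    by_cases h4 : l = 2 * n - 1 - k
    · subst h4; exact Or.inr (Or.inr (value_bar w (by omega)))
    · exact Or.inl ⟨l, by omega, by omega, rfl⟩
  · rintro (⟨l, h1, h2, rfl⟩ | rfl | rfl)
    · exact ⟨l, by omega, by omega, rfl⟩
    · exact ⟨k, le_rfl, by omega, rfl⟩
    · exact ⟨2 * n - 1 - k, by omega, by omega, (value_bar w (by omega)).symm⟩

theorem value_ne {n : ℕ} (w : SignedPerm n) {p q : ℕ} (hp : p < 2 * n) (hq : q < 2 * n)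
    (h : p ≠ q) : value w p ≠ value w q := fun h' => h (value_inj w hp hq h')

theorem value_ne_bar {n : ℕ} (w : SignedPerm n) {p q : ℕ} (hp : p < 2 * n) (hq : q < 2 * n)
    (h : p ≠ 2 * n - 1 - q) : value w p ≠ 2 * n - 1 - value w q := by
  rw [← value_bar w hq]; exact value_ne w hp (by omega) h

open Classical in
-- The labels before the last one do not touch position `k`, so its letter `x` blocks like a frozen
-- one. The last label then allows one step to the bar of `x`.
theorem cnt_outerRoots_append {n : ℕ} (i k : Fin n) (hik : i < k) (w : SignedPerm n) (c : ℕ)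
    (ih : ∀ c, cnt (outerRoots i (k.val + 1)) w (fun x => value x i.val = c) =
      if OuterReach (innerValues w i.val (k.val + 1)) (outerValues w (k.val + 1)) n
        (value w i.val) c then 1 else 0) :
    cnt (outerRoots i (k.val + 1) ++ [(unb i, bar (unb k))]) w (fun x => value x i.val = c) =
      if InnerReach (innerValues w i.val k.val) (outerValues w (k.val + 1)) n (value w i.val)
        (value w k.val) c then 1 else 0 := by
  have hik' : i.val < k.val := hik
  have hk := k.isLt
  set F := innerValues w i.val k.val with hF
  set O := outerValues w (k.val + 1) with hO
  set b := value w i.val with hb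
  set x := value w k.val with hx
  have hxl : x < 2 * n := value_lt w (by omega)
  have hbl : b < 2 * n := value_lt w (by omega)
  rw [innerValues_succ w hik'] at ih
  have hne : unb i ≠ bar (unb k) := by simp only [ne_eq, Fin.ext_iff, val_unb, val_bar]; omega
  rw [cnt_append (C := fun y => value y i.val = c ∨
    (QuantumBruhatEdge y (unb i, bar (unb k)) ∧ 2 * n - 1 - x = c))]
  · have hk2 : ∀ y, Walk (outerRoots i (k.val + 1)) w y → value y k.val = x := fun y hy =>
      value_eq_of_walk_outerRoots hy (by omega) (by omega) (by omega) (by omega)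
    by_cases hc : c = 2 * n - 1 - x
    · rw [cnt_of_values (fun y => value y i.val) _ (fun d => d < c ∧ (n ≤ d ∨ c < n) ∧
        (∀ f, F f → ¬ (d < f ∧ f < c)) ∧
        ∀ y, (y = b ∨ y = 2 * n - 1 - b ∨ O y) → ¬ (d < y ∧ y < c)) ih]
      · congr 1
        refine propext ⟨fun h => Or.inr ⟨hc, h⟩, ?_⟩
        rintro (⟨h, -⟩ | ⟨-, h⟩)
        · exact absurd hc h
        · exact h
      · intro y hy hR
        have hyk := hk2 y hy
        have hyi : value y i.val ≠ c := by
          rw [hc, ← hyk]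
          exact value_ne_bar y (by omega) (by omega) (by omega)
        have hE : (value y i.val = c ∨ QuantumBruhatEdge y (unb i, bar (unb k)) ∧
            2 * n - 1 - x = c) ↔ QuantumBruhatEdge y (unb i, bar (unb k)) :=
          ⟨fun h => h.elim (fun h => absurd h hyi) And.left, fun h => Or.inr ⟨h, hc.symm⟩⟩
        refine hE.trans ?_
        rw [edge_bar_iff y hik, hyk, ← hc]
        refine and_congr_right fun h1 => and_congr_right fun h2 => ?_
        have hfix : ∀ l, l < 2 * n → l ≠ i.val → l ≠ 2 * n - 1 - i.val →
          (l < k.val + 1 ∨ 2 * n - 1 - (k.val + 1) < l) → value y l = value w l :=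
          fun l => value_eq_of_walk_outerRoots hy
        constructor
        · intro h3
          refine ⟨?_, ?_⟩
          · rintro f ⟨l, h4, h5, rfl⟩
            rw [← hfix l (by omega) (by omega) (by omega) (by omega)]
            exact h3 l h4 (by omega)
          -- The walk permutes the letters at `i`, at the positions beyond `k` and at their mirror
          -- images among themselves. So the edge condition at `y` can be stated with the letters of
          -- `w`.
          · have hsurj : ∀ l, l < 2 * n → (l = i.val ∨ l = 2 * n - 1 - i.val ∨
                k.val + 1 ≤ l ∧ l < 2 * n - (k.val + 1)) →
                ¬ (value y i.val < value w l ∧ value w l < c) := by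
              intro l hl hl' h4
              obtain ⟨l', hl1, hl2⟩ := value_surj y (value_lt w hl)
              by_cases h5 : l' = i.val
              · subst h5; omega
              by_cases h6 : l' = 2 * n - 1 - i.val
              · subst h6
                rw [value_bar y (by omega)] at hl2
                have := value_lt y (p := i.val) (by omega)
                omega
              by_cases h7 : l' < k.val + 1 ∨ 2 * n - 1 - (k.val + 1) < l'
              · rw [hfix l' hl1 h5 h6 h7] at hl2
                have := value_inj w hl1 hl hl2
                omega
              · exact h3 l' (by omega) (by omega) (by rw [hl2]; exact h4)
            rintro z (rfl | rfl | ⟨l, h4, h5, rfl⟩)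
            · exact hsurj _ (by omega) (Or.inl rfl)
            · have := hsurj (2 * n - 1 - i.val) (by omega) (Or.inr (Or.inl rfl))
              rwa [value_bar w (by omega)] at this
            · exact hsurj l (by omega) (by omega)
        · rintro ⟨h3, h4⟩ l h5 h6 h7
          by_cases h8 : l < k.val
          · refine h3 (value w l) ⟨l, h5, h8, rfl⟩ ?_
            rwa [← hfix l (by omega) (by omega) (by omega) (by omega)]
          by_cases h9 : l = k.val
          · subst h9
            rw [hyk] at h7
            have := value_lt y (p := i.val) (by omega)
            omega
          have h10 : value y l = value y l := rfl
          obtain ⟨l', hl1, hl2⟩ := value_surj w (value_lt y (p := l) (by omega))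
          by_cases h11 : l' = i.val ∨ l' = 2 * n - 1 - i.val ∨
            k.val + 1 ≤ l' ∧ l' < 2 * n - (k.val + 1)
          · refine h4 (value y l) ?_ h7
            rcases h11 with rfl | rfl | h11
            · exact Or.inl hl2.symm
            · rw [value_bar w (by omega)] at hl2; exact Or.inr (Or.inl hl2.symm)
            · exact Or.inr (Or.inr ⟨l', h11.1, h11.2, hl2.symm⟩)
          · have h12 := hfix l' hl1 (by omega) (by omega) (by omega)
            rw [hl2] at h12
            have := value_inj y hl1 (by omega) h12
            omega
      -- Neither of two possible last stops may lie between the other and `c`, so they coincide.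
      · rintro d d' ⟨hR, -⟩ ⟨h1, h2, h3, h4⟩ ⟨hR', -⟩ ⟨h1', h2', h3', h4'⟩
        have := h4 d' hR'
        have := h4' d hR
        omega
    · have : ∀ y, (value y i.val = c ∨ QuantumBruhatEdge y (unb i, bar (unb k)) ∧
          2 * n - 1 - x = c) ↔ value y i.val = c := by
        intro y
        have : ¬ 2 * n - 1 - x = c := fun h => hc h.symm
        tauto
      simp only [this]
      rw [ih]
      congr 1
      refine propext ⟨fun h => Or.inl ⟨hc, h⟩, ?_⟩
      rintro (⟨-, h⟩ | ⟨h, -⟩)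
      · exact h
      · exact absurd h hc
  · intro y hy
    have hyk : value y k.val = x :=
      value_eq_of_walk_outerRoots hy (by omega) (by omega) (by omega) (by omega)
    have h1 : value (y * reflection (unb i, bar (unb k))) i.val = 2 * n - 1 - x := by
      have := value_mul_left y hne
      rw [val_unb, val_bar, val_unb, value_bar y (by omega), hyk] at this
      exact this
    have h2 : value y i.val ≠ 2 * n - 1 - x := by
      rw [← hyk]
      exact value_ne_bar y (by omega) (by omega) (by omega)
    simp only [cnt, h1]
    by_cases h3 : value y i.val = c
    · have : ¬ 2 * n - 1 - x = c := fun h => h2 (h3.trans h.symm)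
      simp [h3, this]
    · by_cases h4 : QuantumBruhatEdge y (unb i, bar (unb k)) <;> simp [h3, h4]

open Classical in
-- By induction on the number `d` of outer positions. For `d = 0` only the label `(i, ī)` is left;
-- otherwise using or skipping the first label gives the two disjoint alternatives of
-- `outerReach_iff`.
theorem cnt_outerRoots {n : ℕ} (i : Fin n) (d : ℕ) : ∀ (k : ℕ), i.val < k → k + d = n →
    ∀ (w : SignedPerm n) (c : ℕ),
    cnt (outerRoots i k) w (fun x => value x i.val = c) =
      if OuterReach (innerValues w i.val k) (outerValues w k) n (value w i.val) c
        then 1 else 0 := by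
  have hi := i.isLt
  induction d with
  | zero =>
    intro k hik hk w c
    obtain rfl : k = n := by omega
    have hne : unb i ≠ bar (unb i) := (bar_ne _).symm
    have h1 : value (w * reflection (unb i, bar (unb i))) i.val = 2 * k - 1 - value w i.val := by
      have := value_mul_left w hne
      rw [val_unb, val_bar, val_unb, value_bar w (by omega)] at this
      exact this
    have hb := value_lt w (p := i.val) (by omega)
    rw [outerRoots_of_ge i le_rfl]
    simp only [cnt, h1]
    have hE : QuantumBruhatEdge w (unb i, bar (unb i)) ↔
        ∀ f, innerValues w i.val k f → ¬ Cyc (value w i.val) f (2 * k - 1 - value w i.val) := by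
      rw [edge_self_iff, value_bar w (by omega)]
      constructor
      · rintro h f ⟨l, h1, h2, rfl⟩; exact h l h1 h2
      · intro h l h1 h2; exact h _ ⟨l, h1, h2, rfl⟩
    have hO : ∀ y, ¬ outerValues w k y := by
      rintro y ⟨l, h1, h2, -⟩; omega
    by_cases hc : value w i.val = c
    · have : OuterReach (innerValues w i.val k) (outerValues w k) k (value w i.val) c := by
        refine ⟨Or.inl hc.symm, fun f _ => ?_⟩
        unfold Cyc; omega
      have h2 : ¬ 2 * k - 1 - c = c := by omega
      rw [if_pos this]
      simp [hc, h2]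
    · by_cases hc' : c = 2 * k - 1 - value w i.val
      · have : OuterReach (innerValues w i.val k) (outerValues w k) k (value w i.val) c ↔
            QuantumBruhatEdge w (unb i, bar (unb i)) := by
          rw [hE, ← hc']
          exact ⟨fun h => h.2, fun h => ⟨Or.inr (Or.inl hc'), h⟩⟩
        simp [this, hc, hc'.symm]
      · have : ¬ OuterReach (innerValues w i.val k) (outerValues w k) k (value w i.val) c := by
          rintro ⟨h | h | h, -⟩
          · exact hc h.symm
          · exact hc' h
          · exact hO _ h
        have h2 : ¬ 2 * k - 1 - value w i.val = c := fun h => hc' h.symm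
        simp [this, hc, h2]
  | succ d ih =>
    intro k hik hk w c
    have hkn : k < n := by omega
    set j : Fin n := ⟨k, hkn⟩ with hj
    have hij : i < j := hik
    have hne : unb i ≠ unb j := by simp only [ne_eq, Fin.ext_iff, val_unb, hj]; omega
    set w' := w * reflection (unb i, unb j) with hw'
    have h1 : value w' i.val = value w k := value_mul_left w hne
    have h2 : value w' k = value w i.val := value_mul_right w hne
    have h3 : ∀ l, l ≠ i.val → l ≠ k → l ≠ 2 * n - 1 - i.val → l ≠ 2 * n - 1 - k →
        value w' l = value w l := fun l h1 h2 h3 h4 => value_mul_of_ne w h1 h2 h3 h4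
    have hO : outerValues w' (k + 1) = outerValues w (k + 1) := by
      funext y
      refine propext (exists_congr fun l => and_congr_right fun h4 => and_congr_right fun h5 => ?_)
      rw [h3 l (by omega) (by omega) (by omega) (by omega)]
    have hF : innerValues w' i.val k = innerValues w i.val k := by
      funext y
      refine propext (exists_congr fun l => and_congr_right fun h4 => and_congr_right fun h5 => ?_)
      rw [h3 l (by omega) (by omega) (by omega) (by omega)]
    have e1 := cnt_outerRoots_append i j hij w c (ih (k + 1) (by omega) (by omega) w)
    have e2 := cnt_outerRoots_append i j hij w' c (ih (k + 1) (by omega) (by omega) w')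
    simp only [hj] at e1 e2
    rw [hO, hF, h1, h2] at e2
    have e3 := outerRoots_succ i j
    simp only [hj] at e3
    rw [e3, cnt, e1]
    have hE : QuantumBruhatEdge w (unb i, unb j) ↔ ∀ f, innerValues w i.val k f →
        ¬ Cyc (value w i.val) f (value w k) := by
      rw [edge_unb_iff w hij]
      constructor
      · rintro h f ⟨l, h1, h2, rfl⟩; exact h l h1 h2
      · intro h l h1 h2; exact h _ ⟨l, h1, h2, rfl⟩
    have hb : value w i.val < 2 * n := value_lt w (by omega)
    have hx : value w k < 2 * n := value_lt w (by omega)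
    have hbx : value w i.val ≠ value w k := value_ne w (by omega) (by omega) (by omega)
    have hbx' : value w i.val ≠ 2 * n - 1 - value w k :=
      value_ne_bar w (by omega) (by omega) (by omega)
    have hO' : ∀ y, outerValues w (k + 1) y → y < 2 * n ∧ outerValues w (k + 1) (2 * n - 1 - y) ∧
        y ≠ value w i.val ∧ y ≠ value w k ∧ y ≠ 2 * n - 1 - value w i.val ∧
        y ≠ 2 * n - 1 - value w k := by
      rintro y ⟨l, h4, h5, rfl⟩
      refine ⟨value_lt w (by omega), ⟨2 * n - 1 - l, by omega, by omega,
        (value_bar w (by omega)).symm⟩, value_ne w ?_ ?_ ?_, value_ne w ?_ ?_ ?_,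
        value_ne_bar w ?_ ?_ ?_, value_ne_bar w ?_ ?_ ?_⟩ <;> omega
    have hF' : ∀ f, innerValues w i.val k f → f < 2 * n ∧ ¬ outerValues w (k + 1) f ∧
        f ≠ value w i.val ∧ f ≠ value w k ∧ f ≠ 2 * n - 1 - value w i.val ∧
        f ≠ 2 * n - 1 - value w k := by
      rintro y ⟨l, h4, h5, rfl⟩
      refine ⟨value_lt w (by omega), ?_, value_ne w ?_ ?_ ?_, value_ne w ?_ ?_ ?_,
        value_ne_bar w ?_ ?_ ?_, value_ne_bar w ?_ ?_ ?_⟩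
      · rintro ⟨l', h6, h7, h8⟩
        have := value_inj w (by omega) (by omega) h8
        omega
      all_goals omega
    rw [outerValues_eq w hkn]
    have hiff := outerReach_iff (c := c) hb hx hbx hbx' hO' hF'
    have hdis := InnerReach.disjoint (c := c) (F := innerValues w i.val k) hb hx hbx hbx' hO'
    rw [← hE] at hiff
    simp only [hiff]
    by_cases hE' : QuantumBruhatEdge w (unb i, unb j)
    · rw [if_pos hE']
      change _ + cnt _ w' _ = _
      rw [e2]
      by_cases h4 : InnerReach (innerValues w i.val k) (outerValues w (k + 1)) n (value w i.val)
        (value w k) c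
      · rw [if_pos h4, if_neg (hdis h4), if_pos (Or.inl h4)]
      · simp [h4, hE']
    · rw [if_neg hE']
      simp [hE']


/-! ### Moves of one letter along the labels inside the column -/

theorem filter_lt_finRange_succ {n : ℕ} (p : Fin n) :
    (List.finRange n).filter (fun q => q.val < p.val + 1) =
      (List.finRange n).filter (fun q => q.val < p.val) ++ [p] := by
  have := filter_lt_succ_finRange (fun _ => True) p
  simpa using this

/-- The labels `(p, ī), …, (1, ī)`. -/
def innerRoots {n : ℕ} (i : Fin n) (p : ℕ) : List (Letter n × Letter n) :=
  (((List.finRange n).filter (fun q => q.val < p)).map (fun q => (unb q, bar (unb i)))).reverse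

theorem innerRoots_zero {n : ℕ} (i : Fin n) : innerRoots i 0 = [] := by
  simp [innerRoots]

theorem innerRoots_succ {n : ℕ} (i p : Fin n) :
    innerRoots i (p.val + 1) = (unb p, bar (unb i)) :: innerRoots i p.val := by
  rw [innerRoots, filter_lt_finRange_succ p]
  simp [innerRoots]

/-- The letters that can be reached at position `i` by the labels `(p, ī), …, (1, ī)`. -/
def InnerStep {n : ℕ} (w : SignedPerm n) (i p c : ℕ) : Prop :=
  c = value w i ∨ ((∃ q < p, c = 2 * n - 1 - value w q) ∧ value w i < c ∧ (n ≤ value w i ∨ c < n) ∧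
    ∀ l, i < l → l < 2 * n - p → ¬ (value w i < value w l ∧ value w l < c))

open Classical in
-- The letter at `i` only moves upwards within one half. Position `p̄`, which carries the bar of the
-- letter at `p`, lies inside the interval of every later label; hence that bar cannot be skipped
-- later, and for a given target the use of `(p, ī)` is forced.
theorem cnt_innerRoots {n : ℕ} (i : Fin n) (p : ℕ) (hp : p ≤ i.val) : ∀ (w : SignedPerm n) (c : ℕ),
    cnt (innerRoots i p) w (fun x => value x i.val = c) =
      if InnerStep w i.val p c then 1 else 0 := by
  have hi := i.isLt
  induction p with
  | zero =>
    intro w c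
    rw [innerRoots_zero, cnt]
    congr 1
    refine propext ⟨fun h => Or.inl h.symm, ?_⟩
    rintro (h | ⟨⟨q, hq, -⟩, -⟩)
    · exact h.symm
    · omega
  | succ p ih =>
    intro w c
    set j : Fin n := ⟨p, by omega⟩ with hj
    have hji : j < i := hp
    have hne : unb j ≠ bar (unb i) := by simp only [ne_eq, Fin.ext_iff, val_unb, val_bar]; omega
    set w' := w * reflection (unb j, bar (unb i)) with hw'
    have h1 : value w' p = 2 * n - 1 - value w i.val := by
      have := value_mul_left w hne
      rw [val_unb, val_bar, val_unb, value_bar w (by omega)] at this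
      exact this
    have h2 : value w' (2 * n - 1 - p) = value w i.val := by
      rw [value_bar w' (by omega), h1]
      have := value_lt w (p := i.val) (by omega)
      omega
    have h3 : value w' (2 * n - 1 - i.val) = value w p := by
      have := value_mul_right w hne
      rw [val_unb, val_bar, val_unb] at this
      exact this
    have h4 : value w' i.val = 2 * n - 1 - value w p := by
      rw [← h3, value_bar w' (by omega)]
      have := value_lt w' (p := i.val) (by omega)
      omega
    have h5 : ∀ l, l < 2 * n → l ≠ i.val → l ≠ p → l ≠ 2 * n - 1 - i.val → l ≠ 2 * n - 1 - p →
        value w' l = value w l := by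
      intro l h0 h1 h2 h3 h4
      refine value_mul_of_ne w ?_ ?_ ?_ ?_ <;> simp only [val_unb, val_bar, hj] <;> omega
    have hE := edge_bar_iff' w hji
    have hb : value w i.val < 2 * n := value_lt w (by omega)
    have ha : value w p < 2 * n := value_lt w (by omega)
    have hbp : value w i.val ≠ 2 * n - 1 - value w p :=
      value_ne_bar w (by omega) (by omega) (by omega)
    have hvb := value_bar w (p := i.val) (by omega)
    have hvp := value_bar w (p := p) (by omega)
    have hiff : InnerStep w i.val (p + 1) c ↔ InnerStep w i.val p c ∨
        QuantumBruhatEdge w (unb j, bar (unb i)) ∧ InnerStep w' i.val p c := by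
      rw [hE]
      constructor
      · rintro (h | ⟨⟨q, hq, rfl⟩, h7, h8, h9⟩)
        · exact Or.inl (Or.inl h)
        by_cases hqp : q = p
        · subst hqp
          refine Or.inr ⟨⟨h7, h8, ?_⟩, Or.inl h4.symm⟩
          intro l hl1 hl2
          simp only [hj] at hl2
          exact h9 l hl1 (by omega)
        have hqc : 2 * n - 1 - value w q ≠ 2 * n - 1 - value w p := by
          have := value_ne w (by omega) (by omega) hqp
          have := value_lt w (p := q) (by omega)
          omega
        -- For a target other than the bar of the letter at `p`, the label is used exactly if this
        -- bar lies between the current letter and the target.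
        by_cases hc : value w i.val < 2 * n - 1 - value w p ∧
          2 * n - 1 - value w p < 2 * n - 1 - value w q
        · refine Or.inr ⟨⟨hc.1, by simp only [hj]; omega, ?_⟩, Or.inr ⟨⟨q, by omega, ?_⟩, ?_, ?_, ?_⟩⟩
          · intro l hl1 hl2 hl3
            simp only [hj] at hl2 hl3
            refine h9 l hl1 (by omega) ?_
            omega
          · rw [h5 q] <;> omega
          · omega
          · omega
          · intro l hl1 hl2 hl3
            rw [h4] at hl3
            by_cases hlp : l = 2 * n - 1 - p
            · subst hlp; omega
            by_cases hli : l = 2 * n - 1 - i.val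
            · subst hli; omega
            rw [h5 l (by omega) (by omega) (by omega) hli hlp] at hl3
            refine h9 l hl1 (by omega) ?_
            omega
        · refine Or.inl (Or.inr ⟨⟨q, by omega, rfl⟩, h7, h8, ?_⟩)
          intro l hl1 hl2 hl3
          by_cases hlp : l = 2 * n - 1 - p
          · subst hlp; omega
          exact h9 l hl1 (by omega) hl3
      · rintro ((h | ⟨⟨q, hq, rfl⟩, h7, h8, h9⟩) | ⟨⟨k1, k2, k3⟩, h | ⟨⟨q, hq, rfl⟩, h7, h8, h9⟩⟩)
        · exact Or.inl h
        · exact Or.inr ⟨⟨q, by omega, rfl⟩, h7, h8, fun l hl1 hl2 => h9 l hl1 (by omega)⟩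
        · rw [h4] at h
          subst h
          refine Or.inr ⟨⟨p, by omega, rfl⟩, k1, k2, fun l hl1 hl2 => k3 l hl1 ?_⟩
          simp only [hj]; omega
        · rw [h5 q (by omega) (by omega) (by omega) (by omega) (by omega)] at h7 h8 h9 ⊢
          rw [h4] at h7 h8
          simp only [hj] at k1 k2 k3
          refine Or.inr ⟨⟨q, by omega, rfl⟩, by omega, by omega, fun l hl1 hl2 hl3 => ?_⟩
          have k3 := k3 l hl1 (by omega)
          have h9 := h9 l hl1 (by omega)
          by_cases hli : l = 2 * n - 1 - i.val
          · subst hli; omega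
          rw [h4, h5 l (by omega) (by omega) (by omega) hli (by omega)] at h9
          have : value w l ≠ 2 * n - 1 - value w p :=
            value_ne_bar w (by omega) (by omega) (by omega)
          omega
    have hdis : InnerStep w i.val p c → QuantumBruhatEdge w (unb j, bar (unb i)) →
        InnerStep w' i.val p c → False := by
      rw [hE]
      rintro h ⟨k1, k2, k3⟩ h'
      simp only [hj] at k1 k2 k3
      rcases h with h | ⟨⟨q, hq, rfl⟩, h7, h8, h9⟩
      · rcases h' with h' | ⟨-, h', -⟩
        · omega
        · omega
      · have h10 := h9 (2 * n - 1 - p) (by omega) (by omega)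
        rcases h' with h' | ⟨-, h', -⟩
        · rw [h4] at h'
          have := value_ne w (p := q) (q := p) (by omega) (by omega) (by omega)
          have := value_lt w (p := q) (by omega)
          omega
        · omega
    have hstep := innerRoots_succ i j
    simp only [hj] at hstep
    rw [hstep, cnt, ih (by omega)]
    simp only [hiff]
    by_cases hE' : QuantumBruhatEdge w (unb j, bar (unb i))
    · rw [if_pos hE']
      change _ + cnt _ w' _ = _
      rw [ih (by omega)]
      by_cases h : InnerStep w i.val p c
      · rw [if_pos h, if_neg (hdis h hE'), if_pos (Or.inl h)]
      · simp [h, hE']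
    · rw [if_neg hE']
      simp [hE']

/-- The values of `w` at the first `i` positions. -/
def initialValues {n : ℕ} (w : SignedPerm n) (i : ℕ) (y : ℕ) : Prop := ∃ l < i, value w l = y

theorem mem_innerRoots {n : ℕ} {i : Fin n} {p : ℕ} {r : Letter n × Letter n}
    (h : r ∈ innerRoots i p) : ∃ q : Fin n, q.val < p ∧ r = (unb q, bar (unb i)) := by
  simp only [innerRoots, List.mem_reverse, List.mem_map, List.mem_filter, List.mem_finRange,
    true_and, decide_eq_true_eq] at h
  obtain ⟨q, h1, h2⟩ := h
  exact ⟨q, h1, h2.symm⟩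

theorem value_eq_of_walk_innerRoots {n : ℕ} {i : Fin n} {w x : SignedPerm n}
    (h : Walk (innerRoots i i.val) w x) {l : ℕ} (h1 : i.val < l) (h2 : l < 2 * n - 1 - i.val) :
    value x l = value w l := by
  refine h.value_eq fun r hr => ?_
  have hi := i.isLt
  obtain ⟨q, hq, rfl⟩ := mem_innerRoots hr
  simp only [val_unb, val_bar]
  omega

/-- Each step trades the bar of the new letter for the bar of the old one. These exchanges
telescope, so only the first and the last letter at `i` matter. -/
theorem initialValues_of_walk_innerRoots {n : ℕ} {i : Fin n} {w x : SignedPerm n}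
    (h : Walk (innerRoots i i.val) w x) :
    (value x i.val = value w i.val ∧ ∀ y, initialValues x i.val y ↔ initialValues w i.val y) ∨
    (initialValues w i.val (2 * n - 1 - value x i.val) ∧ ∀ y, initialValues x i.val y ↔
      (initialValues w i.val y ∧ y ≠ 2 * n - 1 - value x i.val) ∨
        y = 2 * n - 1 - value w i.val) := by
  have hi := i.isLt
  have hb : ¬ initialValues w i.val (2 * n - 1 - value w i.val) := by
    rintro ⟨l, hl, h⟩
    rw [← value_bar w (by omega)] at h
    have := value_inj w (by omega) (by omega) h
    omega
  refine h.invariant (P := fun x =>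
    (value x i.val = value w i.val ∧ ∀ y, initialValues x i.val y ↔ initialValues w i.val y) ∨
    (initialValues w i.val (2 * n - 1 - value x i.val) ∧ ∀ y, initialValues x i.val y ↔
      (initialValues w i.val y ∧ y ≠ 2 * n - 1 - value x i.val) ∨
        y = 2 * n - 1 - value w i.val)) ?_ (Or.inl ⟨rfl, fun y => Iff.rfl⟩)
  intro u r hr hu
  obtain ⟨q, hq, rfl⟩ := mem_innerRoots hr
  have hne : unb q ≠ bar (unb i) := by simp only [ne_eq, Fin.ext_iff, val_unb, val_bar]; omega
  set u' := u * reflection (unb q, bar (unb i)) with hu'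
  have h1 : value u' q.val = 2 * n - 1 - value u i.val := by
    have := value_mul_left u hne
    rw [val_unb, val_bar, val_unb, value_bar u (by omega)] at this
    exact this
  have h3 : value u' (2 * n - 1 - i.val) = value u q.val := by
    have := value_mul_right u hne
    rw [val_unb, val_bar, val_unb] at this
    exact this
  have h4 : 2 * n - 1 - value u' i.val = value u q.val := by
    rw [← h3, value_bar u' (by omega)]
  have h5 : ∀ l, l < i.val → l ≠ q.val → value u' l = value u l := by
    intro l h1 h2
    refine value_mul_of_ne u ?_ ?_ ?_ ?_ <;> simp only [val_unb, val_bar] <;> omega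
  have hl1 := value_lt u (p := i.val) (by omega)
  have hl2 := value_lt u (p := q.val) (by omega)
  have hl3 := value_lt u' (p := i.val) (by omega)
  have hl4 := value_lt w (p := i.val) (by omega)
  have hset : ∀ y, initialValues u' i.val y ↔
      (initialValues u i.val y ∧ y ≠ value u q.val) ∨ y = 2 * n - 1 - value u i.val := by
    intro y
    constructor
    · rintro ⟨l, hl, rfl⟩
      by_cases hlq : l = q.val
      · subst hlq; exact Or.inr h1
      · rw [h5 l hl hlq]
        exact Or.inl ⟨⟨l, hl, rfl⟩, value_ne u (by omega) (by omega) hlq⟩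
    · rintro (⟨⟨l, hl, rfl⟩, h⟩ | rfl)
      · have hlq : l ≠ q.val := fun h' => h (by rw [h'])
        exact ⟨l, hl, h5 l hl hlq⟩
      · exact ⟨q.val, hq, h1⟩
  have hq' : initialValues u i.val (value u q.val) := ⟨q.val, hq, rfl⟩
  rw [h4]
  rcases hu with ⟨h6, h7⟩ | ⟨h6, h7⟩
  · right
    refine ⟨(h7 _).1 hq', fun y => ?_⟩
    rw [hset, h7, h6]
  -- The invariant is proved for arbitrary steps, not only for edges, so a return to the original
  -- letter has to be allowed; it restores the original set.
  · by_cases hqb : value u q.val = 2 * n - 1 - value w i.val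
    · left
      refine ⟨by omega, fun y => ?_⟩
      rw [hset, h7, hqb]
      by_cases hy : y = 2 * n - 1 - value u i.val
      · subst hy; simp [h6]
      · by_cases hy' : y = 2 * n - 1 - value w i.val
        · subst hy'; simp [hb, hy]
        · simp [hy, hy']
    · right
      have h8 := (h7 _).1 hq'
      have h9 : initialValues w i.val (value u q.val) := by tauto
      refine ⟨h9, fun y => ?_⟩
      rw [hset, h7]
      by_cases hy : y = 2 * n - 1 - value u i.val
      · subst hy
        simp only [h6, or_true, true_and, true_iff]
        by_cases h10 : 2 * n - 1 - value u i.val = value u q.val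
        · exfalso
          rw [← value_bar u (by omega)] at h10
          have := value_inj u (by omega) (by omega) h10
          omega
        · exact Or.inl h10
      · by_cases hy' : y = 2 * n - 1 - value w i.val
        · simp only [hy', or_true, true_and, iff_true]
          left; exact fun h => hqb h.symm
        · simp [hy, hy']


/-! ### Flows on the cycle of letters and the criterion for `Γ_r` -/

open Classical in
/-- The indicator of a proposition. -/
noncomputable def ind (p : Prop) : ℕ := if p then 1 else 0

theorem ind_pos {p : Prop} (h : p) : ind p = 1 := if_pos h

theorem ind_neg {p : Prop} (h : ¬ p) : ind p = 0 := if_neg h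

theorem ind_le_one (p : Prop) : ind p ≤ 1 := by
  unfold ind; split_ifs <;> omega

theorem ind_or {p q : Prop} (h : p → ¬ q) : ind (p ∨ q) = ind p + ind q := by
  by_cases hp : p
  · rw [ind_pos (Or.inl hp), ind_pos hp, ind_neg (h hp)]
  · by_cases hq : q
    · rw [ind_pos (Or.inr hq), ind_neg hp, ind_pos hq]
    · rw [ind_neg (by tauto), ind_neg hp, ind_neg hq]

/-- A flow on the cycle of letters with sources `A` and sinks `R`; the number `G x` is the flow
that enters the letter `x` from its predecessor. -/
def Flow (n : ℕ) (A R : ℕ → Prop) (G : ℕ → ℕ) : Prop :=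
  (∀ x < 2 * n, G (x + 1) + ind (R x) = G x + ind (A x)) ∧ G (2 * n) = G 0

/-- No letter of `R` has its bar in `R`. -/
def NoPair (n : ℕ) (R : ℕ → Prop) : Prop := ∀ x < 2 * n, R x → ¬ R (2 * n - 1 - x)

/-- The letters are the active ones `A` and their bars, the letter `b` and its bar, the frozen ones
`F` and their bars, and the free ones `O`. -/
structure LetterSplit (n b : ℕ) (A F O : ℕ → Prop) : Prop where
  b_lt : b < 2 * n
  A_bar : ∀ y, A y → ¬ A (2 * n - 1 - y)
  A_ne : ∀ y, A y → y ≠ b ∧ y ≠ 2 * n - 1 - b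
  A_F : ∀ y, A y → ¬ F y ∧ ¬ F (2 * n - 1 - y)
  A_O : ∀ y, A y → ¬ O y
  F_lt : ∀ y, F y → y < 2 * n
  F_ne : ∀ y, F y → y ≠ b ∧ y ≠ 2 * n - 1 - b
  F_O : ∀ y, F y → ¬ O y
  O_lt : ∀ y, O y → y < 2 * n
  O_bar : ∀ y, O y → O (2 * n - 1 - y)
  O_ne : ∀ y, O y → y ≠ b ∧ y ≠ 2 * n - 1 - b
  cover : ∀ y < 2 * n, A y ∨ A (2 * n - 1 - y) ∨ y = b ∨ y = 2 * n - 1 - b ∨ F y ∨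
    F (2 * n - 1 - y) ∨ O y

/-- The letters `A` after the letter `d` has moved to `c`, exchanging the bar of `c` for the bar
of `d`. -/
def exchange (n : ℕ) (A : ℕ → Prop) (d c y : ℕ) : Prop :=
  (c = d ∧ A y) ∨ (c ≠ d ∧ ((A y ∧ y ≠ 2 * n - 1 - c) ∨ y = 2 * n - 1 - d))

theorem ind_exchange {n : ℕ} {A : ℕ → Prop} {d c : ℕ} (hd : ¬ A (2 * n - 1 - d))
    (hc : c = d ∨ A (2 * n - 1 - c)) (y : ℕ) :
    ind (exchange n A d c y) + ind (y = 2 * n - 1 - c) = ind (A y) + ind (y = 2 * n - 1 - d) := by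
  by_cases hcd : c = d
  · subst hcd
    have : exchange n A c c y ↔ A y := by simp [exchange]
    rw [propext this]
  · have hc := hc.resolve_left hcd
    have : exchange n A d c y ↔ (A y ∧ y ≠ 2 * n - 1 - c) ∨ y = 2 * n - 1 - d := by
      simp [exchange, hcd]
    rw [propext this, ind_or (fun (h : A y ∧ _) (h' : y = 2 * n - 1 - d) => hd (h' ▸ h.1))]
    by_cases hy : y = 2 * n - 1 - c
    · subst hy
      rw [ind_neg (by tauto), ind_pos rfl, ind_pos hc]; omega
    · rw [ind_neg hy, add_zero]
      congr 2
      exact propext (by tauto)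

theorem ind_and_ne {R : ℕ → Prop} {c : ℕ} (hc : R c) (y : ℕ) :
    ind (R y ∧ y ≠ c) + ind (y = c) = ind (R y) := by
  by_cases hy : y = c
  · subst hy
    rw [ind_neg (by tauto), ind_pos rfl, ind_pos hc]
  · rw [ind_neg hy, add_zero]
    congr 1
    exact propext (by tauto)

/-- The edge that enters `e` lies on the arc from `b` to `c`. -/
def Arc (b c e : ℕ) : Prop := (b ≤ c ∧ b < e ∧ e ≤ c) ∨ (c < b ∧ (b < e ∨ e ≤ c))

theorem ind_arc_succ (b c x : ℕ) :
    ind (Arc b c (x + 1)) + ind (x = c) = ind (Arc b c x) + ind (x = b) := by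
  unfold ind Arc; split_ifs <;> omega

/-- Two flows with the same sources and sinks differ by a constant, and for nonnegative flows that
both have a zero this constant is 0. -/
theorem Flow.unique {n : ℕ} {A R : ℕ → Prop} {G G' : ℕ → ℕ} (h : Flow n A R G)
    (h' : Flow n A R G') (hz : ∃ x ≤ 2 * n, G x = 0) (hz' : ∃ x ≤ 2 * n, G' x = 0) :
    ∀ x ≤ 2 * n, G x = G' x := by
  have key : ∀ x ≤ 2 * n, G x + G' 0 = G' x + G 0 := by
    intro x hx
    induction x with
    | zero => omega
    | succ x ih =>
      have h1 := h.1 x (by omega)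
      have h2 := h'.1 x (by omega)
      have := ih (by omega)
      omega
  obtain ⟨x, hx, hx0⟩ := hz
  obtain ⟨y, hy, hy0⟩ := hz'
  have h1 := key x hx
  have h2 := key y hy
  intro z hz
  have := key z hz
  omega

theorem Flow.sub {n : ℕ} {A A' R R' : ℕ → Prop} {G K : ℕ → ℕ} (h : Flow n A R G)
    (hK : ∀ x ≤ 2 * n, K x ≤ G x) (hK0 : K (2 * n) = K 0)
    (hKA : ∀ x < 2 * n, K (x + 1) + ind (A' x) + ind (R x) = K x + ind (A x) + ind (R' x)) :
    Flow n A' R' (fun x => G x - K x) := by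
  refine ⟨fun x hx => ?_, ?_⟩
  · have h1 := h.1 x hx
    have h2 := hKA x hx
    have h3 := hK x (by omega)
    have h4 := hK (x + 1) (by omega)
    simp only
    omega
  · have := h.2
    simp only
    omega

theorem Flow.add {n : ℕ} {A A' R R' : ℕ → Prop} {G K : ℕ → ℕ} (h : Flow n A' R' G)
    (hK0 : K (2 * n) = K 0)
    (hKA : ∀ x < 2 * n, K (x + 1) + ind (A' x) + ind (R x) = K x + ind (A x) + ind (R' x)) :
    Flow n A R (fun x => G x + K x) := by
  refine ⟨fun x hx => ?_, ?_⟩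
  · have h1 := h.1 x hx
    have h2 := hKA x hx
    simp only
    omega
  · have := h.2
    simp only
    omega

/-- The flow criterion for the chain `Γ_r`. -/
def CritR (n : ℕ) (A O R : ℕ → Prop) : Prop :=
  NoPair n R ∧ ∃ G, Flow n A R G ∧ G 0 = 0 ∧ G n = 0 ∧ ∀ y, O y → G y = 0

/-- The possible moves of the letter `b` in a factor of `Γ_r`. -/
def StepTo (n b : ℕ) (A O : ℕ → Prop) (c : ℕ) : Prop :=
  c = b ∨ (A (2 * n - 1 - c) ∧ c < 2 * n ∧ b < c ∧ (n ≤ b ∨ c < n) ∧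
    ∀ y, O y → ¬ (b < y ∧ y < c))

section
variable {n b : ℕ} {A F O R : ℕ → Prop}

theorem Flow.not_sink {n y : ℕ} {A R : ℕ → Prop} {G : ℕ → ℕ} (h : Flow n A R G) (hy : y < 2 * n)
    (h0 : G y = 0) (hA : ¬ A y) : ¬ R y ∧ G (y + 1) = 0 := by
  have := h.1 y hy
  rw [ind_neg hA, h0] at this
  by_cases hR : R y
  · rw [ind_pos hR] at this; omega
  · exact ⟨hR, by omega⟩

/-- To the flow of the smaller problem one adds unit paths from `b` to `c` and from `c̄` to `b̄`.
The sum is positive all the way from `b` to `c` and zero right after `c`, so `c` can be recovered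
from it. -/
theorem critR_of_step (hS : LetterSplit n b A (fun _ => False) O) {c : ℕ}
    (hc : StepTo n b A O c) (hRc : R c)
    (h : CritR n (exchange n A b c) (fun y => O y ∨ y = c ∨ y = 2 * n - 1 - c)
      (fun y => R y ∧ y ≠ c)) :
    NoPair n R ∧ ∃ G, Flow n (fun y => A y ∨ y = b) R G ∧ G 0 = 0 ∧ G n = 0 ∧
      (∀ y, O y → G y = 0) ∧ G (c + 1) = 0 ∧ ∀ x, b ≤ x → x < c → 1 ≤ G (x + 1) := by
  obtain ⟨hp, G, hG, h0, hn, hO⟩ := h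
  have hb := hS.b_lt
  have hAb : ¬ A (2 * n - 1 - b) := fun h => (hS.A_ne _ h).2 rfl
  have hAb' : ¬ A b := fun h => (hS.A_ne _ h).1 rfl
  have hcl : c < 2 * n := by
    rcases hc with rfl | h
    · exact hb
    · exact h.2.1
  have hbc : b ≤ c := by
    rcases hc with rfl | h
    · exact le_rfl
    · exact h.2.2.1.le
  have hhalf : n ≤ b ∨ c < n := by
    rcases hc with rfl | h
    · omega
    · exact h.2.2.2.1
  have hcA : c = b ∨ A (2 * n - 1 - c) := hc.imp_right And.left
  have hcA' : ¬ A c := by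
    rcases hcA with rfl | h
    · exact hAb'
    · intro h'
      have := hS.A_bar _ h'
      exact this h
  have hbt : ∀ y, O y → ¬ (b < y ∧ y ≤ c) := by
    intro y hy h
    rcases hc with rfl | ⟨h1, -, -, -, h2⟩
    · omega
    · rcases h.2.lt_or_eq with h3 | rfl
      · exact h2 y hy ⟨h.1, h3⟩
      · exact hS.A_O _ h1 (hS.O_bar _ hy)
  have hexc : ¬ exchange n A b c c := by
    rintro (⟨-, h⟩ | ⟨-, ⟨h, -⟩ | h⟩)
    · exact hcA' h
    · exact hcA' h
    · omega
  have hexc' : ¬ exchange n A b c (2 * n - 1 - c) := by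
    rintro (⟨h, h'⟩ | ⟨h1, ⟨h, h'⟩ | h⟩)
    · rw [h] at h'; exact hAb h'
    · exact h' rfl
    · omega
  have hbar : ¬ R (2 * n - 1 - c) := fun h =>
    (hG.not_sink (by omega) (hO _ (Or.inr (Or.inr rfl))) hexc').1 ⟨h, by omega⟩
  have hc1 := (hG.not_sink hcl (hO _ (Or.inr (Or.inl rfl))) hexc).2
  refine ⟨?_, fun x => G x + (ind (b < x ∧ x ≤ c) +
    ind (2 * n - 1 - c < x ∧ x ≤ 2 * n - 1 - b)), hG.add ?_ ?_, ?_, ?_, ?_, ?_, ?_⟩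
  · intro x hx h1 h2
    by_cases hxc : x = c
    · subst hxc; exact hbar h2
    by_cases hxc' : 2 * n - 1 - x = c
    · apply hbar; rw [← hxc']; rwa [show 2 * n - 1 - (2 * n - 1 - x) = x by omega]
    · exact hp x hx ⟨h1, hxc⟩ ⟨h2, hxc'⟩
  · rw [ind_neg (by omega), ind_neg (by omega), ind_neg (by omega), ind_neg (by omega)]
  · intro x hx
    have e1 := ind_exchange hAb hcA x
    have e2 := ind_and_ne hRc x
    have e3 : ind (A x ∨ x = b) = ind (A x) + ind (x = b) :=
      ind_or fun h h' => hAb' (h' ▸ h)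
    have e4 : ind (b < x + 1 ∧ x + 1 ≤ c) + ind (x = c) = ind (b < x ∧ x ≤ c) + ind (x = b) := by
      unfold ind; split_ifs <;> omega
    have e5 : ind (2 * n - 1 - c < x + 1 ∧ x + 1 ≤ 2 * n - 1 - b) + ind (x = 2 * n - 1 - b) =
        ind (2 * n - 1 - c < x ∧ x ≤ 2 * n - 1 - b) + ind (x = 2 * n - 1 - c) := by
      unfold ind; split_ifs <;> omega
    omega
  · simp only [h0]
    rw [ind_neg (by omega), ind_neg (by omega)]
  · simp only [hn]
    rw [ind_neg (by omega), ind_neg (by omega)]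
  · intro y hy
    have h1 := hbt y hy
    have h2 := hbt _ (hS.O_bar y hy)
    have h3 := hS.O_lt y hy
    have h4 := hS.O_ne y hy
    simp only [hO y (Or.inl hy)]
    rw [ind_neg h1, ind_neg (by omega)]
  · simp only [hc1]
    rw [ind_neg (by omega), ind_neg (by omega)]
  · intro x h1 h2
    simp only
    rw [ind_pos (show b < x + 1 ∧ x + 1 ≤ c by omega)]
    omega

/-- Each pair `x`, `x̄` that is not free contains a source, whereas `R` takes at most one letter of
it; free letters are not sinks. So `G x - G (2 n - x)` is nondecreasing in `x`, and it is 0 at both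
ends. -/
theorem Flow.symm {G : ℕ → ℕ} (hS : LetterSplit n b A (fun _ => False) O) (hR : NoPair n R)
    (hG : Flow n (fun y => A y ∨ y = b) R G) (h0 : G 0 = 0) (hO : ∀ y, O y → G y = 0) :
    ∀ x ≤ 2 * n, G x = G (2 * n - x) := by
  have hb := hS.b_lt
  have hstep : ∀ x < 2 * n, G x + G (2 * n - (x + 1)) ≤ G (x + 1) + G (2 * n - x) := by
    intro x hx
    have h1 : G (x + 1) + ind (R x) = G x + ind (A x ∨ x = b) := hG.1 x hx
    have h2 : G (2 * n - 1 - x + 1) + ind (R (2 * n - 1 - x)) = G (2 * n - 1 - x) +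
      ind (A (2 * n - 1 - x) ∨ 2 * n - 1 - x = b) := hG.1 (2 * n - 1 - x) (by omega)
    rw [show 2 * n - 1 - x + 1 = 2 * n - x by omega] at h2
    rw [show 2 * n - (x + 1) = 2 * n - 1 - x by omega]
    have h3 : ind (R x) + ind (R (2 * n - 1 - x)) ≤
        ind (A x ∨ x = b) + ind (A (2 * n - 1 - x) ∨ 2 * n - 1 - x = b) := by
      by_cases hOx : O x
      · have e1 := (hG.not_sink hx (hO x hOx) (by
          rintro (h | h)
          · exact hS.A_O x h hOx
          · exact (hS.O_ne x hOx).1 h)).1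
        have hOx' := hS.O_bar x hOx
        have e2 := (hG.not_sink (show 2 * n - 1 - x < 2 * n by omega) (hO _ hOx') (by
          rintro (h | h)
          · exact hS.A_O _ h hOx'
          · exact (hS.O_ne _ hOx').1 h)).1
        rw [ind_neg e1, ind_neg e2]; omega
      · have h4 : ind (R x) + ind (R (2 * n - 1 - x)) ≤ 1 := by
          by_cases h : R x
          · rw [ind_pos h, ind_neg (hR x hx h)]
          · rw [ind_neg h]; have := ind_le_one (R (2 * n - 1 - x)); omega
        have h5 : (A x ∨ x = b) ∨ (A (2 * n - 1 - x) ∨ 2 * n - 1 - x = b) := by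
          rcases hS.cover x hx with h | h | h | h | h | h | h
          · exact Or.inl (Or.inl h)
          · exact Or.inr (Or.inl h)
          · exact Or.inl (Or.inr h)
          · exact Or.inr (Or.inr (by omega))
          · exact h.elim
          · exact h.elim
          · exact absurd h hOx
        rcases h5 with h5 | h5
        · rw [ind_pos h5]; omega
        · rw [ind_pos h5]; omega
    omega
  have hmono : ∀ k x, x + k ≤ 2 * n → G x + G (2 * n - (x + k)) ≤ G (x + k) + G (2 * n - x) := by
    intro k
    induction k with
    | zero => intro x hx; simp only [add_zero]; omega
    | succ k ih =>
      intro x hx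
      have h1 := ih x (by omega)
      have h2 := hstep (x + k) (by omega)
      rw [← add_assoc]
      omega
  intro x hx
  have h1 := hmono x 0 (by omega)
  have h2 := hmono (2 * n - x) x (by omega)
  have h3 := hG.2
  rw [show x + (2 * n - x) = 2 * n by omega] at h2
  simp only [zero_add, Nat.sub_zero, Nat.sub_self] at h1 h2
  omega

/-- Conversely, `c` is the letter at which the stretch of positive flow that starts at `b` ends.
Such a stretch avoids free letters and does not leave its half; by `Flow.symm` the mirror path
carries flow as well, so both paths can be removed. -/
theorem critR_iff (hS : LetterSplit n b A (fun _ => False) O) :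
    CritR n (fun y => A y ∨ y = b) O R ↔ ∃ c, StepTo n b A O c ∧ R c ∧
      CritR n (exchange n A b c) (fun y => O y ∨ y = c ∨ y = 2 * n - 1 - c)
        (fun y => R y ∧ y ≠ c) := by
  constructor
  swap
  · rintro ⟨c, h1, h2, h3⟩
    obtain ⟨h4, G, h5, h6, h7, h8, -⟩ := critR_of_step hS h1 h2 h3
    exact ⟨h4, G, h5, h6, h7, h8⟩
  rintro ⟨hp, G, hG, h0, hn, hO⟩
  have hb := hS.b_lt
  have hAb : ¬ A (2 * n - 1 - b) := fun h => (hS.A_ne _ h).2 rfl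
  have hAb' : ¬ A b := fun h => (hS.A_ne _ h).1 rfl
  have hsymm := hG.symm hS hp h0 hO
  have h2n := hG.2
  -- The flow vanishes at the end of each half, so the search stops within the half of `b`.
  have hex : ∃ x, b ≤ x ∧ G (x + 1) = 0 := by
    by_cases h : b < n
    · exact ⟨n - 1, by omega, by rwa [show n - 1 + 1 = n by omega]⟩
    · exact ⟨2 * n - 1, by omega, by rw [show 2 * n - 1 + 1 = 2 * n by omega]; omega⟩
  classical
  set c := Nat.find hex with hcdef
  obtain ⟨hbc, hc1⟩ : b ≤ c ∧ G (c + 1) = 0 := Nat.find_spec hex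
  have hmin : ∀ x, b ≤ x → x < c → 1 ≤ G (x + 1) := by
    intro x h1 h2
    have := Nat.find_min hex h2
    by_contra h
    exact this ⟨h1, by omega⟩
  have hcl : c < 2 * n := by
    by_contra h
    have := hmin (2 * n - 1) (by omega) (by omega)
    rw [show 2 * n - 1 + 1 = 2 * n by omega] at this
    omega
  have hhalf : n ≤ b ∨ c < n := by
    by_contra h
    have := hmin (n - 1) (by omega) (by omega)
    rw [show n - 1 + 1 = n by omega] at this
    omega
  have hpos : ∀ e, b < e → e ≤ c → 1 ≤ G e := by
    intro e h1 h2
    have := hmin (e - 1) (by omega) (by omega)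
    rwa [show e - 1 + 1 = e by omega] at this
  have hflow := hG.1 c hcl
  -- No flow leaves `c`, so `c` is a sink and absorbs exactly one unit: its own if `c = b`, and
  -- otherwise an incoming one, in which case `c` is not a source.
  have hRc : R c ∧ G c = ind (b < c) ∧ (c ≠ b → ¬ A c) := by
    by_cases hcb : c = b
    · rw [hcb] at hflow hc1 ⊢
      rw [ind_pos (Or.inr rfl), hc1] at hflow
      by_cases h : R b
      · rw [ind_pos h] at hflow
        refine ⟨h, ?_, fun h => absurd rfl h⟩
        rw [ind_neg (lt_irrefl b)]; omega
      · rw [ind_neg h] at hflow; omega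
    · have h1 := hpos c (by omega) le_rfl
      by_cases h : R c
      · rw [ind_pos h, hc1] at hflow
        refine ⟨h, ?_, fun _ hA => ?_⟩
        · rw [ind_pos (show b < c by omega)]
          omega
        · rw [ind_pos (Or.inl hA)] at hflow; omega
      · rw [ind_neg h] at hflow; omega
  obtain ⟨hRc, hGc, hAc⟩ := hRc
  have hOc : ∀ y, O y → ¬ (b < y ∧ y ≤ c) := by
    intro y hy h
    have := hpos y h.1 h.2
    have := hO y hy
    omega
  have hcA : c = b ∨ A (2 * n - 1 - c) := by
    by_cases hcb : c = b
    · exact Or.inl hcb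
    · right
      rcases hS.cover c hcl with h | h | h | h | h | h | h
      · exact absurd h (hAc hcb)
      · exact h
      · exact absurd h hcb
      · omega
      · exact h.elim
      · exact h.elim
      · exact absurd ⟨by omega, le_rfl⟩ (hOc c h)
  refine ⟨c, ?_, hRc, fun x hx h1 h2 => hp x hx h1.1 h2.1, fun x => G x - (ind (b < x ∧ x ≤ c) +
    ind (2 * n - 1 - c < x ∧ x ≤ 2 * n - 1 - b)), hG.sub ?_ ?_ ?_, ?_, ?_, ?_⟩
  · rcases eq_or_ne c b with h | h
    · exact Or.inl h
    · refine Or.inr ⟨hcA.resolve_left h, hcl, by omega, hhalf, fun y hy h' => hOc y hy ⟨h'.1, h'.2.le⟩⟩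
  · intro x hx
    by_cases h1 : b < x ∧ x ≤ c
    · rw [ind_pos h1, ind_neg (by omega)]
      exact hpos x h1.1 h1.2
    · rw [ind_neg h1]
      by_cases h2 : 2 * n - 1 - c < x ∧ x ≤ 2 * n - 1 - b
      · rw [ind_pos h2, hsymm x hx]
        have := hpos (2 * n - x) (by omega) (by omega)
        omega
      · rw [ind_neg h2]; omega
  · rw [ind_neg (by omega), ind_neg (by omega), ind_neg (by omega), ind_neg (by omega)]
  · intro x hx
    have e1 := ind_exchange hAb hcA x
    have e2 := ind_and_ne hRc x
    have e3 : ind (A x ∨ x = b) = ind (A x) + ind (x = b) :=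
      ind_or fun h h' => hAb' (h' ▸ h)
    have e4 : ind (b < x + 1 ∧ x + 1 ≤ c) + ind (x = c) = ind (b < x ∧ x ≤ c) + ind (x = b) := by
      unfold ind; split_ifs <;> omega
    have e5 : ind (2 * n - 1 - c < x + 1 ∧ x + 1 ≤ 2 * n - 1 - b) + ind (x = 2 * n - 1 - b) =
        ind (2 * n - 1 - c < x ∧ x ≤ 2 * n - 1 - b) + ind (x = 2 * n - 1 - c) := by
      unfold ind; split_ifs <;> omega
    omega
  · simp only [h0]; omega
  · simp only [hn]; omega
  · rintro y (hy | rfl | rfl)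
    · simp only [hO y hy]; omega
    · simp only [hGc]
      by_cases h : b < c
      · rw [ind_pos h, ind_pos ⟨h, le_rfl⟩]; omega
      · rw [ind_neg h]; omega
    · have := hsymm (2 * n - 1 - c) (by omega)
      rw [show 2 * n - (2 * n - 1 - c) = c + 1 by omega, hc1] at this
      simp only [this]; omega

/-- Both steps produce the same flow by `Flow.unique`, and its first zero after `b` determines the
letter. -/
theorem critR_step_unique (hS : LetterSplit n b A (fun _ => False) O) {c c' : ℕ}
    (hc : StepTo n b A O c) (hRc : R c)
    (h : CritR n (exchange n A b c) (fun y => O y ∨ y = c ∨ y = 2 * n - 1 - c)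
      (fun y => R y ∧ y ≠ c))
    (hc' : StepTo n b A O c') (hRc' : R c')
    (h' : CritR n (exchange n A b c') (fun y => O y ∨ y = c' ∨ y = 2 * n - 1 - c')
      (fun y => R y ∧ y ≠ c')) : c = c' := by
  obtain ⟨-, G, h1, h2, -, -, h3, h4⟩ := critR_of_step hS hc hRc h
  obtain ⟨-, G', k1, k2, -, -, k3, k4⟩ := critR_of_step hS hc' hRc' h'
  have hu := h1.unique k1 ⟨0, by omega, h2⟩ ⟨0, by omega, k2⟩
  have hb := hS.b_lt
  have hle : ∀ c, StepTo n b A O c → b ≤ c ∧ c < 2 * n := by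
    rintro c (rfl | h)
    · exact ⟨le_rfl, hb⟩
    · exact ⟨h.2.2.1.le, h.2.1⟩
  have l1 := hle c hc
  have l2 := hle c' hc'
  rcases lt_trichotomy c c' with h5 | h5 | h5
  · have := k4 c l1.1 h5
    rw [← hu _ (by omega)] at this
    omega
  · exact h5
  · have := h4 c' l2.1 h5
    rw [hu _ (by omega)] at this
    omega
end


/-! ### The flow criterion for `Γ_l` -/

/-- The flow criterion for the chain `Γ_l`. -/
def CritL (n : ℕ) (A F R : ℕ → Prop) : Prop :=
  NoPair n R ∧ (∀ f, F f → ¬ R (2 * n - 1 - f)) ∧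
    ∃ G, Flow n A R G ∧ (∃ x ≤ 2 * n, G x = 0) ∧ ∀ f, F f → G f = 0

/-- The letters that are not active after the letter `b` has moved to `d`. -/
def freeAfter (n b : ℕ) (F O : ℕ → Prop) (d y : ℕ) : Prop :=
  F y ∨ F (2 * n - 1 - y) ∨ ((O y ∨ y = b ∨ y = 2 * n - 1 - b) ∧ y ≠ d ∧ y ≠ 2 * n - 1 - d)

section
variable {n b : ℕ} {A F O R : ℕ → Prop}

theorem bar_bar_nat {n y : ℕ} (h : y < 2 * n) : 2 * n - 1 - (2 * n - 1 - y) = y := by omega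

/-- Three paths are added to the flow of the smaller problem: the cyclic arc from `b` to `d`, the
path from `d` up to `c`, and the mirror path from `c̄` to `d̄`. None of them enters a frozen letter,
and together the first two form the arc from `b` to `c`. -/
theorem critL_of_step (hS : LetterSplit n b A F O) {d c : ℕ} (hd : OuterReach F O n b d)
    (hc : StepTo n d A (freeAfter n b F O d) c) (hRc : R c)
    (h : CritL n (exchange n A d c) (fun y => F y ∨ y = c) (fun y => R y ∧ y ≠ c)) :
    NoPair n R ∧ (∀ f, F f → ¬ R (2 * n - 1 - f)) ∧ ∃ G, Flow n (fun y => A y ∨ y = b) R G ∧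
      (∀ f, F f → G f = 0) ∧ G (c + 1) = 0 ∧ ∀ e ≤ 2 * n, Arc b c e → 1 ≤ G e := by
  obtain ⟨hp, hbarF, G, hG, -, hF⟩ := h
  have hb := hS.b_lt
  have hAb' : ¬ A b := fun h => (hS.A_ne _ h).1 rfl
  have hdl : d < 2 * n := by
    rcases hd.1 with h | h | h
    · omega
    · omega
    · exact hS.O_lt _ h
  have hAd : ¬ A d := fun h => by
    rcases hd.1 with h' | h' | h'
    · exact (hS.A_ne _ h).1 h'
    · exact (hS.A_ne _ h).2 h'
    · exact hS.A_O _ h h'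
  have hAd' : ¬ A (2 * n - 1 - d) := fun h => by
    have h1 := hS.A_ne _ h
    rcases hd.1 with h' | h' | h'
    · omega
    · omega
    · exact hS.A_O _ h (hS.O_bar _ h')
  have hFd : ∀ f, F f → f ≠ d ∧ f ≠ 2 * n - 1 - d := fun f hf => by
    have h1 := hS.F_ne _ hf
    rcases hd.1 with h' | h' | h'
    · omega
    · omega
    · have h2 := hS.F_O _ hf
      exact ⟨fun h => h2 (h ▸ h'), fun h => h2 (h ▸ hS.O_bar _ h')⟩
  have hcl : c < 2 * n := by
    rcases hc with h | h
    · omega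
    · exact h.2.1
  have hdc : d ≤ c := by
    rcases hc with h | h
    · omega
    · exact h.2.2.1.le
  have hhalf : n ≤ d ∨ c < n := by
    rcases hc with h | h
    · omega
    · exact h.2.2.2.1
  have hcA : c = d ∨ A (2 * n - 1 - c) := hc.imp_right And.left
  have hcA' : ¬ A c := by
    rcases hcA with rfl | h
    · exact hAd
    · exact fun h' => hS.A_bar _ h' h
  have hbdc : ¬ (d < b ∧ b ≤ c) := by
    intro h
    rcases hc with h1 | ⟨h1, -, -, -, h2⟩
    · omega
    · have h3 := (hS.A_ne _ h1)
      refine h2 b (Or.inr (Or.inr ⟨Or.inr (Or.inl rfl), ?_, ?_⟩)) ?_ <;> omega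
  have hFdc : ∀ f, F f → ¬ (d < f ∧ f ≤ c) := by
    intro f hf h
    rcases hc with h1 | ⟨h1, -, -, -, h2⟩
    · omega
    · have h3 := (hS.A_F _ h1).2
      rw [bar_bar_nat hcl] at h3
      have : f ≠ c := fun h => h3 (h ▸ hf)
      exact h2 f (Or.inl hf) (by omega)
  have hFdc' : ∀ f, F f → ¬ (2 * n - 1 - c < f ∧ f ≤ 2 * n - 1 - d) := by
    intro f hf h
    have h0 := hS.F_lt f hf
    rcases hc with h1 | ⟨h1, -, -, -, h2⟩
    · omega
    · have h3 := hFd f hf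
      refine h2 (2 * n - 1 - f) (Or.inr (Or.inl ?_)) (by omega)
      rwa [bar_bar_nat h0]
  have hFbd : ∀ f, F f → ¬ Arc b d f := by
    intro f hf
    have h1 := hd.2 f hf
    have h2 := hFd f hf
    have h3 := hS.F_ne f hf
    unfold Cyc at h1
    unfold Arc
    omega
  have hexc : ¬ exchange n A d c c := by
    rintro (⟨-, h⟩ | ⟨-, ⟨h, -⟩ | h⟩)
    · exact hcA' h
    · exact hcA' h
    · omega
  have hbar : ¬ R (2 * n - 1 - c) := fun h => hbarF c (Or.inr rfl) ⟨h, by omega⟩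
  have hc1 := (hG.not_sink hcl (hF _ (Or.inr rfl)) hexc).2
  refine ⟨?_, ?_, fun x => G x + (ind (Arc b d x) + ind (d < x ∧ x ≤ c) +
    ind (2 * n - 1 - c < x ∧ x ≤ 2 * n - 1 - d)), hG.add ?_ ?_, ?_, ?_, ?_⟩
  · intro x hx h1 h2
    by_cases hxc : x = c
    · subst hxc; exact hbar h2
    by_cases hxc' : 2 * n - 1 - x = c
    · apply hbar; rw [← hxc']; rwa [bar_bar_nat hx]
    · exact hp x hx ⟨h1, hxc⟩ ⟨h2, hxc'⟩
  · intro f hf hR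
    by_cases hfc : 2 * n - 1 - f = c
    · have h0 := hS.F_lt f hf
      have h1 : f = 2 * n - 1 - c := by omega
      rcases hcA with h2 | h2
      · exact (hFd f hf).2 (by omega)
      · exact (hS.A_F _ h2).1 (h1 ▸ hf)
    · exact hbarF f (Or.inl hf) ⟨hR, hfc⟩
  · have : ind (Arc b d (2 * n)) = ind (Arc b d 0) := by
      congr 1
      unfold Arc
      apply propext; omega
    have k1 : ind (d < 2 * n ∧ 2 * n ≤ c) = 0 := ind_neg (by omega)
    have k2 : ind (2 * n - 1 - c < 2 * n ∧ 2 * n ≤ 2 * n - 1 - d) = 0 := ind_neg (by omega)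
    have k3 : ind (d < 0 ∧ 0 ≤ c) = 0 := ind_neg (by omega)
    have k4 : ind (2 * n - 1 - c < 0 ∧ 0 ≤ 2 * n - 1 - d) = 0 := ind_neg (by omega)
    rw [this, k1, k2, k3, k4]
  · intro x hx
    have e1 := ind_exchange hAd' hcA x
    have e2 := ind_and_ne hRc x
    have e3 : ind (A x ∨ x = b) = ind (A x) + ind (x = b) :=
      ind_or fun h h' => hAb' (h' ▸ h)
    have e4 : ind (d < x + 1 ∧ x + 1 ≤ c) + ind (x = c) = ind (d < x ∧ x ≤ c) + ind (x = d) := by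
      unfold ind; split_ifs <;> omega
    have e5 : ind (2 * n - 1 - c < x + 1 ∧ x + 1 ≤ 2 * n - 1 - d) + ind (x = 2 * n - 1 - d) =
        ind (2 * n - 1 - c < x ∧ x ≤ 2 * n - 1 - d) + ind (x = 2 * n - 1 - c) := by
      unfold ind; split_ifs <;> omega
    have e6 := ind_arc_succ b d x
    omega
  · intro f hf
    simp only [hF f (Or.inl hf)]
    rw [ind_neg (hFbd f hf), ind_neg (hFdc f hf), ind_neg (hFdc' f hf)]
  · simp only [hc1]
    rw [ind_neg (by unfold Arc; omega), ind_neg (by omega), ind_neg (by omega)]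
  · intro e he h
    simp only
    by_cases h1 : Arc b d e
    · rw [ind_pos h1]; omega
    · rw [ind_pos (show d < e ∧ e ≤ c by unfold Arc at *; omega)]; omega

/-- The unique flow determines `c` as its first zero cyclically after `b`. Of two different
intermediate letters below `c`, the higher one would be free for the lower one and would be skipped
by its step. -/
theorem critL_step_unique (hS : LetterSplit n b A F O) {d c d' c' : ℕ}
    (hd : OuterReach F O n b d) (hc : StepTo n d A (freeAfter n b F O d) c) (hRc : R c)
    (h : CritL n (exchange n A d c) (fun y => F y ∨ y = c) (fun y => R y ∧ y ≠ c))
    (hd' : OuterReach F O n b d') (hc' : StepTo n d' A (freeAfter n b F O d') c') (hRc' : R c')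
    (h' : CritL n (exchange n A d' c') (fun y => F y ∨ y = c') (fun y => R y ∧ y ≠ c')) :
    d = d' ∧ c = c' := by
  obtain ⟨-, -, G, h1, -, h3, h4⟩ := critL_of_step hS hd hc hRc h
  obtain ⟨-, -, G', k1, -, k3, k4⟩ := critL_of_step hS hd' hc' hRc' h'
  have hb := hS.b_lt
  have hlt : ∀ d c, OuterReach F O n b d → StepTo n d A (freeAfter n b F O d) c →
      c < 2 * n ∧ d < 2 * n := by
    intro d c hd hc
    have hdl : d < 2 * n := by
      rcases hd.1 with h | h | h
      · omega
      · omega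
      · exact hS.O_lt _ h
    rcases hc with rfl | h
    · exact ⟨hdl, hdl⟩
    · exact ⟨h.2.1, hdl⟩
  have l1 := hlt d c hd hc
  have l2 := hlt d' c' hd' hc'
  have hu := h1.unique k1 ⟨c + 1, by omega, h3⟩ ⟨c' + 1, by omega, k3⟩
  have hcc : c = c' := by
    by_contra hne
    have e1 : ¬ Arc b c' (c + 1) := fun h => by
      have := k4 (c + 1) (by omega) h
      rw [← hu _ (by omega)] at this
      omega
    have e2 : ¬ Arc b c (c' + 1) := fun h => by
      have := h4 (c' + 1) (by omega) h
      rw [hu _ (by omega)] at this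
      omega
    unfold Arc at e1 e2
    omega
  refine ⟨?_, hcc⟩
  subst hcc
  have hPA : ∀ d, OuterReach F O n b d → ¬ A (2 * n - 1 - d) := by
    intro d hd h
    have h1 := hS.A_ne _ h
    rcases hd.1 with h' | h' | h'
    · omega
    · omega
    · exact hS.A_O _ h (hS.O_bar _ h')
  have hfree : ∀ d d', OuterReach F O n b d' → d' ≠ d → d' ≠ 2 * n - 1 - d →
      freeAfter n b F O d d' := by
    intro d d' hd' h1 h2
    refine Or.inr (Or.inr ⟨?_, h1, h2⟩)
    have := hd'.1
    tauto
  rcases hc with rfl | ⟨e1, e2, e3, e4, e5⟩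
  · rcases hc' with h5 | ⟨h5, -⟩
    · exact h5
    · exact absurd h5 (hPA _ hd)
  · rcases hc' with rfl | ⟨f1, f2, f3, f4, f5⟩
    · exact absurd e1 (hPA _ hd')
    · by_contra hne
      rcases lt_or_gt_of_ne hne with h | h
      · exact e5 d' (hfree d d' hd' (by omega) (by omega)) ⟨h, f3⟩
      · exact f5 d (hfree d' d hd (by omega) (by omega)) ⟨h, e3⟩

/-- The part of `Flow.symm` that survives here. Away from free letters, each pair `x`, `x̄` has at
least as many sources as sinks, so `G x - G (2 n - x)` cannot decrease; pairs with a frozen letter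
have no sinks at all. -/
theorem Flow.antisymm_mono {G : ℕ → ℕ} (hS : LetterSplit n b A F O) (hR : NoPair n R)
    (hRF : ∀ f, F f → ¬ R (2 * n - 1 - f))
    (hG : Flow n (fun y => A y ∨ y = b) R G) (hF : ∀ f, F f → G f = 0) {s t : ℕ} (hst : s ≤ t)
    (ht : t ≤ 2 * n) (hO : ∀ y, s ≤ y → y < t → ¬ O y) :
    G s + G (2 * n - t) ≤ G t + G (2 * n - s) := by
  have hb := hS.b_lt
  induction t, hst using Nat.le_induction with
  | base => omega
  | succ x hsx ih =>
    have ih := ih (by omega) (fun y h1 h2 => hO y h1 (by omega))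
    have hx : x < 2 * n := by omega
    have hOx := hO x hsx (by omega)
    have h1 : G (x + 1) + ind (R x) = G x + ind (A x ∨ x = b) := hG.1 x hx
    have h2 : G (2 * n - 1 - x + 1) + ind (R (2 * n - 1 - x)) = G (2 * n - 1 - x) +
      ind (A (2 * n - 1 - x) ∨ 2 * n - 1 - x = b) := hG.1 (2 * n - 1 - x) (by omega)
    rw [show 2 * n - 1 - x + 1 = 2 * n - x by omega] at h2
    rw [show 2 * n - (x + 1) = 2 * n - 1 - x by omega]
    have hFR : ∀ f, F f → ¬ R f := fun f hf => (hG.not_sink (hS.F_lt f hf) (hF f hf) (by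
      rintro (h | h)
      · exact (hS.A_F _ h).1 hf
      · exact (hS.F_ne _ hf).1 h)).1
    have h3 : ind (R x) + ind (R (2 * n - 1 - x)) ≤
        ind (A x ∨ x = b) + ind (A (2 * n - 1 - x) ∨ 2 * n - 1 - x = b) := by
      by_cases hFx : F x
      · rw [ind_neg (hFR x hFx), ind_neg (hRF x hFx)]; omega
      by_cases hFx' : F (2 * n - 1 - x)
      · have := hRF _ hFx'
        rw [bar_bar_nat hx] at this
        rw [ind_neg (hFR _ hFx'), ind_neg this]; omega
      have h4 : ind (R x) + ind (R (2 * n - 1 - x)) ≤ 1 := by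
        by_cases h : R x
        · rw [ind_pos h, ind_neg (hR x hx h)]
        · rw [ind_neg h]; have := ind_le_one (R (2 * n - 1 - x)); omega
      have h5 : (A x ∨ x = b) ∨ (A (2 * n - 1 - x) ∨ 2 * n - 1 - x = b) := by
        rcases hS.cover x hx with h | h | h | h | h | h | h
        · exact Or.inl (Or.inl h)
        · exact Or.inr (Or.inl h)
        · exact Or.inl (Or.inr h)
        · exact Or.inr (Or.inr (by omega))
        · exact absurd h hFx
        · exact absurd h hFx'
        · exact absurd h hOx
      rcases h5 with h5 | h5
      · rw [ind_pos h5]; omega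
      · rw [ind_pos h5]; omega
    omega

/-- This isolates the removal of the three paths. Once `c` is the first zero after `b` and `d` is
admissible, all that is needed is that the mirror path carries enough flow, counted twice where it
overlaps the arc from `b` to `c`. -/
theorem critL_step_of_flow {G : ℕ → ℕ} {c d : ℕ} (hS : LetterSplit n b A F O) (hp : NoPair n R)
    (hRF : ∀ f, F f → ¬ R (2 * n - 1 - f)) (hG : Flow n (fun y => A y ∨ y = b) R G)
    (hF : ∀ f, F f → G f = 0) (hcl : c < 2 * n) (hpos : ∀ e ≤ 2 * n, Arc b c e → 1 ≤ G e)
    (hRc : R c) (hGc : G c = ind (c ≠ b)) (hd : d = b ∨ d = 2 * n - 1 - b ∨ O d) (hdc : d ≤ c)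
    (hhalf : n ≤ d ∨ c < n) (hcA : c = d ∨ A (2 * n - 1 - c))
    (hfree : ∀ y, freeAfter n b F O d y → ¬ (d < y ∧ y < c)) (hbdc : ¬ (d < b ∧ b ≤ c))
    (hge : ∀ e, 2 * n - 1 - c < e → e ≤ 2 * n - 1 - d → 1 + ind (Arc b c e) ≤ G e) :
    ∃ d, OuterReach F O n b d ∧ ∃ c, StepTo n d A (freeAfter n b F O d) c ∧ R c ∧
      CritL n (exchange n A d c) (fun y => F y ∨ y = c) (fun y => R y ∧ y ≠ c) := by
  have hb := hS.b_lt
  have hAb' : ¬ A b := fun h => (hS.A_ne _ h).1 rfl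
  have hd2 : d < 2 * n := by omega
  have hArc : c ≠ b → Arc b c c := fun h => by unfold Arc; omega
  have hFarc : ∀ f, F f → ¬ Arc b c f := fun f hf h => by
    have := hpos f (hS.F_lt f hf).le h
    have := hF f hf
    omega
  have hnp : NoPair n (fun y => R y ∧ y ≠ c) := fun x hx h1 h2 => hp x hx h1.1 h2.1
  have hbarF : ∀ f, F f ∨ f = c → ¬ (R (2 * n - 1 - f) ∧ 2 * n - 1 - f ≠ c) := by
    rintro f (hf | rfl) h
    · exact hRF f hf h.1
    · exact hp f hcl hRc h.1
  have hdA : ¬ A (2 * n - 1 - d) := by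
    intro h
    have h1 := hS.A_ne _ h
    rcases hd with h' | h' | h'
    · omega
    · omega
    · exact hS.A_O _ h (hS.O_bar _ h')
  have hK : ∀ x, ind (Arc b d x) + ind (d < x ∧ x ≤ c) = ind (Arc b c x) := by
    intro x
    unfold ind Arc
    split_ifs <;> omega
  refine ⟨d, ⟨hd, fun f hf h => hFarc f hf ?_⟩, c, ?_, hRc, hnp, hbarF,
    fun x => G x - (ind (Arc b d x) + ind (d < x ∧ x ≤ c) +
      ind (2 * n - 1 - c < x ∧ x ≤ 2 * n - 1 - d)), hG.sub ?_ ?_ ?_, ?_, ?_⟩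
  · unfold Cyc at h; unfold Arc; omega
  · rcases hcA with h | h
    · exact Or.inl h
    · by_cases hcd : c = d
      · exact Or.inl hcd
      · exact Or.inr ⟨h, hcl, by omega, hhalf, hfree⟩
  · intro x hx
    rw [hK]
    by_cases h2 : 2 * n - 1 - c < x ∧ x ≤ 2 * n - 1 - d
    · rw [ind_pos h2]
      have := hge x h2.1 h2.2
      omega
    · rw [ind_neg h2]
      by_cases h1 : Arc b c x
      · rw [ind_pos h1]; exact hpos x hx h1
      · rw [ind_neg h1]; omega
  · rw [hK, hK]
    have : ind (Arc b c (2 * n)) = ind (Arc b c 0) := by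
      congr 1
      unfold Arc
      apply propext; omega
    have k2 : ind (2 * n - 1 - c < 2 * n ∧ 2 * n ≤ 2 * n - 1 - d) = 0 := ind_neg (by omega)
    have k4 : ind (2 * n - 1 - c < 0 ∧ 0 ≤ 2 * n - 1 - d) = 0 := ind_neg (by omega)
    rw [this, k2, k4]
  · intro x hx
    have e1 := ind_exchange (hdA) hcA x
    have e2 := ind_and_ne hRc x
    have e3 : ind (A x ∨ x = b) = ind (A x) + ind (x = b) :=
      ind_or fun h h' => hAb' (h' ▸ h)
    have e4 : ind (d < x + 1 ∧ x + 1 ≤ c) + ind (x = c) =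
        ind (d < x ∧ x ≤ c) + ind (x = d) := by
      unfold ind; split_ifs <;> omega
    have e5 : ind (2 * n - 1 - c < x + 1 ∧ x + 1 ≤ 2 * n - 1 - d) + ind (x = 2 * n - 1 - d) =
        ind (2 * n - 1 - c < x ∧ x ≤ 2 * n - 1 - d) + ind (x = 2 * n - 1 - c) := by
      unfold ind; split_ifs <;> omega
    have e6 := ind_arc_succ b d x
    omega
  · refine ⟨c, hcl.le, ?_⟩
    simp only [hK, hGc]
    by_cases h : c ≠ b
    · rw [ind_pos h, ind_pos (hArc h)]; omega
    · rw [ind_neg h]; omega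
  · rintro y (hy | rfl)
    · simp only [hF y hy]; omega
    · simp only [hK, hGc]
      by_cases h : y ≠ b
      · rw [ind_pos h, ind_pos (hArc h)]; omega
      · rw [ind_neg h]; omega

theorem arc_of_mem {b c d y : ℕ} (h : ¬ (d < b ∧ b ≤ c)) (h1 : d < y) (h2 : y ≤ c) : Arc b c y := by
  unfold Arc; omega

theorem arc_bar {n b c d e : ℕ} (h : ¬ (d < 2 * n - 1 - b ∧ 2 * n - 1 - b ≤ c))
    (hb : b < 2 * n) (hc : c < 2 * n) (hd : d < c) (hcb : 2 * n - 1 - c ≠ b)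
    (h1 : 2 * n - 1 - c < e) (h2 : e ≤ 2 * n - 1 - d) (h3 : Arc b c e) :
    Arc b c (2 * n - 1 - c) := by
  unfold Arc at h3 ⊢; omega

/-- From a flow, `c` is read off as its first zero cyclically after `b`. The letter `d` is `c`
itself if `c` is free, `b` or `b̄`; otherwise it is the greatest such letter below `c` in the same
half. Its existence and the flow on the mirror path both follow from `Flow.antisymm_mono`. -/
theorem critL_iff (hS : LetterSplit n b A F O) :
    CritL n (fun y => A y ∨ y = b) F R ↔ ∃ d, OuterReach F O n b d ∧ ∃ c,
      StepTo n d A (freeAfter n b F O d) c ∧ R c ∧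
      CritL n (exchange n A d c) (fun y => F y ∨ y = c) (fun y => R y ∧ y ≠ c) := by
  have hb := hS.b_lt
  constructor
  swap
  · rintro ⟨d, h0, c, h1, h2, h3⟩
    obtain ⟨h4, h5, G, h6, h7, h8, -⟩ := critL_of_step hS h0 h1 h2 h3
    have hcl : c + 1 ≤ 2 * n := by
      rcases h1 with rfl | h
      · rcases h0.1 with h | h | h
        · omega
        · omega
        · exact hS.O_lt _ h
      · exact h.2.1
    exact ⟨h4, h5, G, h6, ⟨c + 1, hcl, h8⟩, h7⟩
  rintro ⟨hp, hRF, G, hG, ⟨z, hz, hz0⟩, hF⟩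
  have hAb : ¬ A (2 * n - 1 - b) := fun h => (hS.A_ne _ h).2 rfl
  have hAb' : ¬ A b := fun h => (hS.A_ne _ h).1 rfl
  have h2n := hG.2
  -- The zero is sought first from `b` to the end of the alphabet; if there is none, the search
  -- wraps around to the beginning.
  obtain ⟨c, hcl, hc1, hpos⟩ : ∃ c < 2 * n, G (c + 1) = 0 ∧
      ∀ e ≤ 2 * n, Arc b c e → 1 ≤ G e := by
    classical
    by_cases hex : ∃ x, b ≤ x ∧ x < 2 * n ∧ G (x + 1) = 0
    · obtain ⟨h1, h2, h3⟩ := Nat.find_spec hex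
      refine ⟨Nat.find hex, h2, h3, fun e he h => ?_⟩
      unfold Arc at h
      have := Nat.find_min hex (m := e - 1) (by omega)
      by_contra h4
      refine this ⟨by omega, by omega, ?_⟩
      rw [show e - 1 + 1 = e by omega]; omega
    · have hex2 : ∃ x, x < 2 * n ∧ G (x + 1) = 0 := by
        by_cases hz' : z = 0
        · subst hz'
          exact ⟨2 * n - 1, by omega, by rw [show 2 * n - 1 + 1 = 2 * n by omega]; omega⟩
        · exact ⟨z - 1, by omega, by rwa [show z - 1 + 1 = z by omega]⟩
      obtain ⟨h2, h3⟩ := Nat.find_spec hex2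
      set c := Nat.find hex2 with hc
      have hcb : c < b := by
        by_contra h
        exact hex ⟨c, by omega, h2, h3⟩
      have h5 : ∀ e, b < e → e ≤ 2 * n → 1 ≤ G e := by
        intro e h6 h7
        by_contra h8
        refine hex ⟨e - 1, by omega, by omega, ?_⟩
        rw [show e - 1 + 1 = e by omega]; omega
      refine ⟨c, h2, h3, fun e he h => ?_⟩
      unfold Arc at h
      by_cases he0 : e = 0
      · have := h5 (2 * n) hb le_rfl
        rw [he0]; omega
      by_cases hbe : b < e
      · exact h5 e hbe he
      · have := Nat.find_min hex2 (m := e - 1) (by omega)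
        by_contra h4
        refine this ⟨by omega, ?_⟩
        rw [show e - 1 + 1 = e by omega]; omega
  have hflow : G (c + 1) + ind (R c) = G c + ind (A c ∨ c = b) := hG.1 c hcl
  have hArc : c ≠ b → Arc b c c := fun h => by unfold Arc; omega
  have hRc : R c ∧ G c = ind (c ≠ b) ∧ (c ≠ b → ¬ A c) := by
    by_cases hcb : c = b
    · rw [hcb] at hflow hc1 ⊢
      rw [ind_pos (Or.inr rfl), hc1] at hflow
      by_cases h : R b
      · rw [ind_pos h] at hflow
        refine ⟨h, ?_, fun h => absurd rfl h⟩
        rw [ind_neg (by simp)]; omega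
      · rw [ind_neg h] at hflow; omega
    · have h1 := hpos c (by omega) (hArc hcb)
      by_cases h : R c
      · rw [ind_pos h, hc1] at hflow
        refine ⟨h, ?_, fun _ hA => ?_⟩
        · rw [ind_pos hcb]; omega
        · rw [ind_pos (Or.inl hA)] at hflow; omega
      · rw [ind_neg h] at hflow; omega
  obtain ⟨hRc, hGc, hAc⟩ := hRc
  have hFarc : ∀ f, F f → ¬ Arc b c f := fun f hf h => by
    have := hpos f (hS.F_lt f hf).le h
    have := hF f hf
    omega
  have hF1 : ∀ f, F f → ¬ R f ∧ G (f + 1) = 0 := fun f hf =>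
    hG.not_sink (hS.F_lt f hf) (hF f hf) (by
      rintro (h | h)
      · exact (hS.A_F _ h).1 hf
      · exact (hS.F_ne _ hf).1 h)
  have hFc : ¬ F c := fun h => (hF1 c h).1 hRc
  have hFc' : ¬ F (2 * n - 1 - c) := fun h => by
    have := hRF _ h
    rw [bar_bar_nat hcl] at this
    exact this hRc
  -- Here the cyclic move alone reaches `c`, and the inner step is trivial.
  by_cases hcP : c = b ∨ c = 2 * n - 1 - b ∨ O c
  · exact critL_step_of_flow hS hp hRF hG hF hcl hpos hRc hGc hcP le_rfl (by omega) (Or.inl rfl)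
      (fun y _ => by omega) (by omega) (fun e => by omega)
  have hcA : A (2 * n - 1 - c) := by
    rcases hS.cover c hcl with h | h | h | h | h | h | h
    · exact absurd h (hAc fun h => hcP (Or.inl h))
    · exact h
    · exact absurd (Or.inl h) hcP
    · exact absurd (Or.inr (Or.inl h)) hcP
    · exact absurd h hFc
    · exact absurd h hFc'
    · exact absurd (Or.inr (Or.inr h)) hcP
  have hcb : c ≠ b := fun h => hcP (Or.inl h)
  have hcb' : 2 * n - 1 - c ≠ b := fun h => hcP (Or.inr (Or.inl (by omega)))
  have hmono : ∀ s, s ≤ c → (∀ y, s ≤ y → y < c → ¬ O y) →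
      G s + G (2 * n - 1 - c) ≤ G (2 * n - s) := by
    intro s hs hO
    have := hG.antisymm_mono hS hp hRF hF (s := s) (t := c + 1) (by omega) (by omega) (by
      intro y h1 h2 h3
      rcases Nat.lt_succ_iff_lt_or_eq.1 h2 with h4 | rfl
      · exact hO y h1 h4 h3
      · exact hcP (Or.inr (Or.inr h3)))
    rw [hc1, show 2 * n - (c + 1) = 2 * n - 1 - c by omega] at this
    omega
  -- Without a candidate, `Flow.antisymm_mono` applies from the start of the half up to `c` and
  -- forces zero flow into `c̄`, although `c̄` lies on the arc from `b` to `c`.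
  have hexd : ∃ y < c, (y = b ∨ y = 2 * n - 1 - b ∨ O y) ∧ (n ≤ y ∨ c < n) := by
    by_contra hno
    push Not at hno
    have hno' : ∀ y < c, (n ≤ y ∨ c < n) → ¬ (y = b ∨ y = 2 * n - 1 - b ∨ O y) := by
      intro y h1 h2 h3
      have := hno y h1 h3
      omega
    have hb1 := hno' b
    have hb2 := hno' (2 * n - 1 - b)
    have hb3 : ¬ (b < c ∧ (n ≤ b ∨ c < n)) := fun h => hb1 h.1 h.2 (Or.inl rfl)
    have hb4 : ¬ (2 * n - 1 - b < c ∧ (n ≤ 2 * n - 1 - b ∨ c < n)) :=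
      fun h => hb2 h.1 h.2 (Or.inr (Or.inl rfl))
    have h1 := hpos (2 * n - 1 - c) (by omega) (by unfold Arc; omega)
    by_cases hcn : c < n
    · have := hmono 0 (by omega) fun y _ h3 h4 =>
        hno' y h3 (Or.inr hcn) (Or.inr (Or.inr h4))
      rw [Nat.sub_zero] at this
      omega
    · have := hmono n (by omega) fun y h2 h3 h4 =>
        hno' y h3 (Or.inl h2) (Or.inr (Or.inr h4))
      rw [show 2 * n - n = n by omega] at this
      omega
  obtain ⟨d, hdc, ⟨hd, hhalf⟩, hmax⟩ := exists_greatest_lt hexd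
  have hmax' : ∀ y, d < y → y < c → ¬ (y = b ∨ y = 2 * n - 1 - b ∨ O y) := by
    intro y h1 h2 h3
    exact hmax y h1 h2 ⟨h3, by omega⟩
  have hbd : ¬ (d < b ∧ b ≤ c) := by
    intro h
    exact hmax' b h.1 (by omega) (Or.inl rfl)
  have hbd' : ¬ (d < 2 * n - 1 - b ∧ 2 * n - 1 - b ≤ c) := by
    intro h
    exact hmax' _ h.1 (by omega) (Or.inr (Or.inl rfl))
  have hmono' : ∀ s, d < s → s ≤ c → G s + G (2 * n - 1 - c) ≤ G (2 * n - s) := fun s h1 h2 =>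
    hmono s h2 fun y h3 h4 h5 => hmax' y (by omega) h4 (Or.inr (Or.inr h5))
  refine critL_step_of_flow hS hp hRF hG hF hcl hpos hRc hGc hd hdc.le hhalf (Or.inr hcA) ?_ hbd ?_
  · rintro y (hy | hy | ⟨hy, -⟩) h
    · exact hFarc y hy (arc_of_mem hbd h.1 h.2.le)
    · have h1 := hmono' y h.1 h.2.le
      have h2 := (hF1 _ hy).2
      have h3 := hpos y (h.2.le.trans hcl.le) (arc_of_mem hbd h.1 h.2.le)
      rw [show 2 * n - 1 - y + 1 = 2 * n - y by omega] at h2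
      omega
    · exact hmax' y h.1 h.2 (hy.elim (fun h => Or.inr (Or.inr h)) (Or.imp_right Or.inl))
  -- The flow at `e` is at least the flow at `2 n - e`, which is positive, plus the flow at `c̄`,
  -- which is positive whenever the two paths overlap.
  · intro e h1 h2
    have hd2 : d < 2 * n := by omega
    have h3 := hmono' (2 * n - e) (by omega) (by omega)
    rw [show 2 * n - (2 * n - e) = e by omega] at h3
    have h4 := hpos (2 * n - e) (by omega) (arc_of_mem hbd (by omega) (by omega))
    by_cases h5 : Arc b c e
    · have h6 := hpos (2 * n - 1 - c) (by omega) (arc_bar hbd' hb hcl hdc hcb' h1 h2 h5)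
      rw [ind_pos h5]; omega
    · rw [ind_neg h5]; omega
end


/-! ### Counting walks along `Γ_r` and `Γ_l` -/

/-- The chain `Γ_r(k)`, read backwards. -/
def rootsR (n k : ℕ) : List (Letter n × Letter n) := (gammaR n k).reverse

/-- The part `Γ_{k1} ⋯ Γ_{ki}` of the chain `Γ_l(k)`, read backwards. -/
def rootsL (n k i : ℕ) : List (Letter n × Letter n) :=
  (((List.finRange n).filter (fun p => p.val < i)).flatMap (gammaKSeg k)).reverse

theorem reverse_gammaSeg {n : ℕ} (i : Fin n) : (gammaSeg i).reverse = innerRoots i i.val := rfl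

theorem reverse_gammaKSeg {n : ℕ} (k : ℕ) (i : Fin n) :
    (gammaKSeg k i).reverse = outerRoots i k ++ innerRoots i i.val := by
  simp [gammaKSeg, outerRoots, outer, reverse_gammaSeg, List.map_reverse]

theorem rootsR_zero (n : ℕ) : rootsR n 0 = [] := by simp [rootsR, gammaR]

theorem rootsL_zero (n k : ℕ) : rootsL n k 0 = [] := by simp [rootsL]

theorem rootsR_succ {n : ℕ} (i : Fin n) :
    rootsR n (i.val + 1) = innerRoots i i.val ++ rootsR n i.val := by
  rw [rootsR, gammaR, filter_lt_finRange_succ i]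
  simp [rootsR, gammaR, reverse_gammaSeg]

theorem rootsL_succ {n : ℕ} (k : ℕ) (i : Fin n) :
    rootsL n k (i.val + 1) = outerRoots i k ++ (innerRoots i i.val ++ rootsL n k i.val) := by
  rw [rootsL, filter_lt_finRange_succ i]
  simp [rootsL, reverse_gammaKSeg]

theorem reverse_gamma (n k : ℕ) : (gamma n k).reverse = rootsL n k k ++ rootsR n k := by
  rw [gamma, List.reverse_append, rootsR, rootsL, gammaL]

theorem value_eq_of_walk_rootsR {n i : ℕ} {w x : SignedPerm n} (h : Walk (rootsR n i) w x) {l : ℕ}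
    (h1 : i ≤ l) (h2 : l < 2 * n - i) : value x l = value w l := by
  refine h.value_eq fun r hr => ?_
  simp only [rootsR, gammaR, gammaSeg, List.mem_reverse, List.mem_flatMap, List.mem_filter,
    List.mem_finRange, true_and, decide_eq_true_eq, List.mem_map] at hr
  obtain ⟨j, hj, q, hq, rfl⟩ := hr
  have : q.val < j.val := hq
  simp only [val_unb, val_bar]
  omega

theorem value_eq_of_walk_rootsL {n k i : ℕ} {w x : SignedPerm n} (h : Walk (rootsL n k i) w x)
    {l : ℕ} (h1 : i ≤ l) (h2 : l < k) (hk : k ≤ n) : value x l = value w l := by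
  refine h.value_eq fun r hr => ?_
  simp only [rootsL, gammaKSeg, gammaSeg, List.mem_reverse, List.mem_flatMap, List.mem_filter,
    List.mem_finRange, true_and, decide_eq_true_eq, List.mem_map, List.mem_append,
    List.mem_singleton] at hr
  obtain ⟨j, hj, ((⟨q, hq, rfl⟩ | ⟨q, hq, rfl⟩) | rfl) | ⟨q, hq, rfl⟩⟩ := hr
  · have : q.val < j.val := hq
    simp only [val_unb, val_bar]; omega
  · have := q.isLt
    simp only [val_unb, val_bar]; omega
  · simp only [val_unb, val_bar]; omega
  · have := q.isLt
    simp only [val_unb]; omega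

theorem initialValues_succ {n : ℕ} (w : SignedPerm n) (i : ℕ) :
    initialValues w (i + 1) = fun y => initialValues w i y ∨ y = value w i := by
  funext y
  refine propext ⟨?_, ?_⟩
  · rintro ⟨l, hl, rfl⟩
    rcases Nat.lt_succ_iff_lt_or_eq.1 hl with h | rfl
    · exact Or.inl ⟨l, h, rfl⟩
    · exact Or.inr rfl
  · rintro (⟨l, hl, rfl⟩ | rfl)
    · exact ⟨l, by omega, rfl⟩
    · exact ⟨i, by omega, rfl⟩

theorem not_initialValues {n i : ℕ} (w : SignedPerm n) (hi : i < n) {l : ℕ} (h1 : i ≤ l)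
    (h2 : l < 2 * n) : ¬ initialValues w i (value w l) := by
  rintro ⟨q, hq, h⟩
  have := value_inj w (by omega) h2 h
  omega

theorem initialValues_bar {n i : ℕ} (w : SignedPerm n) (hi : i ≤ n) {y : ℕ}
    (h : initialValues w i y) : ¬ initialValues w i (2 * n - 1 - y) := by
  obtain ⟨q, hq, rfl⟩ := h
  rintro ⟨p, hp, h⟩
  rw [← value_bar w (by omega)] at h
  have := value_inj w (by omega) (by omega) h
  omega

theorem letterSplit {n : ℕ} (w : SignedPerm n) {i k : ℕ} (hik : i < k) (hk : k ≤ n) :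
    LetterSplit n (value w i) (initialValues w i) (innerValues w i k) (outerValues w k) where
  b_lt := value_lt w (by omega)
  A_bar := fun y h => initialValues_bar w (by omega) h
  A_ne := by
    rintro y ⟨l, hl, rfl⟩
    exact ⟨value_ne w (by omega) (by omega) (by omega),
      value_ne_bar w (by omega) (by omega) (by omega)⟩
  A_F := by
    rintro y ⟨l, hl, rfl⟩
    constructor
    · rintro ⟨f, h1, h2, h3⟩
      exact value_ne w (p := l) (q := f) (by omega) (by omega) (by omega) h3
    · rintro ⟨f, h1, h2, h3⟩
      exact value_ne_bar w (p := f) (q := l) (by omega) (by omega) (by omega) h3.symm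
  A_O := by
    rintro y ⟨l, hl, rfl⟩ ⟨f, h1, h2, h3⟩
    exact value_ne w (p := l) (q := f) (by omega) (by omega) (by omega) h3
  F_lt := by rintro y ⟨l, h1, h2, rfl⟩; exact value_lt w (by omega)
  F_ne := by
    rintro y ⟨l, h1, h2, rfl⟩
    exact ⟨value_ne w (by omega) (by omega) (by omega),
      value_ne_bar w (by omega) (by omega) (by omega)⟩
  F_O := by
    rintro y ⟨l, h1, h2, rfl⟩ ⟨f, h4, h5, h3⟩
    exact value_ne w (p := l) (q := f) (by omega) (by omega) (by omega) h3
  O_lt := by rintro y ⟨l, h1, h2, rfl⟩; exact value_lt w (by omega)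
  O_bar := by
    rintro y ⟨l, h1, h2, rfl⟩
    exact ⟨2 * n - 1 - l, by omega, by omega, (value_bar w (by omega)).symm⟩
  O_ne := by
    rintro y ⟨l, h1, h2, rfl⟩
    exact ⟨value_ne w (by omega) (by omega) (by omega),
      value_ne_bar w (by omega) (by omega) (by omega)⟩
  cover := by
    intro y hy
    obtain ⟨p, hp, rfl⟩ := value_surj w hy
    by_cases h1 : p < i
    · exact Or.inl ⟨p, h1, rfl⟩
    by_cases h2 : 2 * n - 1 - i < p
    · exact Or.inr (Or.inl ⟨2 * n - 1 - p, by omega, value_bar w hp⟩)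
    by_cases h3 : p = i
    · subst h3; exact Or.inr (Or.inr (Or.inl rfl))
    by_cases h4 : p = 2 * n - 1 - i
    · subst h4; exact Or.inr (Or.inr (Or.inr (Or.inl (value_bar w (by omega)))))
    by_cases h5 : p < k
    · exact Or.inr (Or.inr (Or.inr (Or.inr (Or.inl ⟨p, by omega, h5, rfl⟩))))
    by_cases h6 : 2 * n - 1 - k < p
    · exact Or.inr (Or.inr (Or.inr (Or.inr (Or.inr (Or.inl
        ⟨2 * n - 1 - p, by omega, by omega, (value_bar w hp).symm⟩)))))
    · exact Or.inr (Or.inr (Or.inr (Or.inr (Or.inr (Or.inr ⟨p, by omega, by omega, rfl⟩)))))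

theorem innerValues_self_succ {n : ℕ} (w : SignedPerm n) (i : ℕ) :
    innerValues w i (i + 1) = fun _ => False := by
  funext y
  exact propext ⟨fun ⟨f, h1, h2, _⟩ => by omega, False.elim⟩

theorem letterSplit' {n : ℕ} (w : SignedPerm n) {i : ℕ} (hi : i < n) :
    LetterSplit n (value w i) (initialValues w i) (fun _ => False) (outerValues w (i + 1)) := by
  have := letterSplit w (Nat.lt_succ_self i) hi
  rwa [innerValues_self_succ] at this

theorem innerStep_iff {n : ℕ} (w : SignedPerm n) {i : ℕ} (hi : i < n) (c : ℕ) :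
    InnerStep w i i c ↔ StepTo n (value w i) (initialValues w i) (outerValues w (i + 1)) c := by
  have hb := value_lt w (p := i) (by omega)
  refine or_congr_right ⟨?_, ?_⟩
  · rintro ⟨⟨q, hq, rfl⟩, h2, h3, h4⟩
    have := value_lt w (p := q) (by omega)
    refine ⟨⟨q, hq, by omega⟩, by omega, h2, h3, ?_⟩
    rintro y ⟨l, h5, h6, rfl⟩
    exact h4 l (by omega) (by omega)
  · rintro ⟨⟨q, hq, h1⟩, h2, h3, h4, h5⟩
    refine ⟨⟨q, hq, by omega⟩, h3, h4, fun l h6 h7 h8 => ?_⟩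
    -- Position `ī` carries the bar of the letter at `i`, which cannot lie strictly between two
    -- letters of the same half that start at that letter.
    by_cases h9 : l = 2 * n - 1 - i
    · rw [h9, value_bar w (by omega)] at h8
      omega
    · exact h5 _ ⟨l, by omega, by omega, rfl⟩ h8

theorem initialValues_eq_exchange {n : ℕ} {i : Fin n} {w x : SignedPerm n}
    (h : Walk (innerRoots i i.val) w x) :
    initialValues x i.val = exchange n (initialValues w i.val) (value w i.val) (value x i.val) := by
  have hi := i.isLt
  funext y
  apply propext
  rcases initialValues_of_walk_innerRoots h with ⟨h1, h2⟩ | ⟨h1, h2⟩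
  · rw [h2, exchange, h1]; simp
  · have hne : value x i.val ≠ value w i.val := by
      intro he
      rw [he, ← value_bar w (by omega)] at h1
      exact not_initialValues w hi (by omega) (by omega) h1
    rw [h2, exchange]
    simp [hne]

theorem outerValues_of_walk_innerRoots {n : ℕ} {i : Fin n} {w x : SignedPerm n}
    (h : Walk (innerRoots i i.val) w x) : outerValues x i.val = fun y =>
      outerValues w (i.val + 1) y ∨ y = value x i.val ∨ y = 2 * n - 1 - value x i.val := by
  rw [outerValues_eq x i.isLt]
  have : outerValues x (i.val + 1) = outerValues w (i.val + 1) := by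
    funext y
    refine propext ⟨?_, ?_⟩
    · rintro ⟨l, h1, h2, rfl⟩
      exact ⟨l, h1, h2, value_eq_of_walk_innerRoots h (by omega) (by omega)⟩
    · rintro ⟨l, h1, h2, rfl⟩
      exact ⟨l, h1, h2, (value_eq_of_walk_innerRoots h (by omega) (by omega)).symm⟩
  rw [this]

open Classical in
theorem cnt_initialValues_succ {n i : ℕ} {Γ : List (Letter n × Letter n)} {x : SignedPerm n}
    {R : ℕ → Prop} {C : Prop} (hi : i < n) (hΓ : ∀ z, Walk Γ x z → value z i = value x i)
    (h : cnt Γ x (fun z => ∀ y, initialValues z i y ↔ (R y ∧ y ≠ value x i)) =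
      if C then 1 else 0) :
    cnt Γ x (fun z => ∀ y, initialValues z (i + 1) y ↔ R y) =
      if R (value x i) ∧ C then 1 else 0 := by
  by_cases hR : R (value x i)
  · rw [cnt_congr (T' := fun z => ∀ y, initialValues z i y ↔ (R y ∧ y ≠ value x i)), h]
    · simp [hR]
    · intro z hz
      have hv := hΓ z hz
      refine forall_congr' fun y => ?_
      rw [initialValues_succ, hv]
      by_cases hy : y = value x i
      · subst hy
        have : ¬ initialValues z i (value x i) := hv ▸ not_initialValues z hi le_rfl (by omega)
        simp [hR, this]
      · simp [hy]
  · rw [if_neg (fun h => hR h.1), cnt_eq_zero]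
    intro z hz hT
    refine hR ((hT _).1 ⟨i, by omega, hΓ z hz⟩)

open Classical in
-- The first factor settles position `i`; the remaining ones do not touch it, so its letter can be
-- removed from the target. The recursion for the count is then `critR_iff`, with
-- `critR_step_unique` excluding a second choice.
theorem cnt_rootsR {n : ℕ} (i : ℕ) (hi : i ≤ n) : ∀ (w : SignedPerm n) (R : ℕ → Prop),
    (∀ y, R y → y < 2 * n) → cnt (rootsR n i) w (fun x => ∀ y, initialValues x i y ↔ R y) =
      if CritR n (initialValues w i) (outerValues w i) R then 1 else 0 := by
  induction i with
  | zero =>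
    intro w R hR
    rw [rootsR_zero, cnt]
    congr 1
    have hA : ∀ y, ¬ initialValues w 0 y := by rintro y ⟨l, hl, -⟩; omega
    refine propext ⟨fun h => ?_, ?_⟩
    · have hR : ∀ y, ¬ R y := fun y hy => hA y ((h y).2 hy)
      refine ⟨fun x _ h => absurd h (hR x), fun _ => 0, ⟨fun x _ => ?_, rfl⟩, rfl, rfl,
        fun _ _ => rfl⟩
      rw [ind_neg (hR x), ind_neg (hA x)]
    · rintro ⟨-, G, h1, -, -, h2⟩ y
      refine ⟨fun h => absurd h (hA y), fun h => absurd h ?_⟩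
      have hy := hR y h
      obtain ⟨p, hp, rfl⟩ := value_surj w hy
      exact (h1.not_sink hy (h2 _ ⟨p, by omega, by omega, rfl⟩) (hA _)).1
  | succ i ih =>
    intro w R hR
    have hi' : i < n := hi
    have hS := letterSplit' w hi'
    rw [show i + 1 = (⟨i, hi'⟩ : Fin n).val + 1 from rfl, rootsR_succ, cnt_append (C := fun x =>
      R (value x i) ∧ CritR n (initialValues x i) (outerValues x i)
        (fun y => R y ∧ y ≠ value x i))]
    · rw [cnt_of_values (fun x => value x i)
        (InnerStep w i i) (fun c => R c ∧ CritR n (exchange n (initialValues w i) (value w i) c)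
          (fun y => outerValues w (i + 1) y ∨ y = c ∨ y = 2 * n - 1 - c) (fun y => R y ∧ y ≠ c))
        (cnt_innerRoots ⟨i, hi'⟩ i le_rfl w)]
      · simp only [innerStep_iff w hi']
        rw [← critR_iff hS, ← initialValues_succ]
      · intro x hx _
        have h1 := initialValues_eq_exchange hx
        have h2 := outerValues_of_walk_innerRoots hx
        simp only at h1 h2
        rw [h1, h2]
      · intro c c' h1 h2 h3 h4
        rw [innerStep_iff w hi'] at h1 h3
        exact critR_step_unique hS h1 h2.1 h2.2 h3 h4.1 h4.2
    · intro x _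
      refine (cnt_initialValues_succ hi' (fun z hz => ?_)
        (ih hi'.le x _ fun y hy => hR y hy.1)).trans (by congr)
      exact value_eq_of_walk_rootsR hz le_rfl (by omega)

/-- The values at the positions from `i` to `k - 1`. -/
def frozenValues {n : ℕ} (w : SignedPerm n) (i k y : ℕ) : Prop :=
  ∃ f, i ≤ f ∧ f < k ∧ y = value w f

theorem frozenValues_eq {n : ℕ} (w : SignedPerm n) {i k : ℕ} (h : i < k) :
    frozenValues w i k = fun y => innerValues w i k y ∨ y = value w i := by
  funext y
  refine propext ⟨?_, ?_⟩
  · rintro ⟨f, h1, h2, rfl⟩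
    rcases Nat.eq_or_lt_of_le h1 with rfl | h1
    · exact Or.inr rfl
    · exact Or.inl ⟨f, h1, h2, rfl⟩
  · rintro (⟨f, h1, h2, rfl⟩ | rfl)
    · exact ⟨f, h1.le, h2, rfl⟩
    · exact ⟨i, le_rfl, h, rfl⟩

theorem initialValues_congr {n i : ℕ} {w x : SignedPerm n}
    (h : ∀ l < i, value x l = value w l) : initialValues x i = initialValues w i := by
  funext y
  refine propext ⟨?_, ?_⟩
  · rintro ⟨l, hl, rfl⟩; exact ⟨l, hl, (h l hl).symm⟩
  · rintro ⟨l, hl, rfl⟩; exact ⟨l, hl, h l hl⟩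

theorem innerValues_congr {n i k : ℕ} {w x : SignedPerm n}
    (h : ∀ l, i < l → l < k → value x l = value w l) : innerValues x i k = innerValues w i k := by
  funext y
  refine propext ⟨?_, ?_⟩
  · rintro ⟨l, h1, h2, rfl⟩; exact ⟨l, h1, h2, h l h1 h2⟩
  · rintro ⟨l, h1, h2, rfl⟩; exact ⟨l, h1, h2, (h l h1 h2).symm⟩

/-- The labels of the outer move permute the letters at `i`, at the outer positions and at their
mirror images. Hence the letters beyond `i` afterwards depend on the walk only through the final
letter at `i`. -/
theorem outerValues_of_walk_outerRoots {n k : ℕ} {i : Fin n} {w x : SignedPerm n} (hik : i.val < k)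
    (hk : k ≤ n) (h : Walk (outerRoots i k) w x) {z : ℕ} (hzl : z < 2 * n) :
    outerValues x (i.val + 1) z ↔
      freeAfter n (value w i.val) (innerValues w i.val k) (outerValues w k) (value x i.val) z := by
  have hS := letterSplit w hik hk
  have hv : ∀ l, l < 2 * n → l ≠ i.val → l ≠ 2 * n - 1 - i.val → (l < k ∨ 2 * n - 1 - k < l) →
    value x l = value w l := fun l => value_eq_of_walk_outerRoots h
  constructor
  · rintro ⟨l, h1, h2, rfl⟩
    by_cases h3 : l < k
    · exact Or.inl ⟨l, h1, h3, hv l (by omega) (by omega) (by omega) (Or.inl h3)⟩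
    by_cases h4 : 2 * n - 1 - k < l
    · refine Or.inr (Or.inl ⟨2 * n - 1 - l, by omega, by omega, ?_⟩)
      rw [hv l (by omega) (by omega) (by omega) (Or.inr h4), value_bar w (by omega)]
    have hd1 : value x l ≠ value x i.val := value_ne x (by omega) (by omega) (by omega)
    have hd2 : value x l ≠ 2 * n - 1 - value x i.val :=
      value_ne_bar x (by omega) (by omega) (by omega)
    have hl := value_lt x (p := l) (by omega)
    rcases hS.cover _ hl with ⟨q, h5, h6⟩ | ⟨q, h5, h6⟩ | h5 | h5 | h5 | h5 | h5
    · rw [← hv q (by omega) (by omega) (by omega) (by omega)] at h6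
      have := value_inj x (by omega) (by omega) h6
      omega
    · rw [← hv q (by omega) (by omega) (by omega) (by omega)] at h6
      exact absurd h6 (value_ne_bar x (by omega) (by omega) (by omega))
    · exact Or.inr (Or.inr ⟨Or.inr (Or.inl h5), hd1, hd2⟩)
    · exact Or.inr (Or.inr ⟨Or.inr (Or.inr h5), hd1, hd2⟩)
    · exact Or.inl h5
    · exact Or.inr (Or.inl h5)
    · exact Or.inr (Or.inr ⟨Or.inl h5, hd1, hd2⟩)
  · have hb := hS.b_lt
    rintro (⟨f, h1, h2, rfl⟩ | ⟨f, h1, h2, h3⟩ | ⟨h1, h2, h3⟩)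
    · exact ⟨f, by omega, by omega, (hv f (by omega) (by omega) (by omega) (Or.inl h2)).symm⟩
    · refine ⟨2 * n - 1 - f, by omega, by omega, ?_⟩
      rw [value_bar x (by omega), hv f (by omega) (by omega) (by omega) (Or.inl h2)]
      have := value_lt w (p := f) (by omega)
      omega
    · have hz : z < 2 * n := by
        rcases h1 with h1 | h1 | h1
        · exact hS.O_lt _ h1
        · omega
        · omega
      obtain ⟨p, hp, rfl⟩ := value_surj x hz
      refine ⟨p, ?_, ?_, rfl⟩
      · by_contra hpi
        have hpi' : p ≠ i.val := fun h => h2 (by rw [h])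
        rw [hv p hp hpi' (by omega) (by omega)] at h1
        have hA : initialValues w i.val (value w p) := ⟨p, by omega, rfl⟩
        rcases h1 with h1 | h1 | h1
        · exact hS.A_O _ hA h1
        · exact (hS.A_ne _ hA).1 h1
        · exact (hS.A_ne _ hA).2 h1
      · by_contra hpi
        have hpi' : p ≠ 2 * n - 1 - i.val := fun h => h3 (by rw [h, value_bar x (by omega)])
        rw [hv p hp (by omega) hpi' (by omega)] at h1
        have hA : initialValues w i.val (2 * n - 1 - value w p) :=
          ⟨2 * n - 1 - p, by omega, value_bar w hp⟩
        have hl := value_lt w hp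
        rcases h1 with h1 | h1 | h1
        · exact hS.A_O _ hA (hS.O_bar _ h1)
        · exact (hS.A_ne _ hA).2 (by omega)
        · exact (hS.A_ne _ hA).1 (by omega)

theorem innerStep_of_walk_outerRoots {n k : ℕ} {i : Fin n} {w x : SignedPerm n} (hik : i.val < k)
    (hk : k ≤ n) (h : Walk (outerRoots i k) w x) (c : ℕ) : InnerStep x i.val i.val c ↔
      StepTo n (value x i.val) (initialValues x i.val) (freeAfter n (value w i.val)
        (innerValues w i.val k) (outerValues w k) (value x i.val)) c := by
  rw [innerStep_iff x i.isLt]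
  refine or_congr_right (and_congr_right fun _ => and_congr_right fun h1 => and_congr_right
    fun _ => and_congr_right fun _ => forall_congr' fun y => ⟨fun h2 h3 h4 => ?_,
      fun h2 h3 h4 => ?_⟩)
  · exact h2 ((outerValues_of_walk_outerRoots hik hk h (by omega)).2 h3) h4
  · exact h2 ((outerValues_of_walk_outerRoots hik hk h (by omega)).1 h3) h4

/-- Without sources a flow can only decrease along the cycle, and since it closes up there are no
sinks. -/
theorem critL_zero {n : ℕ} {w : SignedPerm n} {F R : ℕ → Prop} (hR : ∀ y, R y → y < 2 * n) :
    (∀ y, initialValues w 0 y ↔ R y) ↔ CritL n (initialValues w 0) F R := by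
  have hA : ∀ y, ¬ initialValues w 0 y := by rintro y ⟨l, hl, -⟩; omega
  constructor
  · intro h
    have hR : ∀ y, ¬ R y := fun y hy => hA y ((h y).2 hy)
    refine ⟨fun x _ h => absurd h (hR x), fun f _ => hR _, fun _ => 0, ⟨fun x _ => ?_, rfl⟩,
      ⟨0, by omega, rfl⟩, fun _ _ => rfl⟩
    rw [ind_neg (hR x), ind_neg (hA x)]
  · rintro ⟨-, -, G, h1, -, -⟩ y
    refine ⟨fun h => absurd h (hA y), fun h => absurd h ?_⟩
    have hy := hR y h
    have hstep : ∀ x < 2 * n, G (x + 1) + ind (R x) = G x := fun x hx => by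
      have := h1.1 x hx
      rwa [ind_neg (hA x), add_zero] at this
    have hmono : ∀ s t, s ≤ t → t ≤ 2 * n → G t ≤ G s := by
      intro s t hst
      induction t, hst using Nat.le_induction with
      | base => intro _; exact le_rfl
      | succ t hst ih =>
        intro ht
        have := hstep t (by omega)
        have := ih (by omega)
        omega
    have e1 := hmono 0 y (by omega) (by omega)
    have e2 := hmono (y + 1) (2 * n) (by omega) le_rfl
    have e3 := hstep y hy
    have e4 := h1.2
    rw [ind_pos h] at e3
    omega

open Classical in
-- As for `Γ_r`, but each position moves in two stages. Both intermediate letters are determined by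
-- `critL_step_unique`, and the recursion is `critL_iff`.
theorem cnt_rootsL {n k : ℕ} (hk : k ≤ n) (i : ℕ) (hi : i ≤ k) : ∀ (w : SignedPerm n)
    (R : ℕ → Prop), (∀ y, R y → y < 2 * n) →
    cnt (rootsL n k i) w (fun x => ∀ y, initialValues x i y ↔ R y) =
      if CritL n (initialValues w i) (frozenValues w i k) R then 1 else 0 := by
  induction i with
  | zero =>
    intro w R hR
    rw [rootsL_zero, cnt, critL_zero hR]
  | succ i ih =>
    intro w R hR
    have hik : i < k := hi
    have hi' : i < n := by omega
    have hS := letterSplit w hik hk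
    have hcO := cnt_outerRoots ⟨i, hi'⟩ (n - k) k hik (by omega) w
    have hreach : ∀ y, Walk (outerRoots ⟨i, hi'⟩ k) w y →
        OuterReach (innerValues w i k) (outerValues w k) n (value w i) (value y i) := by
      intro y hy
      by_contra hc
      have h1 := cnt_pos (T := fun x => value x i = value y i) hy rfl
      rw [hcO, if_neg hc] at h1
      exact lt_irrefl _ h1
    -- The target of the outer stage is that a suitable inner step exists. That this step is unique
    -- is checked afterwards, when the tail is counted.
    rw [show i + 1 = (⟨i, hi'⟩ : Fin n).val + 1 from rfl, rootsL_succ, cnt_append (C := fun y =>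
      ∃ c, InnerStep y i i c ∧ R c ∧
        CritL n (exchange n (initialValues y i) (value y i) c)
          (fun z => innerValues y i k z ∨ z = c) (fun z => R z ∧ z ≠ c))]
    · rw [cnt_of_values (fun x => value x i) _
        (fun d => ∃ c, StepTo n d (initialValues w i) (freeAfter n (value w i)
          (innerValues w i k) (outerValues w k) d) c ∧ R c ∧
          CritL n (exchange n (initialValues w i) d c) (fun y => innerValues w i k y ∨ y = c)
            (fun y => R y ∧ y ≠ c)) hcO]
      · simp only
        rw [← critL_iff hS, ← initialValues_succ]
        rfl
      · intro x hx _
        have h1 := innerStep_of_walk_outerRoots hik hk hx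
        have h2 := initialValues_congr (i := i) fun l hl =>
          value_eq_of_walk_outerRoots hx (l := l) (by omega) (by simp only; omega)
            (by simp only; omega) (by omega)
        have h3 := innerValues_congr (i := i) (k := k) fun l hl hl' =>
          value_eq_of_walk_outerRoots hx (l := l) (by omega) (by simp only; omega)
            (by simp only; omega) (by omega)
        simp only at h1
        simp only [h1, h2, h3]
      · rintro d d' h1 ⟨c, h2, h3, h4⟩ h1' ⟨c', h2', h3', h4'⟩
        exact (critL_step_unique hS h1 h2 h3 h4 h1' h2' h3' h4').1
    · intro y hy
      have h1 := innerStep_of_walk_outerRoots hik hk hy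
      have h2 := initialValues_congr (i := i) fun l hl =>
        value_eq_of_walk_outerRoots hy (l := l) (by omega) (by simp only; omega)
          (by simp only; omega) (by omega)
      have h3 := innerValues_congr (i := i) (k := k) fun l hl hl' =>
        value_eq_of_walk_outerRoots hy (l := l) (by omega) (by simp only; omega)
          (by simp only; omega) (by omega)
      simp only at h1
      rw [cnt_append (C := fun x => R (value x i) ∧ CritL n (initialValues x i)
        (frozenValues x i k) (fun z => R z ∧ z ≠ value x i))]
      · rw [cnt_of_values (fun x => value x i)
          (InnerStep y i i) (fun c => R c ∧ CritL n (exchange n (initialValues y i) (value y i) c)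
            (fun z => innerValues y i k z ∨ z = c) (fun z => R z ∧ z ≠ c))
          (cnt_innerRoots ⟨i, hi'⟩ i le_rfl y)]
        · intro x hx _
          have e1 := initialValues_eq_exchange hx
          have e2 := innerValues_congr (i := i) (k := k) fun l hl hl' =>
            value_eq_of_walk_innerRoots hx (l := l) hl (by simp only; omega)
          simp only at e1
          rw [e1, frozenValues_eq x hik, e2]
        · intro c c' k1 k2 k3 k4
          rw [h1, h2] at k1 k3
          rw [h2, h3] at k2 k4
          exact (critL_step_unique hS (hreach y hy) k1 k2.1 k2.2 (hreach y hy) k3 k4.1 k4.2).2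
      · intro x _
        refine (cnt_initialValues_succ hi' (fun z hz => ?_)
          (ih hik.le x _ fun y hy => hR y hy.1)).trans (by congr)
        exact value_eq_of_walk_rootsL hz le_rfl hik hk


/-! ### Flows and split columns -/

theorem sum_ind_eq {ι : Type*} [Fintype ι] {z : ι → ℕ} (hz : Function.Injective z) (x : ℕ) :
    ∑ j, ind (z j = x) = ind (∃ j, z j = x) := by
  classical
  by_cases h : ∃ j, z j = x
  · obtain ⟨j, rfl⟩ := h
    rw [ind_pos ⟨j, rfl⟩, Finset.sum_eq_single j]
    · exact ind_pos rfl
    · intro b _ hb; exact ind_neg fun h => hb (hz h)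
    · intro h; exact absurd (Finset.mem_univ _) h
  · rw [ind_neg h, Finset.sum_eq_zero]
    intro j _; exact ind_neg fun h' => h ⟨j, h'⟩

theorem sum_ind_lt {ι : Type*} [Fintype ι] {z : ι → ℕ} (hz : Function.Injective z) (x : ℕ) :
    ∑ j, ind (z j < x) = ∑ y ∈ Finset.range x, ind (∃ j, z j = y) := by
  induction x with
  | zero => simp [ind]
  | succ x ih =>
    rw [Finset.sum_range_succ, ← ih, ← sum_ind_eq hz, ← Finset.sum_add_distrib]
    refine Finset.sum_congr rfl fun j _ => ?_
    unfold ind; split_ifs <;> omega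

theorem sum_ind_of_lt {ι : Type*} [Fintype ι] {z : ι → ℕ} (hz : Function.Injective z) {x : ℕ}
    (hx : ∀ j, z j < x) : ∑ y ∈ Finset.range x, ind (∃ j, z j = y) = Fintype.card ι := by
  rw [← sum_ind_lt hz, Finset.sum_congr rfl fun j _ => ind_pos (hx j)]
  simp

theorem Flow.sum_eq {n : ℕ} {A R : ℕ → Prop} {G : ℕ → ℕ} (h : Flow n A R G) {x : ℕ}
    (hx : x ≤ 2 * n) : G x + ∑ y ∈ Finset.range x, ind (R y) =
      G 0 + ∑ y ∈ Finset.range x, ind (A y) := by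
  induction x with
  | zero => simp
  | succ x ih =>
    have := ih (by omega)
    have := h.1 x (by omega)
    rw [Finset.sum_range_succ, Finset.sum_range_succ]
    omega

/-- The partial sums of sources minus sinks close up around the cycle; subtracting their minimum
makes them nonnegative and creates a zero. -/
theorem exists_flow {n : ℕ} {A R : ℕ → Prop}
    (h : ∑ y ∈ Finset.range (2 * n), ind (A y) = ∑ y ∈ Finset.range (2 * n), ind (R y)) :
    ∃ G, Flow n A R G ∧ ∃ x ≤ 2 * n, G x = 0 := by
  set D : ℕ → ℤ := fun x => ∑ y ∈ Finset.range x, ((ind (A y) : ℤ) - ind (R y)) with hD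
  obtain ⟨m, hm, hmin⟩ := Finset.exists_min_image (Finset.range (2 * n + 1)) D ⟨0, by simp⟩
  have hD2 : D (2 * n) = 0 := by
    simp only [hD, Finset.sum_sub_distrib]
    have := congrArg (Nat.cast : ℕ → ℤ) h
    push_cast at this
    omega
  have hD0 : D 0 = 0 := by simp [hD]
  refine ⟨fun x => (D x - D m).toNat, ⟨fun x hx => ?_, ?_⟩, m, ?_, ?_⟩
  · have h1 := hmin x (Finset.mem_range.2 (by omega))
    have h2 := hmin (x + 1) (Finset.mem_range.2 (by omega))
    have h3 : D (x + 1) = D x + ((ind (A x) : ℤ) - ind (R x)) := Finset.sum_range_succ _ _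
    simp only
    omega
  · simp only [hD2, hD0]
  · have := Finset.mem_range.1 hm; omega
  · simp

/-- The letters of a column, as natural numbers. -/
def entries {n k : ℕ} (C : Column n k) (y : ℕ) : Prop := ∃ i, (C i).val = y

theorem entries_lt {n k : ℕ} {C : Column n k} {y : ℕ} (h : entries C y) : y < 2 * n := by
  obtain ⟨i, rfl⟩ := h; exact (C i).isLt

theorem mem_range_iff {n k : ℕ} {C : Column n k} {x : Letter n} :
    x ∈ Set.range C ↔ entries C x.val := by
  simp [entries, Fin.ext_iff]

theorem sum_entries {n k : ℕ} {C : Column n k} (h : Function.Injective C) :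
    ∑ y ∈ Finset.range (2 * n), ind (entries C y) = k := by
  have := sum_ind_of_lt (z := fun i => (C i).val) (Fin.val_injective.comp h) (x := 2 * n)
    fun i => (C i).isLt
  rwa [Fintype.card_fin] at this

theorem sum_initialValues {n k : ℕ} (w : SignedPerm n) (hk : k ≤ n) :
    ∑ y ∈ Finset.range (2 * n), ind (initialValues w k y) = k := by
  have := sum_ind_of_lt (z := fun i : Fin k => value w i.val) (fun i j h => Fin.ext
    (value_inj w (by omega) (by omega) h)) (x := 2 * n) fun i => value_lt w (by omega)
  rw [Fintype.card_fin] at this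
  refine Eq.trans ?_ this
  refine Finset.sum_congr rfl fun y _ => congrArg ind (propext ⟨?_, ?_⟩)
  · rintro ⟨l, hl, h⟩; exact ⟨⟨l, hl⟩, h⟩
  · rintro ⟨l, h⟩; exact ⟨l.val, l.isLt, h⟩

/-- No position is frozen when `i = k`, so apart from the absence of pairs the criterion only asks
for equally many sources and sinks. -/
theorem cnt_rootsL_self {n k : ℕ} (hk : k ≤ n) (w : SignedPerm n) {C : Column n k}
    (hC : Function.Injective C) (hp : NoPair n (entries C)) :
    cnt (rootsL n k k) w (fun x => ∀ y, initialValues x k y ↔ entries C y) = 1 := by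
  rw [cnt_rootsL hk k le_rfl w _ fun y hy => entries_lt hy, if_pos]
  have hF : ∀ y, ¬ frozenValues w k k y := by rintro y ⟨f, h1, h2, -⟩; omega
  obtain ⟨G, h1, h2⟩ := exists_flow (A := initialValues w k) (R := entries C)
    ((sum_initialValues w hk).trans (sum_entries hC).symm)
  exact ⟨hp, fun f hf => absurd hf (hF f), G, h1, h2, fun f hf => absurd hf (hF f)⟩

section
variable {n k r : ℕ} {C : Column n k} {z t : Fin r → Fin n}

theorem IsSplitting.t_lt (h : IsSplitting C z t) (i : Fin r) : t i < z i := (h.t_greatest i).1.1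

theorem IsSplitting.t_anti (h : IsSplitting C z t) : StrictAnti t := by
  cases r with
  | zero => exact fun i => i.elim0
  | succ r =>
    refine Fin.strictAnti_iff_succ_lt.2 fun i => ?_
    exact (h.t_greatest i.succ).1.2.1 i.castSucc (by simp)

/-- The greedy choice of the `t_i`: a letter absent from `C` together with its bar, other than the
`t_i` and lying between `t_i` and `z_i`, would have been preferred to `t_i`, unless it is not below
`t_{i-1}`; then it lies between `t_{i-1}` and `z_{i-1}`. -/
theorem IsSplitting.not_between (h : IsSplitting C z t) {x : Fin n} (h1 : ¬ entries C x.val)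
    (h2 : ¬ entries C (2 * n - 1 - x.val)) (h3 : ∀ i, t i ≠ x) (i : Fin r) :
    ¬ (t i < x ∧ x < z i) := by
  obtain ⟨i, hi⟩ := i
  induction i with
  | zero =>
    rintro ⟨h4, h5⟩
    refine absurd ((h.t_greatest ⟨0, hi⟩).2 ⟨h5, fun j hj => by simp at hj, ?_, ?_⟩) (not_le.2 h4)
    · rwa [mem_range_iff, val_unb]
    · rwa [mem_range_iff, val_bar, val_unb]
  | succ i ih =>
    rintro ⟨h4, h5⟩
    have ih := ih (by omega)
    have hz : z ⟨i + 1, hi⟩ < z ⟨i, by omega⟩ := h.z_anti (by simp [Fin.lt_def])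
    have h6 : x < t ⟨i, by omega⟩ := by
      refine lt_of_le_of_ne (not_lt.1 fun h6 => ih ⟨h6, h5.trans hz⟩) (h3 _).symm
    refine absurd ((h.t_greatest ⟨i + 1, hi⟩).2 ⟨h5, fun j hj => ?_, ?_, ?_⟩) (not_le.2 h4)
    · have hj' : j = ⟨i, by omega⟩ := Fin.ext (by simpa using hj)
      rwa [hj']
    · rwa [mem_range_iff, val_unb]
    · rwa [mem_range_iff, val_bar, val_unb]

theorem IsSplitting.exists_z_iff (h : IsSplitting C z t) (x : ℕ) :
    (∃ i, (z i).val = x) ↔ x < n ∧ entries C x ∧ entries C (2 * n - 1 - x) := by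
  constructor
  · rintro ⟨i, rfl⟩
    have : z i ∈ Set.range z := ⟨i, rfl⟩
    rw [h.z_range] at this
    obtain ⟨h1, h2⟩ := this
    rw [mem_range_iff, val_unb] at h1
    rw [mem_range_iff, val_bar, val_unb] at h2
    exact ⟨(z i).isLt, h1, h2⟩
  · rintro ⟨h1, h2, h3⟩
    have : (⟨x, h1⟩ : Fin n) ∈ Set.range z := by
      rw [h.z_range]
      refine ⟨?_, ?_⟩
      · rwa [mem_range_iff, val_unb]
      · rwa [mem_range_iff, val_bar, val_unb]
    obtain ⟨i, hi⟩ := this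
    exact ⟨i, by rw [hi]⟩

theorem IsSplitting.not_t (h : IsSplitting C z t) (i : Fin r) :
    ¬ entries C (t i).val ∧ ¬ entries C (2 * n - 1 - (t i).val) := by
  obtain ⟨-, -, h1, h2⟩ := (h.t_greatest i).1
  rw [mem_range_iff, val_unb] at h1
  rw [mem_range_iff, val_bar, val_unb] at h2
  exact ⟨h1, h2⟩
end

theorem IsSplitColumn.exists_entries {n k : ℕ} {C R L : Column n k} (h : IsSplitColumn C R L) :
    ∃ (r : ℕ) (z t : Fin r → Fin n), IsSplitting C z t ∧
      (∀ y, entries R y ↔ (entries C y ∧ ¬ ∃ i, 2 * n - 1 - (z i).val = y) ∨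
        ∃ i, 2 * n - 1 - (t i).val = y) ∧
      (∀ y, entries L y ↔ (entries C y ∧ ¬ ∃ i, (z i).val = y) ∨ ∃ i, (t i).val = y) := by
  obtain ⟨-, r, z, t, hs, ⟨-, hR⟩, -, hL⟩ := h
  refine ⟨r, z, t, hs, fun y => ?_, fun y => ?_⟩
  · by_cases hy : y < 2 * n
    · have := Set.ext_iff.1 hR ⟨y, hy⟩
      simpa only [entries, Set.mem_union, Set.mem_sdiff, Set.mem_range, Fin.ext_iff, val_bar,
        val_unb] using this
    · refine ⟨fun h => absurd (entries_lt h) hy, ?_⟩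
      rintro (⟨h, -⟩ | ⟨i, rfl⟩)
      · exact absurd (entries_lt h) hy
      · have := (t i).isLt; omega
  · by_cases hy : y < 2 * n
    · have := Set.ext_iff.1 hL ⟨y, hy⟩
      simpa only [entries, Set.mem_union, Set.mem_sdiff, Set.mem_range, Fin.ext_iff, val_bar,
        val_unb] using this
    · refine ⟨fun h => absurd (entries_lt h) hy, ?_⟩
      rintro (⟨h, -⟩ | ⟨i, rfl⟩)
      · exact absurd (entries_lt h) hy
      · have := (t i).isLt; omega

theorem noPair_of_lt {n : ℕ} {R : ℕ → Prop} (h : ∀ x < n, R x → ¬ R (2 * n - 1 - x)) :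
    NoPair n R := by
  intro x hx h1 h2
  by_cases hxn : x < n
  · exact h x hxn h1 h2
  · refine h (2 * n - 1 - x) (by omega) h2 ?_
    rwa [bar_bar_nat hx]

theorem IsSplitColumn.noPair_left {n k : ℕ} {C R L : Column n k} (h : IsSplitColumn C R L) :
    NoPair n (entries L) := by
  obtain ⟨r, z, t, hs, -, hL⟩ := h.exists_entries
  refine noPair_of_lt fun x hx h1 h2 => ?_
  rw [hL] at h1 h2
  have h2 : entries C (2 * n - 1 - x) := by
    rcases h2 with h2 | ⟨i, hi⟩
    · exact h2.1
    · have := (t i).isLt; omega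
  rcases h1 with ⟨h1, h3⟩ | ⟨i, rfl⟩
  · exact h3 ((hs.exists_z_iff x).2 ⟨hx, h1, h2⟩)
  · exact (hs.not_t i).2 h2

theorem IsSplitColumn.noPair_right {n k : ℕ} {C R L : Column n k} (h : IsSplitColumn C R L) :
    NoPair n (entries R) := by
  obtain ⟨r, z, t, hs, hR, -⟩ := h.exists_entries
  refine noPair_of_lt fun x hx h1 h2 => ?_
  rw [hR] at h1 h2
  have h1 : entries C x := by
    rcases h1 with h1 | ⟨i, hi⟩
    · exact h1.1
    · have := (t i).isLt; omega
  rcases h2 with ⟨h2, h3⟩ | ⟨i, hi⟩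
  · obtain ⟨i, hi⟩ := (hs.exists_z_iff x).2 ⟨hx, h1, h2⟩
    exact h3 ⟨i, by rw [hi]⟩
  · have h4 := (hs.not_t i).1
    have : (t i).val = x := by have := (t i).isLt; omega
    exact h4 (this ▸ h1)

theorem ind_congr {p q : Prop} (h : p ↔ q) : ind p = ind q := by rw [propext h]

/-- The flow is the sum of unit paths from `t_i` to `z_i` and from `z̄_i` to `t̄_i`. They stay
within the halves, and they avoid the free letters by `IsSplitting.not_between`. -/
theorem IsSplitColumn.critR {n k : ℕ} {C R L : Column n k} (h : IsSplitColumn C R L)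
    {O : ℕ → Prop} (hO : ∀ y, O y → y < 2 * n ∧ ¬ entries L y ∧ ¬ entries L (2 * n - 1 - y)) :
    CritR n (entries L) O (entries R) := by
  refine ⟨h.noPair_right, ?_⟩
  obtain ⟨r, z, t, hs, hR, hL⟩ := h.exists_entries
  have hzi : Function.Injective fun i => (z i).val :=
    Fin.val_injective.comp hs.z_anti.injective
  have hti : Function.Injective fun i => (t i).val :=
    Fin.val_injective.comp hs.t_anti.injective
  have hzi' : Function.Injective fun i => 2 * n - 1 - (z i).val := fun i j hij =>
    hzi (by have := (z i).isLt; have := (z j).isLt; simp only at hij ⊢; omega)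
  have hti' : Function.Injective fun i => 2 * n - 1 - (t i).val := fun i j hij =>
    hti (by have := (t i).isLt; have := (t j).isLt; simp only at hij ⊢; omega)
  refine ⟨fun x => ∑ i, (ind ((t i).val < x ∧ x ≤ (z i).val) +
    ind (2 * n - 1 - (z i).val < x ∧ x ≤ 2 * n - 1 - (t i).val)), ⟨fun x hx => ?_, ?_⟩, ?_, ?_, ?_⟩
  · have e1 : ∑ i, (ind ((t i).val < x + 1 ∧ x + 1 ≤ (z i).val) +
        ind (2 * n - 1 - (z i).val < x + 1 ∧ x + 1 ≤ 2 * n - 1 - (t i).val)) +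
        (∑ i, ind ((z i).val = x) + ∑ i, ind (2 * n - 1 - (t i).val = x)) =
        ∑ i, (ind ((t i).val < x ∧ x ≤ (z i).val) +
        ind (2 * n - 1 - (z i).val < x ∧ x ≤ 2 * n - 1 - (t i).val)) +
        (∑ i, ind ((t i).val = x) + ∑ i, ind (2 * n - 1 - (z i).val = x)) := by
      simp only [← Finset.sum_add_distrib]
      refine Finset.sum_congr rfl fun i _ => ?_
      have h1 : (t i).val < (z i).val := hs.t_lt i
      have h2 := (z i).isLt
      have e4 : ind ((t i).val < x + 1 ∧ x + 1 ≤ (z i).val) + ind ((z i).val = x) =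
          ind ((t i).val < x ∧ x ≤ (z i).val) + ind ((t i).val = x) := by
        unfold ind; split_ifs <;> omega
      have e5 : ind (2 * n - 1 - (z i).val < x + 1 ∧ x + 1 ≤ 2 * n - 1 - (t i).val) +
          ind (2 * n - 1 - (t i).val = x) =
          ind (2 * n - 1 - (z i).val < x ∧ x ≤ 2 * n - 1 - (t i).val) +
          ind (2 * n - 1 - (z i).val = x) := by
        unfold ind; split_ifs <;> omega
      omega
    rw [sum_ind_eq hzi, sum_ind_eq hti, sum_ind_eq hzi', sum_ind_eq hti'] at e1
    have e2 : ind (entries R x) + ind (∃ i, 2 * n - 1 - (z i).val = x) =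
        ind (entries C x) + ind (∃ i, 2 * n - 1 - (t i).val = x) := by
      rw [ind_congr (hR x), ind_or]
      · by_cases hz : ∃ i, 2 * n - 1 - (z i).val = x
        · have : entries C x := by
            obtain ⟨i, rfl⟩ := hz
            exact ((hs.exists_z_iff (z i).val).1 ⟨i, rfl⟩).2.2
          rw [ind_neg (fun h => h.2 hz), ind_pos hz, ind_pos this]; omega
        · rw [ind_neg hz, ind_congr (and_iff_left hz)]; omega
      · rintro h ⟨i, rfl⟩
        exact (hs.not_t i).2 h.1
    have e3 : ind (entries L x) + ind (∃ i, (z i).val = x) =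
        ind (entries C x) + ind (∃ i, (t i).val = x) := by
      rw [ind_congr (hL x), ind_or]
      · by_cases hz : ∃ i, (z i).val = x
        · have : entries C x := ((hs.exists_z_iff x).1 hz).2.1
          rw [ind_neg (fun h => h.2 hz), ind_pos hz, ind_pos this]; omega
        · rw [ind_neg hz, ind_congr (and_iff_left hz)]; omega
      · rintro h ⟨i, rfl⟩
        exact (hs.not_t i).1 h.1
    simp only
    omega
  · refine Finset.sum_congr rfl fun i _ => ?_
    have h2 := (z i).isLt
    have h3 := (t i).isLt
    unfold ind; split_ifs <;> omega
  · refine Finset.sum_eq_zero fun i _ => ?_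
    unfold ind; split_ifs <;> omega
  · refine Finset.sum_eq_zero fun i _ => ?_
    have h2 := (z i).isLt
    unfold ind; split_ifs <;> omega
  · intro y hy
    obtain ⟨hy, hy1, hy2⟩ := hO y hy
    -- The endpoints are included: `t_i` and `z̄_i` belong to `L`, so neither `t_i` nor `z_i` is
    -- free.
    have key : ∀ x, x < 2 * n → ¬ entries L x → ¬ entries L (2 * n - 1 - x) →
        ∀ i, ¬ ((t i).val ≤ x ∧ x ≤ (z i).val) := by
      rintro x - h1 h2 i ⟨h3, h4⟩
      have hxn : x < n := by have := (z i).isLt; omega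
      rw [hL] at h1 h2
      have h5 : ∀ j, t j ≠ ⟨x, hxn⟩ := fun j hj => h1 (Or.inr ⟨j, by rw [hj]⟩)
      have h6 : ¬ entries C (2 * n - 1 - x) := fun h => h2 (Or.inl ⟨h, fun ⟨j, hj⟩ => by
        have := (z j).isLt; omega⟩)
      have h7 : ∀ j, (z j).val ≠ x := fun j hj => h6 ((hs.exists_z_iff x).1 ⟨j, hj⟩).2.2
      have h8 : ¬ entries C x := fun h => h1 (Or.inl ⟨h, fun ⟨j, hj⟩ => h7 j hj⟩)
      refine hs.not_between (x := ⟨x, hxn⟩) h8 h6 h5 i ⟨?_, ?_⟩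
      · have := h5 i
        rw [Fin.lt_def]
        rw [ne_eq, Fin.ext_iff] at this
        simp only at this ⊢
        omega
      · have := h7 i
        rw [Fin.lt_def]
        simp only
        omega
    refine Finset.sum_eq_zero fun i _ => ?_
    have k1 := key y hy hy1 hy2 i
    have k2 := key (2 * n - 1 - y) (by omega) hy2 (by rwa [bar_bar_nat hy]) i
    rw [ind_neg (by omega), ind_neg (by omega)]
    rfl

theorem exists_strictAnti {n r : ℕ} (s : Finset (Fin n)) (h : s.card = r) :
    ∃ z : Fin r → Fin n, StrictAnti z ∧ ∀ x, (∃ i, z i = x) ↔ x ∈ s := by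
  refine ⟨s.orderEmbOfFin h ∘ Fin.rev, (s.orderEmbOfFin h).strictMono.comp_strictAnti
    Fin.rev_strictAnti, fun x => ?_⟩
  have := Set.ext_iff.1 (s.range_orderEmbOfFin h) x
  rw [Finset.mem_coe] at this
  rw [← this]
  constructor
  · rintro ⟨i, rfl⟩; exact ⟨Fin.rev i, rfl⟩
  · rintro ⟨i, rfl⟩; exact ⟨Fin.rev i, by simp⟩

theorem exists_column {n k : ℕ} {S : ℕ → Prop} (hlt : ∀ y, S y → y < 2 * n)
    (h : ∑ y ∈ Finset.range (2 * n), ind (S y) = k) :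
    ∃ C : Column n k, StrictMono C ∧ ∀ y, entries C y ↔ S y := by
  classical
  set s : Finset (Letter n) := Finset.univ.filter fun x => S x.val with hs
  have hcard : s.card = k := by
    rw [← h, Finset.card_filter, Finset.sum_range]
    rfl
  refine ⟨s.orderEmbOfFin hcard, (s.orderEmbOfFin hcard).strictMono, fun y => ?_⟩
  have key := fun x => Set.ext_iff.1 (s.range_orderEmbOfFin hcard) x
  constructor
  · rintro ⟨i, rfl⟩
    have := (key _).1 ⟨i, rfl⟩
    simpa [hs] using this
  · intro hy
    obtain ⟨i, hi⟩ := (key ⟨y, hlt y hy⟩).2 (by simpa [hs] using hy)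
    exact ⟨i, by rw [hi]⟩

theorem sum_range_two_mul (n : ℕ) (f : ℕ → ℕ) : ∑ y ∈ Finset.range (2 * n), f y =
    ∑ y ∈ Finset.range n, (f y + f (2 * n - 1 - y)) := by
  rw [two_mul, Finset.sum_range_add, Finset.sum_add_distrib]
  congr 1
  rw [← Finset.sum_range_reflect]
  refine Finset.sum_congr rfl fun j hj => ?_
  have := Finset.mem_range.1 hj
  congr 1
  omega

/-- The sinks of a flow that satisfies the criterion contain exactly one letter of every pair that
contains a source. -/
theorem CritR.mem_iff {n : ℕ} {A O R : ℕ → Prop} (h : CritR n A O R)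
    (hO : ∀ y < 2 * n, O y ↔ ¬ A y ∧ ¬ A (2 * n - 1 - y)) {y : ℕ} (hy : y < 2 * n) :
    R y ↔ (A y ∨ A (2 * n - 1 - y)) ∧ ¬ R (2 * n - 1 - y) := by
  obtain ⟨hR, G, hG, -, -, hGO⟩ := h
  have hsum := hG.sum_eq le_rfl
  rw [hG.2, Nat.add_left_cancel_iff, sum_range_two_mul, sum_range_two_mul] at hsum
  have hOR : ∀ y < 2 * n, R y → A y ∨ A (2 * n - 1 - y) := by
    intro y hy hRy
    by_contra hn
    have hOy : O y := (hO y hy).2 (by tauto)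
    exact (hG.not_sink hy (hGO y hOy) (by tauto)).1 hRy
  have hle : ∀ x ∈ Finset.range n, ind (R x) + ind (R (2 * n - 1 - x)) ≤
      ind (A x) + ind (A (2 * n - 1 - x)) := by
    intro x hx
    have hx := Finset.mem_range.1 hx
    by_cases h1 : R x
    · rw [ind_pos h1, ind_neg (hR x (by omega) h1)]
      rcases hOR x (by omega) h1 with h2 | h2 <;> rw [ind_pos h2] <;> omega
    · rw [ind_neg h1]
      by_cases h3 : R (2 * n - 1 - x)
      · rw [ind_pos h3]
        have := hOR _ (by omega) h3
        rw [bar_bar_nat (by omega)] at this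
        rcases this with h2 | h2 <;> rw [ind_pos h2] <;> omega
      · rw [ind_neg h3]; omega
  -- No pair has more sinks than sources, and the totals agree, so every pair has equally many of
  -- both.
  have heq := (Finset.sum_eq_sum_iff_of_le hle).1 hsum
  have key : ∀ x < n, (A x ∨ A (2 * n - 1 - x)) → R x ∨ R (2 * n - 1 - x) := by
    intro x hx h1
    have := heq x (Finset.mem_range.2 hx)
    by_contra hn
    rw [ind_neg (fun h => hn (Or.inl h)), ind_neg (fun h => hn (Or.inr h))] at this
    rcases h1 with h2 | h2 <;> rw [ind_pos h2] at this <;> omega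
  constructor
  · exact fun h => ⟨hOR y hy h, hR y hy h⟩
  · rintro ⟨h1, h2⟩
    by_cases hyn : y < n
    · exact (key y hyn h1).resolve_right h2
    · have := key (2 * n - 1 - y) (by omega) (by rw [bar_bar_nat hy]; exact h1.symm)
      rw [bar_bar_nat hy] at this
      exact this.resolve_left h2

theorem mem_right_iff {R R' L L' : Prop} (h1 : R ↔ (L ∨ L') ∧ ¬ R') (h2 : L → ¬ L') :
    R ↔ (L ∧ ¬ (L ∧ R')) ∨ (R ∧ L') := by tauto

set_option maxHeartbeats 1000000 in
-- On the unbarred half the flow at `x` is the number of letters `t_i` below `x` minus the number of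
-- letters `z_i` below `x`. Nonnegativity then gives `t_i < z_i`, and vanishing at free letters
-- gives the maximality of `t_i`.
theorem CritR.isSplitColumn {n k : ℕ} {R L : Column n k} (hRm : StrictMono R) (hLm : StrictMono L)
    (hL : NoPair n (entries L)) {O : ℕ → Prop}
    (hO : ∀ y < 2 * n, O y ↔ ¬ entries L y ∧ ¬ entries L (2 * n - 1 - y))
    (h : CritR n (entries L) O (entries R)) : ∃ C, IsSplitColumn C R L := by
  classical
  have hmem := fun y hy => h.mem_iff hO (y := y) hy
  obtain ⟨hR, G, hG, h0, hn, hGO⟩ := h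
  -- In a split column, `t` goes with `t ∈ L`, `t̄ ∈ R`, and `z` with `z ∈ R`, `z̄ ∈ L`; so `T` and
  -- `Z` are the only possible sets of the `t_i` and the `z_i`.
  set T : ℕ → Prop := fun t => t < n ∧ entries L t ∧ entries R (2 * n - 1 - t) with hT
  set Z : ℕ → Prop := fun z => z < n ∧ entries R z ∧ entries L (2 * n - 1 - z) with hZ
  have hind : ∀ x < n, ind (entries R x) + ind (T x) = ind (entries L x) + ind (Z x) := by
    intro x hx
    have h1 := hmem x (by omega)
    have h2 := hmem (2 * n - 1 - x) (by omega)
    rw [bar_bar_nat (by omega)] at h2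
    have h3 := hL x (by omega)
    by_cases k1 : entries L x
    · by_cases k2 : entries R x
      · rw [ind_pos k1, ind_pos k2, ind_neg (p := T x) (by tauto), ind_neg (p := Z x) (by tauto)]
      · rw [ind_pos k1, ind_neg k2, ind_pos (p := T x) (by tauto), ind_neg (p := Z x) (by tauto)]
    · by_cases k2 : entries R x
      · rw [ind_neg k1, ind_pos k2, ind_neg (p := T x) (by tauto), ind_pos (p := Z x) (by tauto)]
      · rw [ind_neg k1, ind_neg k2, ind_neg (p := T x) (by tauto), ind_neg (p := Z x) (by tauto)]
  have hflow : ∀ x ≤ n, G x + ∑ y ∈ Finset.range x, ind (Z y) =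
      ∑ y ∈ Finset.range x, ind (T y) := by
    intro x hx
    induction x with
    | zero => simpa using h0
    | succ x ih =>
      have := ih (by omega)
      have := hG.1 x (by omega)
      have := hind x (by omega)
      rw [Finset.sum_range_succ, Finset.sum_range_succ]
      omega
  have hcard : ∀ P : ℕ → Prop, (Finset.univ.filter fun x : Fin n => P x.val).card =
      ∑ y ∈ Finset.range n, ind (P y) := by
    intro P
    rw [Finset.card_filter, Finset.sum_range]
    rfl
  have hZT := hflow n le_rfl
  rw [hn, zero_add] at hZT
  obtain ⟨r, hr⟩ : ∃ r, ∑ y ∈ Finset.range n, ind (T y) = r := ⟨_, rfl⟩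
  obtain ⟨z, hz, hzm⟩ := exists_strictAnti _ ((hcard Z).trans (hZT.trans hr))
  obtain ⟨t, ht, htm⟩ := exists_strictAnti _ ((hcard T).trans hr)
  have hzm' : ∀ y, (∃ i, (z i).val = y) ↔ Z y := by
    intro y
    constructor
    · rintro ⟨i, rfl⟩
      simpa using (hzm (z i)).1 ⟨i, rfl⟩
    · intro hy
      obtain ⟨i, hi⟩ := (hzm ⟨y, hy.1⟩).2 (by simpa using hy)
      exact ⟨i, by rw [hi]⟩
  have htm' : ∀ y, (∃ i, (t i).val = y) ↔ T y := by
    intro y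
    constructor
    · rintro ⟨i, rfl⟩
      simpa using (htm (t i)).1 ⟨i, rfl⟩
    · intro hy
      obtain ⟨i, hi⟩ := (htm ⟨y, hy.1⟩).2 (by simpa using hy)
      exact ⟨i, by rw [hi]⟩
  have hflow' : ∀ x ≤ n, G x + ∑ i, ind ((z i).val < x) = ∑ i, ind ((t i).val < x) := by
    intro x hx
    rw [sum_ind_lt (z := fun i => (z i).val) (Fin.val_injective.comp hz.injective),
      sum_ind_lt (z := fun i => (t i).val) (Fin.val_injective.comp ht.injective)]
    simp only [hzm', htm']
    exact hflow x hx
  -- If `z_i < t_i`, then up to `z_i` there would be more letters `z_j` than letters `t_j`, and the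
  -- flow would be negative.
  have hlt : ∀ i, t i < z i := by
    intro i
    by_contra hle
    have hne : t i ≠ z i := by
      intro he
      have h1 := (hzm' (z i).val).1 ⟨i, rfl⟩
      have h2 := (htm' (z i).val).1 ⟨i, by rw [he]⟩
      exact hL _ (by have := h1.1; omega) h2.2.1 h1.2.2
    have hlt : z i < t i := lt_of_le_of_ne (not_lt.1 hle) hne.symm
    have := hflow' ((z i).val + 1) (z i).isLt
    have hs : ∑ j, ind ((t j).val < (z i).val + 1) < ∑ j, ind ((z j).val < (z i).val + 1) := by
      refine Finset.sum_lt_sum (fun j _ => ?_) ⟨i, Finset.mem_univ _, ?_⟩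
      · by_cases hj : (t j).val < (z i).val + 1
        · have h1 : t j < t i := lt_of_le_of_lt (Fin.le_def.2 (by omega)) hlt
          have h2 : z j < z i := hz (ht.lt_iff_gt.1 h1)
          rw [ind_pos hj, ind_pos (by have : (z j).val < (z i).val := h2; omega)]
        · rw [ind_neg hj]; omega
      · have : (z i).val < (t i).val := hlt
        rw [ind_neg (by omega), ind_pos (by omega)]; omega
    omega
  -- Every `z_j` below `x` has `t_j` below `x`, and `t_i` is below `x` while `z_i` is not, so the
  -- flow at `x` would be positive.
  have hgap : ∀ i x, x < n → G x = 0 → t i < x → x < z i → (∀ j, j < i → x < (t j).val) → False := by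
    intro i x hx hx0 h1 h2 h3
    have := hflow' x hx.le
    have hs : ∑ j, ind ((z j).val < x) < ∑ j, ind ((t j).val < x) := by
      refine Finset.sum_lt_sum (fun j _ => ?_) ⟨i, Finset.mem_univ _, ?_⟩
      · by_cases hj : (z j).val < x
        · have h4 : z j < z i := Fin.lt_def.2 (by omega)
          have h5 : (t j).val < (t i).val := ht (hz.lt_iff_gt.1 h4)
          rw [ind_pos hj, ind_pos (by omega)]
        · rw [ind_neg hj]; omega
      · rw [ind_neg (by omega), ind_pos h1]; omega
    omega
  have hLZ : ∀ y, Z y → ¬ entries L y := fun y h h' => hL _ (by have := h.1; omega) h' h.2.2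
  have hsumT : ∑ y ∈ Finset.range (2 * n), ind (T y) = r := by
    have := sum_ind_of_lt (z := fun i => (t i).val) (Fin.val_injective.comp ht.injective)
      (x := 2 * n) fun i => by have := (t i).isLt; omega
    simpa only [htm', Fintype.card_fin] using this
  have hsumZ : ∑ y ∈ Finset.range (2 * n), ind (Z y) = r := by
    have := sum_ind_of_lt (z := fun i => (z i).val) (Fin.val_injective.comp hz.injective)
      (x := 2 * n) fun i => by have := (z i).isLt; omega
    simpa only [hzm', Fintype.card_fin] using this
  have hsumS : ∑ y ∈ Finset.range (2 * n), ind ((entries L y ∧ ¬ T y) ∨ Z y) = k := by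
    have h1 : ∀ y, ind ((entries L y ∧ ¬ T y) ∨ Z y) + ind (T y) = ind (entries L y) + ind (Z y) := by
      intro y
      rw [ind_or fun h h' => hLZ y h' h.1]
      by_cases hy : T y
      · rw [ind_neg (p := entries L y ∧ ¬ T y) fun h => h.2 hy, ind_pos hy, ind_pos hy.2.1]; omega
      · rw [ind_neg hy, ind_congr (and_iff_left hy)]; omega
    have h2 := Finset.sum_congr (rfl : Finset.range (2 * n) = _) fun y _ => h1 y
    rw [Finset.sum_add_distrib, Finset.sum_add_distrib, hsumT, hsumZ, sum_entries hLm.injective] at h2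
    omega
  -- The KN column is `L` with the letters `t_i` changed back into the `z_i`.
  obtain ⟨C, hC, hCS⟩ := exists_column (S := fun y => (entries L y ∧ ¬ T y) ∨ Z y) (by
    rintro y (h | h)
    · exact entries_lt h.1
    · exact entries_lt h.2.1) hsumS
  have hbarT : ∀ x < n, ¬ T (2 * n - 1 - x) := fun x hx h => by have := h.1; omega
  have hbarZ : ∀ x < n, ¬ Z (2 * n - 1 - x) := fun x hx h => by have := h.1; omega
  have hCbar : ∀ x < n, entries C (2 * n - 1 - x) ↔ entries L (2 * n - 1 - x) := by
    intro x hx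
    rw [hCS]
    have h1 := hbarT x hx
    have h2 := hbarZ x hx
    tauto
  have hpair : ∀ x < n, (entries C x ∧ entries C (2 * n - 1 - x)) ↔ Z x := by
    intro x hx
    rw [hCbar x hx, hCS]
    have h1 := hL x (by omega)
    have h2 : Z x → entries L (2 * n - 1 - x) := fun h => h.2.2
    tauto
  have hfree : ∀ x < n, ¬ entries C x → ¬ entries C (2 * n - 1 - x) → T x ∨ O x := by
    intro x hx h1 h2
    rw [hCS] at h1
    rw [hCbar x hx] at h2
    rw [hO x (by omega)]
    tauto
  have hRC : ∀ y, entries R y ↔ (entries C y ∧ ¬ ∃ i, 2 * n - 1 - (z i).val = y) ∨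
      ∃ i, 2 * n - 1 - (t i).val = y := by
    intro y
    have hex : ∀ (Q : ℕ → Prop) (f : Fin r → Fin n), (∀ y, (∃ i, (f i).val = y) ↔ Q y) →
        y < 2 * n → (∀ x, Q x → x < n) → ((∃ i, 2 * n - 1 - (f i).val = y) ↔ Q (2 * n - 1 - y)) := by
      intro Q f hf hy hQ
      constructor
      · rintro ⟨i, rfl⟩
        rw [bar_bar_nat (by omega)]
        exact (hf _).1 ⟨i, rfl⟩
      · intro h
        obtain ⟨i, hi⟩ := (hf _).2 h
        exact ⟨i, by rw [hi, bar_bar_nat hy]⟩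
    by_cases hy : y < 2 * n
    swap
    · refine ⟨fun h => absurd (entries_lt h) hy, ?_⟩
      rintro (⟨h, -⟩ | ⟨i, rfl⟩)
      · exact absurd (entries_lt h) hy
      · have := (t i).isLt; omega
    rw [hex Z z hzm' hy fun x h => h.1, hex T t htm' hy fun x h => h.1, hCS]
    have h1 := hmem y hy
    have h2 := hL y hy
    have h3 := mem_right_iff h1 h2
    by_cases hyn : y < n
    · have h5 : ¬ 2 * n - 1 - y < n := by omega
      simp only [hT, hZ, hyn, h5, true_and, false_and, not_false_eq_true, and_true, or_false]
      exact h3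
    · have h5 : 2 * n - 1 - y < n := by omega
      simp only [hT, hZ, bar_bar_nat hy, hyn, h5, true_and, false_and, not_false_eq_true, and_true,
        or_false]
      rw [and_comm (a := entries R (2 * n - 1 - y)), and_comm (a := entries L (2 * n - 1 - y))]
      exact h3
  refine ⟨C, hC, r, z, t, ⟨hz, ?_, fun i => ⟨⟨hlt i, fun j hj => ht (Fin.lt_def.2 (by omega)), ?_, ?_⟩,
    ?_⟩⟩, ⟨hRm, ?_⟩, hLm, ?_⟩
  · ext x
    have h1 := hzm' x.val
    have h2 := hpair x.val x.isLt
    simp only [Set.mem_range, Set.mem_ofPred_eq, ← Fin.val_inj, val_unb, val_bar] at h1 ⊢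
    rw [h1, ← h2]
    rfl
  · rw [mem_range_iff, val_unb, hCS]
    have h1 := (htm' (t i).val).1 ⟨i, rfl⟩
    rintro (h | h)
    · exact h.2 h1
    · exact hLZ _ h h1.2.1
  · rw [mem_range_iff, val_bar, val_unb, hCbar _ (t i).isLt]
    exact hL _ (by have := (t i).isLt; omega) ((htm' (t i).val).1 ⟨i, rfl⟩).2.1
  · rintro x ⟨h1, h2, h3, h4⟩
    rw [mem_range_iff, val_unb] at h3
    rw [mem_range_iff, val_bar, val_unb] at h4
    by_contra hle
    have h5 : t i < x := not_le.1 hle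
    have h6 : ∀ j, j < i → x < t j := by
      intro j hj
      refine lt_of_lt_of_le (h2 ⟨i.val - 1, by omega⟩ ?_) (ht.antitone (Fin.le_def.2 ?_))
      · have : j.val < i.val := hj
        simp only; omega
      · have : j.val < i.val := hj
        simp only; omega
    rcases hfree x.val x.isLt h3 h4 with h7 | h7
    · obtain ⟨j, hj⟩ := (htm' _).2 h7
      have hj : t j = x := Fin.ext hj
      rcases lt_trichotomy j i with h | h | h
      · have := h6 j h
        rw [hj] at this
        exact lt_irrefl _ this
      · rw [← hj, h] at h5; exact lt_irrefl _ h5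
      · have := ht h
        rw [hj] at this
        exact lt_asymm this h5
    · exact hgap i x.val x.isLt (hGO _ h7) h5 h1 fun j hj => h6 j hj
  · ext x
    have := hRC x.val
    simpa only [entries, Set.mem_union, Set.mem_sdiff, Set.mem_range, Fin.ext_iff, val_bar,
      val_unb] using this
  · ext x
    have h1 : entries L x.val ↔ (entries C x.val ∧ ¬ ∃ i, (z i).val = x.val) ∨
        ∃ i, (t i).val = x.val := by
      rw [hzm', htm', hCS]
      have h2 := hLZ x.val
      have h3 : T x.val → entries L x.val := fun h => h.2.1
      tauto
    simpa only [entries, Set.mem_union, Set.mem_sdiff, Set.mem_range, Fin.ext_iff, val_bar,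
      val_unb] using h1

theorem outerValues_iff {n k : ℕ} (w : SignedPerm n) (hk : k ≤ n) {y : ℕ} (hy : y < 2 * n) :
    outerValues w k y ↔ ¬ initialValues w k y ∧ ¬ initialValues w k (2 * n - 1 - y) := by
  constructor
  · rintro ⟨l, h1, h2, rfl⟩
    constructor
    · rintro ⟨q, hq, h⟩
      have := value_inj w (by omega) (by omega) h
      omega
    · rintro ⟨q, hq, h⟩
      rw [← value_bar w (by omega)] at h
      have := value_inj w (by omega) (by omega) h
      omega
  · rintro ⟨h1, h2⟩
    obtain ⟨p, hp, rfl⟩ := value_surj w hy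
    refine ⟨p, ?_, ?_, rfl⟩
    · by_contra h; exact h1 ⟨p, by omega, rfl⟩
    · by_contra h; exact h2 ⟨2 * n - 1 - p, by omega, value_bar w hp⟩

open Classical in
theorem cnt_rootsR_self {n k : ℕ} (hk : k ≤ n) (w : SignedPerm n) {R L : Column n k}
    (hR : StrictMono R) (hL : StrictMono L) (hw : ∀ y, initialValues w k y ↔ entries L y) :
    cnt (rootsR n k) w (fun x => ∀ y, initialValues x k y ↔ entries R y) =
      if ∃ C, IsSplitColumn C R L then 1 else 0 := by
  rw [cnt_rootsR k hk w _ fun y hy => entries_lt hy]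
  have hw' : initialValues w k = entries L := funext fun y => propext (hw y)
  have hO : ∀ y < 2 * n, outerValues w k y ↔ ¬ entries L y ∧ ¬ entries L (2 * n - 1 - y) := by
    intro y hy
    rw [outerValues_iff w hk hy, hw']
  rw [hw']
  congr 1
  refine propext ⟨fun h => h.isSplitColumn hR hL ?_ hO, fun ⟨C, h⟩ => h.critR ?_⟩
  · intro x _ h1 h2
    rw [← hw] at h1 h2
    exact initialValues_bar w hk h1 h2
  · intro y hy
    have hy2 : y < 2 * n := by
      obtain ⟨l, h1, h2, rfl⟩ := hy
      exact value_lt w (by omega)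
    exact ⟨hy2, (hO y hy2).1 hy⟩


/-! ### Walks as sequences, column by column -/

/-- The sequence `Q` is a walk in the quantum Bruhat graph along a sublist of `Γ`, which stays
where it is at the labels that it does not use. -/
def IsWalk {n : ℕ} (Γ : List (Letter n × Letter n)) (Q : ℕ → SignedPerm n) : Prop :=
  ∀ q (h : q < Γ.length), Q (q + 1) = Q q ∨
    (QuantumBruhatEdge (Q q) Γ[q] ∧ Q (q + 1) = Q q * reflection Γ[q])

section
variable {n : ℕ} {Γ Γ₁ Γ₂ : List (Letter n × Letter n)} {r : Letter n × Letter n}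
  {Q Q' : ℕ → SignedPerm n} {T : SignedPerm n → Prop}

theorem isWalk_cons : IsWalk (r :: Γ) Q ↔ (Q 1 = Q 0 ∨ (QuantumBruhatEdge (Q 0) r ∧
    Q 1 = Q 0 * reflection r)) ∧ IsWalk Γ (fun q => Q (q + 1)) := by
  constructor
  · intro h
    exact ⟨h 0 (by simp), fun q hq => h (q + 1) (by simpa using hq)⟩
  · rintro ⟨h1, h2⟩ q hq
    cases q with
    | zero => exact h1
    | succ q => exact h2 q (by simpa using hq)

theorem isWalk_append : IsWalk (Γ₁ ++ Γ₂) Q ↔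
    IsWalk Γ₁ Q ∧ IsWalk Γ₂ (fun q => Q (Γ₁.length + q)) := by
  constructor
  · intro h
    refine ⟨fun q hq => ?_, fun q hq => ?_⟩
    · have := h q (by rw [List.length_append]; omega)
      rwa [List.getElem_append_left hq] at this
    · have := h (Γ₁.length + q) (by rw [List.length_append]; omega)
      rw [List.getElem_append_right (by omega)] at this
      simpa [add_assoc] using this
  · rintro ⟨h1, h2⟩ q hq
    by_cases h : q < Γ₁.length
    · rw [List.getElem_append_left h]
      exact h1 q h
    · rw [List.length_append] at hq
      have := h2 (q - Γ₁.length) (by omega)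
      rw [List.getElem_append_right (by omega)]
      simp only at this
      rwa [← add_assoc, show Γ₁.length + (q - Γ₁.length) = q by omega] at this

theorem IsWalk.congr (h : IsWalk Γ Q) (he : ∀ q ≤ Γ.length, Q' q = Q q) : IsWalk Γ Q' := by
  intro q hq
  rw [he q hq.le, he (q + 1) hq]
  exact h q hq

theorem IsWalk.walk (h : IsWalk Γ Q) : Walk Γ (Q 0) (Q Γ.length) := by
  induction Γ generalizing Q with
  | nil => rfl
  | cons r Γ ih =>
    obtain ⟨h1, h2⟩ := isWalk_cons.1 h
    have := ih h2
    rcases h1 with h1 | ⟨h1, h3⟩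
    · exact Or.inl (by simpa [h1] using this)
    · exact Or.inr ⟨h1, by simpa [h3] using this⟩

theorem exists_isWalk {w : SignedPerm n} (h : cnt Γ w T ≠ 0) :
    ∃ Q, Q 0 = w ∧ IsWalk Γ Q ∧ T (Q Γ.length) := by
  induction Γ generalizing w with
  | nil =>
    refine ⟨fun _ => w, rfl, fun q hq => absurd hq (by simp), ?_⟩
    by_contra hT
    exact h (by simp only [cnt, hT, if_false])
  | cons r Γ ih =>
    have hcase : cnt Γ w T ≠ 0 ∨ (QuantumBruhatEdge w r ∧ cnt Γ (w * reflection r) T ≠ 0) := by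
      rw [cnt] at h
      by_cases he : QuantumBruhatEdge w r
      · rw [if_pos he] at h
        by_cases h0 : cnt Γ w T = 0
        · exact Or.inr ⟨he, by omega⟩
        · exact Or.inl h0
      · rw [if_neg he] at h
        exact Or.inl h
    rcases hcase with h | ⟨he, h⟩
    · obtain ⟨Q, h1, h2, h3⟩ := ih h
      exact ⟨fun q => Nat.casesOn q w Q, rfl, isWalk_cons.2 ⟨Or.inl h1, h2⟩, h3⟩
    · obtain ⟨Q, h1, h2, h3⟩ := ih h
      exact ⟨fun q => Nat.casesOn q w Q, rfl, isWalk_cons.2 ⟨Or.inr ⟨he, h1⟩, h2⟩, h3⟩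

/-- If two walks to the target part at some label, both branches of the count are positive, and the
count exceeds one. -/
theorem IsWalk.unique (hQ : IsWalk Γ Q) (hQ' : IsWalk Γ Q') (h0 : Q 0 = Q' 0)
    (hT : T (Q Γ.length)) (hT' : T (Q' Γ.length)) (h : cnt Γ (Q 0) T ≤ 1) :
    ∀ q ≤ Γ.length, Q q = Q' q := by
  induction Γ generalizing Q Q' with
  | nil =>
    intro q hq
    obtain rfl : q = 0 := by simpa using hq
    exact h0
  | cons r Γ ih =>
    obtain ⟨h1, h2⟩ := isWalk_cons.1 hQ
    obtain ⟨h1', h2'⟩ := isWalk_cons.1 hQ'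
    have e1 := cnt_pos h2.walk hT
    have e2 := cnt_pos h2'.walk hT'
    simp only [zero_add] at e1 e2
    rw [← h0] at h1'
    rw [cnt] at h
    have hQ1 : Q 1 = Q' 1 := by
      rcases h1 with h1 | ⟨h1, h3⟩ <;> rcases h1' with h1' | ⟨h1', h3'⟩
      · rw [h1, h1']
      · rw [h1] at e1
        rw [h3'] at e2
        rw [if_pos h1'] at h
        omega
      · rw [h3] at e1
        rw [h1'] at e2
        rw [if_pos h1] at h
        omega
      · rw [h3, h3']
    have hc : cnt Γ (Q 1) T ≤ 1 := by
      rcases h1 with h1 | ⟨h1, h3⟩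
      · rw [h1]; omega
      · rw [h3]; rw [if_pos h1] at h; omega
    have := ih h2 h2' hQ1 hT hT' hc
    intro q hq
    cases q with
    | zero => exact h0
    | succ q => exact this q (by simpa using hq)

theorem exists_isWalk_append (h₁ : IsWalk Γ₁ Q) (h₂ : IsWalk Γ₂ Q') (h : Q' 0 = Q Γ₁.length) :
    ∃ P, IsWalk (Γ₁ ++ Γ₂) P ∧ (∀ q ≤ Γ₁.length, P q = Q q) ∧
      ∀ q, P (Γ₁.length + q) = Q' q := by
  have h3 : ∀ q ≤ Γ₁.length, (if q ≤ Γ₁.length then Q q else Q' (q - Γ₁.length)) = Q q :=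
    fun q hq => if_pos hq
  have h4 : ∀ q, (if Γ₁.length + q ≤ Γ₁.length then Q (Γ₁.length + q)
      else Q' (Γ₁.length + q - Γ₁.length)) = Q' q := by
    intro q
    rw [Nat.add_sub_cancel_left]
    split_ifs with hq
    · obtain rfl : q = 0 := by omega
      exact h.symm
    · rfl
  exact ⟨fun q => if q ≤ Γ₁.length then Q q else Q' (q - Γ₁.length),
    isWalk_append.2 ⟨h₁.congr h3, h₂.congr fun q _ => h4 q⟩, h3, h4⟩
end

/-- The walk `Q` along the chain of a column of height `k` passes through signed permutations
whose first `k` letters are those of the split column `(R, L)`. -/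
def Visits {n k : ℕ} (R L : Column n k) (Q : ℕ → SignedPerm n) : Prop :=
  (∀ y, initialValues (Q (rootsL n k k).length) k y ↔ entries L y) ∧
    ∀ y, initialValues (Q ((rootsL n k k).length + (rootsR n k).length)) k y ↔ entries R y

theorem Visits.congr {n k : ℕ} {R L : Column n k} {Q Q' : ℕ → SignedPerm n} (h : Visits R L Q)
    (he : ∀ q ≤ (gamma n k).reverse.length, Q' q = Q q) : Visits R L Q' := by
  rw [reverse_gamma, List.length_append] at he
  rw [Visits, he _ (by omega), he _ le_rfl]
  exact h

theorem exists_isWalk_gamma {n k : ℕ} (hk : k ≤ n) {C R L : Column n k} (h : IsSplitColumn C R L)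
    (w : SignedPerm n) : ∃ Q, Q 0 = w ∧ IsWalk (gamma n k).reverse Q ∧ Visits R L Q := by
  have hR : StrictMono R := by obtain ⟨-, r, z, t, -, ⟨h, -⟩, -⟩ := h; exact h
  have hL : StrictMono L := by obtain ⟨-, r, z, t, -, -, h, -⟩ := h; exact h
  obtain ⟨Q, h1, h2, h3⟩ := exists_isWalk (ne_of_eq_of_ne
    (cnt_rootsL_self hk w hL.injective h.noPair_left) one_ne_zero)
  obtain ⟨Q', h1', h2', h3'⟩ := exists_isWalk (ne_of_eq_of_ne
    ((cnt_rootsR_self hk _ hR hL h3).trans (if_pos ⟨C, h⟩)) one_ne_zero)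
  obtain ⟨P, h4, h5, h6⟩ := exists_isWalk_append h2 h2' h1'
  refine ⟨P, ?_, ?_, ?_, ?_⟩
  · rw [h5 0 (by omega), h1]
  · rwa [reverse_gamma]
  · rwa [h5 _ le_rfl]
  · rwa [h6]

theorem IsWalk.unique_gamma {n k : ℕ} (hk : k ≤ n) {C R L : Column n k} (h : IsSplitColumn C R L)
    {Q Q' : ℕ → SignedPerm n} (hQ : IsWalk (gamma n k).reverse Q)
    (hQ' : IsWalk (gamma n k).reverse Q') (h0 : Q 0 = Q' 0) (hv : Visits R L Q)
    (hv' : Visits R L Q') : ∀ q ≤ (gamma n k).reverse.length, Q q = Q' q := by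
  have hR : StrictMono R := by obtain ⟨-, r, z, t, -, ⟨h, -⟩, -⟩ := h; exact h
  have hL : StrictMono L := by obtain ⟨-, r, z, t, -, -, h, -⟩ := h; exact h
  rw [reverse_gamma] at hQ hQ' ⊢
  obtain ⟨h1, h2⟩ := isWalk_append.1 hQ
  obtain ⟨h1', h2'⟩ := isWalk_append.1 hQ'
  have e1 := h1.unique h1' h0 (T := fun x => ∀ y, initialValues x k y ↔ entries L y) hv.1 hv'.1
    (cnt_rootsL_self hk _ hL.injective h.noPair_left).le
  have e2 := h2.unique h2' (e1 _ le_rfl) (T := fun x => ∀ y, initialValues x k y ↔ entries R y)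
    hv.2 hv'.2 ((cnt_rootsR_self hk _ hR hL hv.1).trans (if_pos ⟨C, h⟩)).le
  intro q hq
  rw [List.length_append] at hq
  by_cases hq' : q ≤ (rootsL n k k).length
  · exact e1 q hq'
  · have := e2 (q - (rootsL n k k).length) (by omega)
    rwa [show (rootsL n k k).length + (q - (rootsL n k k).length) = q by omega] at this

theorem IsWalk.exists_isSplitColumn {n k : ℕ} (hk : k ≤ n) {R L : Column n k} (hR : StrictMono R)
    (hL : StrictMono L) {Q : ℕ → SignedPerm n} (hQ : IsWalk (gamma n k).reverse Q)
    (hv : Visits R L Q) : ∃ C, IsSplitColumn C R L := by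
  rw [reverse_gamma] at hQ
  obtain ⟨-, h2⟩ := isWalk_append.1 hQ
  have := cnt_pos h2.walk (T := fun x => ∀ y, initialValues x k y ↔ entries R y) hv.2
  simp only [add_zero] at this
  rw [cnt_rootsR_self hk _ hR hL hv.1] at this
  by_contra hC
  rw [if_neg hC] at this
  exact lt_irrefl _ this

/-- The chains of the first `N` columns, read backwards. -/
def columns {n : ℕ} (μ : Fin n → ℕ) (N : ℕ) : List (Letter n × Letter n) :=
  (List.range N).flatMap fun j => (gamma n (height μ j)).reverse

theorem columns_succ {n : ℕ} (μ : Fin n → ℕ) (N : ℕ) :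
    columns μ (N + 1) = columns μ N ++ (gamma n (height μ N)).reverse := by
  simp [columns, List.range_succ]

theorem reverse_chain {n : ℕ} (μ : Fin n → ℕ) : (chain μ).reverse = columns μ (numCols μ) := by
  -- In `chain` the list of column indices is coerced from `Fin` to `ℕ` monadically; this identifies
  -- the coerced list.
  have h : (do let a ← (List.finRange (numCols μ)).reverse; pure a.val) =
      (List.range (numCols μ)).reverse := by
    rw [← List.map_coe_finRange_eq_range, ← List.map_reverse]
    exact List.flatMap_pure_eq_map _ _
  rw [chain, h, List.reverse_flatMap, List.reverse_reverse, columns]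
  rfl

theorem length_columns {n : ℕ} (μ : Fin n → ℕ) (N : ℕ) :
    (columns μ N).length = ∑ j ∈ Finset.range N, (gamma n (height μ j)).length := by
  induction N with
  | zero => simp [columns]
  | succ N ih => rw [columns_succ, List.length_append, ih, Finset.sum_range_succ, List.length_reverse]

/-- This converts positions counted from the left end of the chain into positions of the reversed
chain: the start of a factor is the end of the first `j + 1` columns. -/
theorem segStart_add {n : ℕ} (μ : Fin n → ℕ) (j : Fin (numCols μ)) :
    segStart μ j + (columns μ (j.val + 1)).length = (chain μ).length := by
  rw [← List.length_reverse (as := chain μ), reverse_chain, length_columns, length_columns,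
    ← Finset.sum_range_add_sum_Ico _ (Nat.succ_le_of_lt j.isLt), add_comm, segStart]
  congr 1
  have : Finset.Ico (j.val + 1) (numCols μ) = Finset.Ioo j.val (numCols μ) := by
    ext x; simp
  rw [Nat.succ_eq_add_one, this, ← Fin.map_valEmbedding_Ioi, Finset.sum_map]
  rfl

theorem length_columns_mono {n : ℕ} (μ : Fin n → ℕ) {M N : ℕ} (h : M ≤ N) :
    (columns μ M).length ≤ (columns μ N).length := by
  rw [length_columns, length_columns]
  exact Finset.sum_le_sum_of_subset (Finset.range_mono h)

theorem IsWalk.columns_le {n : ℕ} {μ : Fin n → ℕ} {M N : ℕ} {Q : ℕ → SignedPerm n}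
    (hQ : IsWalk (columns μ N) Q) (h : M ≤ N) : IsWalk (columns μ M) Q := by
  induction N, h using Nat.le_induction with
  | base => exact hQ
  | succ N _ ih =>
    rw [columns_succ] at hQ
    exact ih (isWalk_append.1 hQ).1

theorem exists_isWalk_columns {n : ℕ} (μ : Fin n → ℕ) {τ : Filling μ} (hτ : τ ∈ B μ) (N : ℕ)
    (hN : N ≤ numCols μ) : ∃ Q, Q 0 = 1 ∧ IsWalk (columns μ N) Q ∧
      ∀ j : Fin (numCols μ), j.val < N →
        Visits (τ j).1 (τ j).2 (fun q => Q ((columns μ j.val).length + q)) := by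
  induction N with
  | zero => exact ⟨fun _ => 1, rfl, fun q hq => absurd hq (by simp [columns]), fun j hj => by omega⟩
  | succ N ih =>
    obtain ⟨Q, h1, h2, h3⟩ := ih (by omega)
    obtain ⟨D, hD⟩ := hτ ⟨N, hN⟩
    obtain ⟨Q', h4, h5, h6⟩ := exists_isWalk_gamma (height_le μ N) hD (Q (columns μ N).length)
    obtain ⟨P, h7, h8, h9⟩ := exists_isWalk_append h2 h5 h4
    refine ⟨P, ?_, ?_, fun j hj => ?_⟩
    · rw [h8 0 (by omega), h1]
    · rwa [columns_succ]
    · rcases Nat.lt_succ_iff_lt_or_eq.1 hj with hj | hj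
      · refine (h3 j hj).congr fun q hq => h8 _ ?_
        have := length_columns_mono μ (Nat.succ_le_of_lt hj)
        rw [Nat.succ_eq_add_one, columns_succ, List.length_append] at this
        omega
      · obtain rfl : j = ⟨N, hN⟩ := Fin.ext hj
        exact h6.congr fun q _ => h9 q

theorem IsWalk.unique_columns {n : ℕ} {μ : Fin n → ℕ} {τ : Filling μ} (hτ : τ ∈ B μ) (N : ℕ)
    (hN : N ≤ numCols μ) {Q Q' : ℕ → SignedPerm n} (hQ : IsWalk (columns μ N) Q)
    (hQ' : IsWalk (columns μ N) Q') (h0 : Q 0 = Q' 0)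
    (hv : ∀ j : Fin (numCols μ), j.val < N →
      Visits (τ j).1 (τ j).2 (fun q => Q ((columns μ j.val).length + q)))
    (hv' : ∀ j : Fin (numCols μ), j.val < N →
      Visits (τ j).1 (τ j).2 (fun q => Q' ((columns μ j.val).length + q))) :
    ∀ q ≤ (columns μ N).length, Q q = Q' q := by
  induction N with
  | zero =>
    intro q hq
    obtain rfl : q = 0 := by simpa [columns] using hq
    exact h0
  | succ N ih =>
    rw [columns_succ] at hQ hQ' ⊢
    obtain ⟨h1, h2⟩ := isWalk_append.1 hQ
    obtain ⟨h1', h2'⟩ := isWalk_append.1 hQ'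
    have e1 := ih (by omega) h1 h1' (fun j hj => hv j (by omega)) (fun j hj => hv' j (by omega))
    obtain ⟨D, hD⟩ := hτ ⟨N, hN⟩
    have e2 := h2.unique_gamma (height_le μ N) hD h2' (e1 _ le_rfl) (hv ⟨N, hN⟩ (Nat.lt_succ_self N))
      (hv' ⟨N, hN⟩ (Nat.lt_succ_self N))
    intro q hq
    rw [List.length_append] at hq
    by_cases hq' : q ≤ (columns μ N).length
    · exact e1 q hq'
    · have := e2 (q - (columns μ N).length) (by omega)
      rwa [show (columns μ N).length + (q - (columns μ N).length) = q by omega] at this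

theorem entries_sortColumn {n k : ℕ} (hk : k ≤ n) (u : SignedPerm n) (y : ℕ) :
    entries (sortColumn (firstEntries hk u)) y ↔ initialValues u k y := by
  have hval : ∀ i : Fin k, (firstEntries hk u i).val = value u i.val := by
    intro i
    rw [firstEntries, ← value_coe, val_unb]
    rfl
  constructor
  · rintro ⟨i, rfl⟩
    exact ⟨_, Fin.isLt _, (hval (Tuple.sort (firstEntries hk u) i)).symm⟩
  · rintro ⟨l, hl, rfl⟩
    refine ⟨(Tuple.sort (firstEntries hk u)).symm ⟨l, hl⟩, ?_⟩
    simp only [sortColumn, Function.comp_apply, Equiv.apply_symm_apply]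
    exact hval ⟨l, hl⟩

theorem strictMono_sortColumn {n k : ℕ} (hk : k ≤ n) (u : SignedPerm n) :
    StrictMono (sortColumn (firstEntries hk u)) := by
  refine (Tuple.monotone_sort _).strictMono_of_injective ?_
  refine Function.Injective.comp ?_ (Tuple.sort (firstEntries hk u)).injective
  intro i j h
  have := u.1.injective h
  simpa [unb, Fin.ext_iff] using this

theorem eq_of_entries {n k : ℕ} {C D : Column n k} (hC : StrictMono C) (hD : StrictMono D)
    (h : ∀ y, entries C y ↔ entries D y) : C = D := by
  refine (hC.range_inj hD).1 (Set.ext fun x => ?_)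
  rw [mem_range_iff, mem_range_iff, h]

/-! ### Folding pairs as walks, and the bijection -/

/-- The sequence of the partial products of a folding pair, read backwards. -/
def backwards {n : ℕ} {μ : Fin n → ℕ} (wJ : FoldingPair μ) (q : ℕ) : SignedPerm n :=
  partialProd wJ ((chain μ).length - q)

theorem isWalk_backwards {n : ℕ} {μ : Fin n → ℕ} {wJ : FoldingPair μ}
    (h : IsQuantumBruhatPath wJ) : IsWalk (columns μ (numCols μ)) (backwards wJ) := by
  intro q hq
  simp only [← reverse_chain, List.length_reverse, List.getElem_reverse] at hq ⊢
  set p : Fin (chain μ).length := ⟨(chain μ).length - 1 - q, by omega⟩ with hp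
  have hs := partialProd_succ wJ p
  have e1 : backwards wJ (q + 1) = partialProd wJ p.val := by
    rw [backwards]; congr 1; simp only [hp]; omega
  have e2 : backwards wJ q = partialProd wJ (p.val + 1) := by
    rw [backwards]; congr 1; simp only [hp]; omega
  rw [e1, e2]
  by_cases hpJ : p ∈ wJ.2
  · rw [if_pos hpJ] at hs
    refine Or.inr ⟨h.2 p hpJ, ?_⟩
    rw [hs]
    exact (mul_reflection_cancel _ _).symm
  · rw [if_neg hpJ] at hs
    exact Or.inl hs.symm

theorem visits_backwards_iff {n : ℕ} {μ : Fin n → ℕ} (wJ : FoldingPair μ) (j : Fin (numCols μ))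
    {R L : Column n (height μ j)} (hR : StrictMono R) (hL : StrictMono L) :
    Visits R L (fun q => backwards wJ ((columns μ j.val).length + q)) ↔
      ord (fillingMap wJ) j = (R, L) := by
  have h1 := segStart_add μ j
  have h2 := congrArg List.length (reverse_gamma n (height μ j))
  have h3 : (rootsR n (height μ j)).length = (gammaR n (height μ j)).length := by
    rw [rootsR, List.length_reverse]
  rw [columns_succ, List.length_append] at h1
  rw [List.length_append] at h2
  have e1 : backwards wJ ((columns μ j.val).length + (rootsL n (height μ j) (height μ j)).length) =
      partialProd wJ (segStart μ j + (gammaR n (height μ j)).length) := by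
    rw [backwards]; congr 1; omega
  have e2 : backwards wJ ((columns μ j.val).length + ((rootsL n (height μ j) (height μ j)).length +
      (rootsR n (height μ j)).length)) = partialProd wJ (segStart μ j) := by
    rw [backwards]; congr 1; omega
  have e3 : ord (fillingMap wJ) j =
      (sortColumn (firstEntries (height_le μ j) (partialProd wJ (segStart μ j))),
        sortColumn (firstEntries (height_le μ j)
          (partialProd wJ (segStart μ j + (gammaR n (height μ j)).length)))) := rfl
  rw [Visits, e1, e2, e3, Prod.mk.injEq]
  simp only [← entries_sortColumn (height_le μ j)]
  constructor
  · rintro ⟨h4, h5⟩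
    exact ⟨eq_of_entries (strictMono_sortColumn _ _) hR h5,
      eq_of_entries (strictMono_sortColumn _ _) hL h4⟩
  · rintro ⟨h4, h5⟩
    exact ⟨fun y => by rw [h5], fun y => by rw [h4]⟩

theorem IsSplitColumn.strictMono {n k : ℕ} {C R L : Column n k} (h : IsSplitColumn C R L) :
    StrictMono R ∧ StrictMono L := by
  obtain ⟨-, r, z, t, -, ⟨h1, -⟩, h2, -⟩ := h
  exact ⟨h1, h2⟩

theorem visits_backwards {n : ℕ} {μ : Fin n → ℕ} (wJ : FoldingPair μ) (j : Fin (numCols μ)) :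
    Visits (ord (fillingMap wJ) j).1 (ord (fillingMap wJ) j).2
      (fun q => backwards wJ ((columns μ j.val).length + q)) :=
  (visits_backwards_iff wJ j (strictMono_sortColumn _ _) (strictMono_sortColumn _ _)).2 rfl

theorem ord_fillingMap_mem_B {n : ℕ} {μ : Fin n → ℕ} {wJ : FoldingPair μ}
    (h : IsQuantumBruhatPath wJ) : ord (fillingMap wJ) ∈ B μ := by
  intro j
  have hw := (isWalk_backwards h).columns_le (Nat.succ_le_of_lt j.isLt)
  rw [Nat.succ_eq_add_one, columns_succ] at hw
  exact (isWalk_append.1 hw).2.exists_isSplitColumn (height_le μ j) (strictMono_sortColumn _ _)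
    (strictMono_sortColumn _ _) (visits_backwards wJ j)

theorem backwards_zero {n : ℕ} {μ : Fin n → ℕ} {wJ : FoldingPair μ} (h : IsQuantumBruhatPath wJ) :
    backwards wJ 0 = 1 := h.1

theorem reflection_ne_one {n : ℕ} {r : Letter n × Letter n} (h : IsPositiveRoot r) :
    reflection r ≠ 1 := by
  intro h1
  have := (length_mul_reflection_bound 1 h).1
  rw [h1, mul_one] at this
  exact this rfl

/-- Reflections are not the identity, so `J` can be recovered from the partial products. -/
theorem mem_snd_iff {n : ℕ} {μ : Fin n → ℕ} (wJ : FoldingPair μ) (p : Fin (chain μ).length) :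
    p ∈ wJ.2 ↔ partialProd wJ (p.val + 1) ≠ partialProd wJ p.val := by
  rw [partialProd_succ]
  have := reflection_ne_one (isPositiveRoot_of_mem_chain (List.get_mem (chain μ) p))
  split_ifs with h
  · simpa [h] using this
  · simp [h]

theorem ord_fillingMap_injOn {n : ℕ} (μ : Fin n → ℕ) :
    Set.InjOn (fun wJ : FoldingPair μ => ord (fillingMap wJ)) {wJ | IsQuantumBruhatPath wJ} := by
  intro wJ h wJ' h' he
  simp only [Set.mem_ofPred_eq] at h h' he
  have hv' : ∀ j : Fin (numCols μ), j.val < numCols μ → Visits (ord (fillingMap wJ) j).1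
      (ord (fillingMap wJ) j).2 (fun q => backwards wJ' ((columns μ j.val).length + q)) := by
    intro j _
    rw [he]
    exact visits_backwards wJ' j
  have key := (isWalk_backwards h).unique_columns (ord_fillingMap_mem_B h) _ le_rfl
    (isWalk_backwards h') ((backwards_zero h).trans (backwards_zero h').symm)
    (fun j _ => visits_backwards wJ j) hv'
  rw [← reverse_chain, List.length_reverse] at key
  have hP : ∀ p ≤ (chain μ).length, partialProd wJ p = partialProd wJ' p := by
    intro p hp
    have := key ((chain μ).length - p) (by omega)
    rwa [backwards, backwards, show (chain μ).length - ((chain μ).length - p) = p by omega] at this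
  refine Prod.ext ?_ (Finset.ext fun p => ?_)
  · rw [← partialProd_zero, ← partialProd_zero wJ']
    exact hP 0 (by omega)
  · rw [mem_snd_iff, mem_snd_iff, hP _ p.isLt, hP _ p.isLt.le]

theorem exists_foldingPair {n : ℕ} {μ : Fin n → ℕ} {Q : ℕ → SignedPerm n} (h0 : Q 0 = 1)
    (hQ : IsWalk (columns μ (numCols μ)) Q) : ∃ wJ : FoldingPair μ, IsQuantumBruhatPath wJ ∧
      ∀ q ≤ (chain μ).length, backwards wJ q = Q q := by
  classical
  set m := (chain μ).length with hm
  -- The folding positions are those at which the walk moves, and the initial element is the end of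
  -- the walk.
  set wJ : FoldingPair μ := (Q m, Finset.univ.filter fun p : Fin (chain μ).length =>
    Q (m - p.val) ≠ Q (m - (p.val + 1))) with hwJ
  have hstep : ∀ p : Fin (chain μ).length, p ∈ wJ.2 →
      QuantumBruhatEdge (Q (m - (p.val + 1))) ((chain μ).get p) ∧
        Q (m - p.val) = Q (m - (p.val + 1)) * reflection ((chain μ).get p) := by
    intro p hp
    have hpl := p.isLt
    have hne : Q (m - p.val) ≠ Q (m - (p.val + 1)) := by simpa [hwJ] using hp
    have := hQ (m - (p.val + 1)) (by rw [← reverse_chain, List.length_reverse]; omega)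
    simp only [← reverse_chain, List.getElem_reverse] at this
    have e1 : m - (p.val + 1) + 1 = m - p.val := by omega
    have e2 : (chain μ)[(chain μ).length - 1 - (m - (p.val + 1))]'(by omega) = (chain μ).get p := by
      rw [List.get_eq_getElem]
      congr 1
      omega
    rw [e1, e2] at this
    exact this.resolve_left hne
  have hP : ∀ p ≤ m, partialProd wJ p = Q (m - p) := by
    intro p hp
    induction p with
    | zero => rw [partialProd_zero]; rfl
    | succ p ih =>
      have ih := ih (by omega)
      have := partialProd_succ wJ ⟨p, hp⟩
      simp only at this
      rw [this, ih]
      split_ifs with hpJ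
      · rw [(hstep _ hpJ).2]
        exact mul_reflection_cancel _ _
      · simpa [hwJ] using hpJ
  refine ⟨wJ, ⟨?_, fun p hp => ?_⟩, fun q hq => ?_⟩
  · rw [endElt, hP _ le_rfl, Nat.sub_self, h0]
  · rw [hP _ p.isLt]
    exact (hstep p hp).1
  · rw [backwards, hP _ (by omega)]
    congr 1
    omega

/-- The walk for `τ` is built from `1` column by column; as a folding pair it has the prescribed
sets of first letters at every stage, and sorting turns these sets into the columns of `τ`. -/
theorem ord_fillingMap_surjOn {n : ℕ} (μ : Fin n → ℕ) :
    Set.SurjOn (fun wJ : FoldingPair μ => ord (fillingMap wJ)) {wJ | IsQuantumBruhatPath wJ}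
      (B μ) := by
  intro τ hτ
  obtain ⟨Q, h0, hQ, hv⟩ := exists_isWalk_columns μ hτ _ le_rfl
  obtain ⟨wJ, hwJ, hQ'⟩ := exists_foldingPair h0 hQ
  refine ⟨wJ, hwJ, funext fun j => ?_⟩
  obtain ⟨D, hD⟩ := hτ j
  refine (visits_backwards_iff wJ j hD.strictMono.1 hD.strictMono.2).1
    ((hv j j.isLt).congr fun q hq => hQ' _ ?_)
  have := segStart_add μ j
  rw [columns_succ, List.length_append] at this
  omega

end TypeC

theorem mainTheorem1 (n : ℕ) (μ : Fin n → ℕ) (hμ : Antitone μ) :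
    (∀ wJ : TypeC.FoldingPair μ, wJ ∈ TypeC.FBar μ ↔ TypeC.IsQuantumBruhatPath wJ) ∧
    Set.BijOn (fun wJ : TypeC.FoldingPair μ => TypeC.ord (TypeC.fillingMap wJ))
      (TypeC.FBar μ) (TypeC.B μ) := by
  have h : TypeC.FBar μ = {wJ | TypeC.IsQuantumBruhatPath wJ} :=
    Set.ext TypeC.mem_FBar_iff
  refine ⟨TypeC.mem_FBar_iff, ?_⟩
  rw [h]
  exact ⟨fun wJ hwJ => TypeC.ord_fillingMap_mem_B hwJ, TypeC.ord_fillingMap_injOn μ,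
    TypeC.ord_fillingMap_surjOn μ⟩
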